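/- **Theorem (representation for second-order equations).** Let $a_{ij}\in\mathcal T\{0\}$, $1\le i,j\le n$, be real-valued, i.e. $a_{ij}\in C^\infty([0,\infty))$ and $|a_{ij}^{(\ell)}(t)|\le C_\ell(1+t)^{-\ell}$ for all $\ell\ge 0$, $t\ge 0$, and assume uniform ellipticity: $\sum_{i,j}a_{ij}(t)\xi_i\xi_j\ge C_0|\xi|^2$ for some $C_0>0$ and all $t\ge0$, $\xi\in\mathbb R^n$. Put $$a(t,\xi)=\Big(\sum_{i,j}a_{ij}(t)\xi_i\xi_j\Big)^{1/2},\qquad \vartheta(t,\xi)=\frac1t\int_0^t a(\tau,\xi)\,d\tau ,$$ and for $c>0$ let $\mathcal Z_{\rm hyp}(c)=\{(t,\xi)\in[0,\infty)\times\mathbb R^n:(1+t)|\xi|\ge c\}$ and $\mathcal Z_{\rm pd}(c)=\{(t,\xi)\in[0,\infty)\times\mathbb R^n:(1+t)|\xi|<c\}$. For every integer $k\ge1$ there are a constant $c_k>0$ and functions $b_{j,\pm,\rm hyp}(t,\xi)$, $b_{j,\rm pd}(t,\xi)$, $j=0,1$, smooth in $\xi\in\mathbb R^n$ for every $t\ge0$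 and depending only on the coefficients and on $k$, such that 1. $b_{j,\pm,\rm hyp}$ vanishes outside $\mathcal Z_{\rm hyp}(c_k)$, and for every $\alpha$ with $|\alpha|\le (k-1)/2$ there is a constant $C_\alpha$ with $|D_\xi^\alpha b_{j,\pm,\rm hyp}(t,\xi)|\le C_\alpha|\xi|^{-|\alpha|-j}$ for all $t\ge0$, $\xi\neq0$; 2. $b_{j,\rm pd}$ vanishes outside $\mathcal Z_{\rm pd}(2c_k)$ and satisfies $|b_{j,\rm pd}(t,\xi)|\le C(1+t)^{j}$ for all $t\ge0$, $\xi\in\mathbb R^n$; in particular $b_{0,\rm pd}$ is uniformly bounded; 3. for every $t\ge 0$ and $j=0,1$ the function $\sum_\pm e^{\pm it\vartheta(t,\xi)}b_{j,\pm,\rm hyp}(t,\xi)+b_{j,\rm pd}(t,\xi)$ of $\xi$ is smooth with all derivatives of at most polynomial growth, and every solution $u\in C^2([0,\infty);\mathscr S'(\mathbb R^n))$ (derivatives in $t$ taken in the weak-$*$ sense) of $$\partial_t^2u-\sum_{i,j=1}^n a_{ij}(t)\,\partial_{x_i}\partial_{x_j}u=0,\qquad u(0,\cdot)=u_0,\quad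 u_t(0,\cdot)=u_1,$$ satisfies, for all $t\ge0$, $$\widehat u(t,\xi)=\sum_{j=0,1}\Big(\sum_{\pm}e^{\pm it\vartheta(t,\xi)}\,b_{j,\pm,\rm hyp}(t,\xi)+b_{j,\rm pd}(t,\xi)\Big)\widehat u_j(\xi)$$ as tempered distributions, where $\widehat v(\xi)=\int e^{-ix\cdot\xi}v(x)\,dx$. -/

import Mathlib

open scoped SchwartzMap ContDiff LineDeriv FourierTransform

/-- The class `𝒯{ℓ}`: smooth real functions on `[0, ∞)` with
`|f^(k)(t)| ≤ C_k (1 + t)^(-(ℓ + k))` for all `k`. -/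
def IsSymbolT (ℓ : ℕ) (f : ℝ → ℝ) : Prop :=
  ContDiffOn ℝ ∞ f (Set.Ici 0) ∧
    ∀ k : ℕ, ∃ C : ℝ, ∀ t : ℝ, 0 ≤ t →
      |iteratedDerivWithin k f (Set.Ici 0) t| ≤ C * (1 / (1 + t)) ^ (ℓ + k)

/-- The quadratic form `∑ a_ij(t) ξ_i ξ_j`. -/
noncomputable def symbolForm {n : ℕ} (a : Fin n → Fin n → ℝ → ℝ) (t : ℝ)
    (ξ : EuclideanSpace ℝ (Fin n)) : ℝ :=
  ∑ i, ∑ j, a i j t * ξ i * ξ j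

/-- Uniform ellipticity: `∑ a_ij(t) ξ_i ξ_j ≥ C |ξ|²` with some `C > 0`, for all `t ≥ 0` and `ξ`. -/
def UniformlyElliptic {n : ℕ} (a : Fin n → Fin n → ℝ → ℝ) : Prop :=
  ∃ C : ℝ, 0 < C ∧ ∀ t : ℝ, 0 ≤ t → ∀ ξ : EuclideanSpace ℝ (Fin n),
    C * ‖ξ‖ ^ 2 ≤ symbolForm a t ξ

/-- `a(t, ξ)`, the nonnegative square root of `∑ a_ij(t) ξ_i ξ_j`. -/
noncomputable def symbolRoot {n : ℕ} (a : Fin n → Fin n → ℝ → ℝ) (t : ℝ)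
    (ξ : EuclideanSpace ℝ (Fin n)) : ℝ :=
  Real.sqrt (symbolForm a t ξ)

/-- The phase `ϑ(t, ξ) = (1/t) ∫_0^t a(τ, ξ) dτ`. It enters only through `t ϑ(t, ξ)`, so that its
value at `t = 0` plays no role. -/
noncomputable def phase {n : ℕ} (a : Fin n → Fin n → ℝ → ℝ) (t : ℝ)
    (ξ : EuclideanSpace ℝ (Fin n)) : ℝ :=
  (1 / t) * ∫ τ in (0 : ℝ)..t, symbolRoot a τ ξ

/-- The hyperbolic zone `(1 + t) |ξ| ≥ c` in `[0, ∞) × ℝⁿ`. -/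
def hypZone (n : ℕ) (c : ℝ) : Set (ℝ × EuclideanSpace ℝ (Fin n)) :=
  {p | 0 ≤ p.1 ∧ c ≤ (1 + p.1) * ‖p.2‖}

/-- The pseudo-differential zone, the complement of the hyperbolic zone in `[0, ∞) × ℝⁿ`. -/
def pdZone (n : ℕ) (c : ℝ) : Set (ℝ × EuclideanSpace ℝ (Fin n)) :=
  {p | 0 ≤ p.1 ∧ (1 + p.1) * ‖p.2‖ < c}

/-- The dilation `ξ ↦ (2π)⁻¹ ξ`. -/
noncomputable def dilation (n : ℕ) :
    EuclideanSpace ℝ (Fin n) ≃L[ℝ] EuclideanSpace ℝ (Fin n) :=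
  ContinuousLinearEquiv.smulLeft
    (Units.mk0 ((2 * Real.pi)⁻¹) (inv_ne_zero Real.two_pi_pos.ne') : ℝˣ)

/-- The Fourier transform `φ ↦ ∫ e^{-i x·ξ} φ(x) dx` on Schwartz functions. -/
noncomputable def schwartzFourier (n : ℕ) :
    𝓢(EuclideanSpace ℝ (Fin n), ℂ) →L[ℂ] 𝓢(EuclideanSpace ℝ (Fin n), ℂ) :=
  (SchwartzMap.compCLMOfContinuousLinearEquiv ℂ (dilation n)) ∘L
    (FourierTransform.fourierCLM ℂ 𝓢(EuclideanSpace ℝ (Fin n), ℂ))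

theorem schwartzFourier_apply {n : ℕ} (φ : 𝓢(EuclideanSpace ℝ (Fin n), ℂ))
    (ξ : EuclideanSpace ℝ (Fin n)) :
    schwartzFourier n φ ξ = ∫ x, Complex.exp (-Complex.I * (inner ℝ x ξ : ℝ)) * φ x := by
  have h : schwartzFourier n φ ξ = 𝓕 (φ : EuclideanSpace ℝ (Fin n) → ℂ) ((2 * Real.pi)⁻¹ • ξ) := by
    rw [← SchwartzMap.fourier_coe]
    rfl
  rw [h, Real.fourier_eq']
  refine MeasureTheory.integral_congr_ae (Filter.Eventually.of_forall fun x => ?_)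
  simp only [smul_eq_mul, inner_smul_right]
  congr 2
  push_cast
  field_simp

/-- The Fourier transform `û` of a tempered distribution, `⟨û, φ⟩ = ⟨u, φ̂⟩`, in the convention
`û(ξ) = ∫ e^{-i x·ξ} u(x) dx`. -/
noncomputable def distFourier {n : ℕ} (u : 𝓢'(EuclideanSpace ℝ (Fin n), ℂ)) :
    𝓢'(EuclideanSpace ℝ (Fin n), ℂ) :=
  PointwiseConvergenceCLM.precomp ℂ (schwartzFourier n) u

/-- `u ∈ C²([0, ∞); 𝓢'(ℝⁿ))`, with derivatives in the topology of pointwise convergence on test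
functions, solves `∂_t² u - ∑ a_ij(t) ∂_i ∂_j u = 0`, `u(0) = u₀`, `∂_t u(0) = u₁`, the space
derivatives being those of tempered distributions. -/
structure IsSolution {n : ℕ} (a : Fin n → Fin n → ℝ → ℝ)
    (u₀ u₁ : 𝓢'(EuclideanSpace ℝ (Fin n), ℂ)) (u : ℝ → 𝓢'(EuclideanSpace ℝ (Fin n), ℂ)) :
    Prop where
  contDiffOn : ∀ φ : 𝓢(EuclideanSpace ℝ (Fin n), ℂ),
    ContDiffOn ℝ 2 (fun t => u t φ) (Set.Ici 0)
  equation : ∀ φ : 𝓢(EuclideanSpace ℝ (Fin n), ℂ), ∀ t : ℝ, 0 ≤ t →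
    iteratedDerivWithin 2 (fun s => u s φ) (Set.Ici 0) t =
      ∑ i, ∑ j, (a i j t : ℂ) *
        (∂_{EuclideanSpace.single i (1 : ℝ)} (∂_{EuclideanSpace.single j (1 : ℝ)} (u t))) φ
  initial : u 0 = u₀
  initial_deriv : ∀ φ : 𝓢(EuclideanSpace ℝ (Fin n), ℂ),
    derivWithin (fun t => u t φ) (Set.Ici 0) 0 = u₁ φ

/-- The multiplier `∑_± e^{± i t ϑ(t,ξ)} b_{±,hyp}(t,ξ) + b_pd(t,ξ)`. -/
noncomputable def reprMultiplier {n : ℕ} (a : Fin n → Fin n → ℝ → ℝ)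
    (bhyp : ℤˣ → ℝ → EuclideanSpace ℝ (Fin n) → ℂ) (bpd : ℝ → EuclideanSpace ℝ (Fin n) → ℂ)
    (t : ℝ) (ξ : EuclideanSpace ℝ (Fin n)) : ℂ :=
  (∑ s : ℤˣ, Complex.exp (((s : ℤ) : ℂ) * Complex.I * (t : ℂ) * (phase a t ξ : ℂ)) * bhyp s t ξ)
    + bpd t ξ

/-! The Fourier transform turns the equation into `y'' + q y = 0` with `q(t, ξ) = ∑ a_ij(t) ξ_i
ξ_j`, and the multipliers sought are the fundamental solutions `v_0, v_1` of this ordinary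
differential equation. Since `q` is a polynomial in `ξ`, everything extends to complex `z`: the
Picard series gives entire `v_j`, and every bound on `ξ`-derivatives comes from a sup bound on a
complex ball via Cauchy's estimates. No equation is ever differentiated in `ξ`.

In the hyperbolic zone let `σ = √q`, holomorphic in a complex cone around the nonzero real vectors
by ellipticity. Successive correction of `± iσ` produces `p_± = ± iσ + u_±` with `p' + p² + q = r_±`
and `r_± = O(|ξ|² ((1 + t)|ξ|)^(-(K + 2)))` (`riccatiCorr_symbol`). Here `u_± = -σ'/(2σ)` up to a
time-integrable error (`riccatiCorr_add_symbol`), so `exp ∫ u_±` behaves like `σ^(-1/2)` and is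
bounded above and below on balls of radius `ε|ξ|`. Write `v = w_+ + w_-`, `v' = p_+ w_+ + p_- w_-`.
Then `w_±' = p_± w_±` up to coupling terms with factor `r_±/(p_+ - p_-)`. Hence `w_±` divided by
`exp ∫ p_±` is almost constant in time; the phase `∫ σ` is split off and the rest is the amplitude.

The difficulty is that the coupling contains `exp (∓ 2i ∫ σ)`, which for complex `z` is bounded only
where `|z - ξ| ≲ 1/(1 + t)` (`abs_im_root_le`). Cauchy's estimate there loses `(1 + t)^m` instead of
`|ξ|^(-m)`. The loss is harmless for increments: over a dyadic time interval the normalized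
amplitude changes by `O(((1 + t)|ξ|)^(-(K + 2)) (1 + t))` times the size of the data, so for `m ≤ K`
the derivatives of the increments have the right size with a factor `((1 + t)|ξ|)^(-1)` to spare,
and sum geometrically (`le_of_dyadic_increments`). The starting value, taken when `(1 + t)|ξ| ~ N`,
is controlled on the large ball of radius `ε|ξ|`. This is `exists_norm_iteratedFDeriv_hypAmp_le`.

In the pseudo-differential zone the Picard bound alone gives `|v_j| ≲ (1 + t)^j`. A cutoff in `(1 +
t)ξ` splits `v_j` exactly into the two parts. Both zones together bound `v_j(t, ·)` on complex balls
of fixed radius, hence it is a multiplier of temperate growth (`hasTemperateGrowth_fundSol`).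

For an arbitrary distributional solution `U = û` the representation is a duality argument. The
Wronskian pairing `⟨U', v_j φ⟩ - ⟨U, v_j' φ⟩` is constant in time (`wronskian_const`).
Differentiating such a pairing, in which distribution and test function both move, requires
equicontinuity, supplied by the uniform boundedness principle on the Schwartz space. The identities
for `j = 0, 1` and `v_0 v_1' - v_0' v_1 = 1` then determine `U` from its data (`eq_fundSol`). -/

/-! ### Holomorphic functions of several variables and Cauchy's estimates. -/

open Metric Set Filter Topology MeasureTheory in
/-- Cauchy's estimate for the first derivative of a holomorphic function on a normed space. -/
theorem norm_fderiv_le_of_forall_mem_ball {E : Type*} [NormedAddCommGroup E] [NormedSpace ℂ E]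
    {f : E → ℂ} {x : E} {r M : ℝ} (hr : 0 < r) (hf : DifferentiableOn ℂ f (ball x r))
    (hM : ∀ z ∈ ball x r, ‖f z‖ ≤ M) : ‖fderiv ℂ f x‖ ≤ 2 * M / r := by
  have hM0 : 0 ≤ M := (norm_nonneg _).trans (hM x (mem_ball_self hr))
  refine ContinuousLinearMap.opNorm_le_bound _ (by positivity) fun y => ?_
  rcases eq_or_ne y 0 with rfl | hy
  · simp
  have hy' : 0 < ‖y‖ := norm_pos_iff.2 hy
  -- The one-variable estimate is used on the complex line through `x` in direction `y`. Since `R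
  -- ‖y‖ = r / 2`, the closed disc stays in the open ball; this is the source of the factor 2.
  set R : ℝ := r / (2 * ‖y‖) with hR
  have hR0 : 0 < R := by positivity
  have hmem : ∀ z : ℂ, ‖z‖ ≤ R → x + z • y ∈ ball x r := by
    intro z hz
    rw [mem_ball_iff_norm, add_sub_cancel_left, norm_smul]
    calc ‖z‖ * ‖y‖ ≤ R * ‖y‖ := by gcongr
      _ = r / 2 := by rw [hR]; field_simp
      _ < r := by linarith
  have hline : ∀ z : ℂ, HasDerivAt (fun z : ℂ => x + z • y) y z := fun z => by
    simpa using ((hasDerivAt_id z).smul_const y).const_add x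
  have hdiff : ∀ z : ℂ, ‖z‖ ≤ R →
      HasDerivAt (fun z : ℂ => f (x + z • y)) (fderiv ℂ f (x + z • y) y) z := fun z hz =>
    (((hf.differentiableAt (isOpen_ball.mem_nhds (hmem z hz))).hasFDerivAt).comp_hasDerivAt z
      (hline z))
  have hd : DifferentiableOn ℂ (fun z : ℂ => f (x + z • y)) (closedBall 0 R) := fun z hz =>
    (hdiff z (by simpa using hz)).differentiableAt.differentiableWithinAt
  have key := Complex.norm_deriv_le_of_forall_mem_sphere_norm_le (c := 0) (C := M) hR0
    (hd.diffContOnCl_ball le_rfl) fun z hz => hM _ (hmem z (by simpa using hz.le))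
  rw [(hdiff 0 (by simpa using hR0.le)).deriv] at key
  simp only [zero_smul, add_zero] at key
  refine key.trans (le_of_eq ?_)
  rw [hR]; field_simp

open Metric Set Filter Topology MeasureTheory in
/-- The integral of a locally bounded family of holomorphic functions is holomorphic. -/
theorem differentiableOn_intervalIntegral {E : Type*} [NormedAddCommGroup E] [NormedSpace ℂ E]
    [FiniteDimensional ℂ E] {U : Set E} {F : ℝ → E → ℂ} {a b : ℝ}
    (hF : ∀ s ∈ uIcc a b, DifferentiableOn ℂ (F s) U)
    (hc : ∀ z ∈ U, ContinuousOn (fun s => F s z) (uIcc a b))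
    (hb : ∀ z ∈ U, ∃ r > 0, ∃ M : ℝ, ball z r ⊆ U ∧ ∀ s ∈ uIcc a b, ∀ w ∈ ball z r, ‖F s w‖ ≤ M) :
    DifferentiableOn ℂ (fun z => ∫ s in a..b, F s z) U := by
  intro x hx
  obtain ⟨r, hr, M, hrU, hM⟩ := hb x hx
  have hUx : ∀ y ∈ ball x r, U ∈ 𝓝 y := fun y hy => mem_of_superset (isOpen_ball.mem_nhds hy) hrU
  have hder : ∀ s ∈ uIcc a b, ∀ y ∈ ball x r, HasFDerivAt (F s) (fderiv ℂ (F s) y) y :=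
    fun s hs y hy => ((hF s hs).differentiableAt (hUx y hy)).hasFDerivAt
  have hmeas : ∀ y ∈ U, AEStronglyMeasurable (fun s => F s y) (volume.restrict (uIoc a b)) :=
    fun y hy => ((hc y hy).mono uIoc_subset_uIcc).aestronglyMeasurable measurableSet_uIoc
  have hball : ∀ y ∈ ball x (r / 2), ball y (r / 2) ⊆ ball x r := fun y hy =>
    ball_subset_ball' (by rw [mem_ball] at hy; linarith)
  -- In each basis direction the derivative is a pointwise limit of difference quotients, which are
  -- continuous in `s`; finitely many directions determine the functional.
  have hmeas' : AEStronglyMeasurable (fun s => fderiv ℂ (F s) x)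
      (volume.restrict (uIoc a b)) := by
    let e := Module.finBasis ℂ E
    have hdec : ∀ ℓ : E →L[ℂ] ℂ,
        ℓ = ∑ i, ℓ (e i) • LinearMap.toContinuousLinearMap (e.coord i) := fun ℓ => by
      ext y
      conv_lhs => rw [← e.sum_repr y, map_sum]
      simp [mul_comm]
    have : (fun s => fderiv ℂ (F s) x) = fun s =>
        ∑ i, fderiv ℂ (F s) x (e i) • LinearMap.toContinuousLinearMap (e.coord i) :=
      funext fun s => hdec _
    rw [this]
    refine Finset.aestronglyMeasurable_fun_sum _ fun i _ => AEStronglyMeasurable.smul_const ?_ _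
    obtain ⟨δ, hδ, hδr⟩ : ∃ δ > 0, δ * ‖e i‖ < r :=
      ⟨r / (2 * (‖e i‖ + 1)), by positivity, by
        rw [div_mul_eq_mul_div, div_lt_iff₀ (by positivity)]
        nlinarith [norm_nonneg (e i)]⟩
    let c : ℕ → ℂ := fun m => (((m + 1 : ℝ) / δ : ℝ) : ℂ)
    have hcn : ∀ m, ‖c m‖ = (m + 1 : ℝ) / δ := fun m => by
      simp only [c, Complex.norm_real, Real.norm_eq_abs]
      exact abs_of_pos (by positivity)
    have hmem : ∀ m, x + (c m)⁻¹ • e i ∈ ball x r := fun m => by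
      rw [mem_ball_iff_norm, add_sub_cancel_left, norm_smul, norm_inv, hcn, inv_div]
      refine lt_of_le_of_lt ?_ hδr
      gcongr
      exact div_le_self hδ.le (by linarith [(Nat.cast_nonneg m : (0 : ℝ) ≤ m)])
    refine aestronglyMeasurable_of_tendsto_ae atTop
      (f := fun (m : ℕ) (s : ℝ) => c m • (F s (x + (c m)⁻¹ • e i) - F s x))
      (fun m => AEStronglyMeasurable.const_smul ((hmeas _ (hrU (hmem m))).sub (hmeas _ hx)) (c m)) ?_
    refine (ae_restrict_iff' measurableSet_uIoc).2 (Eventually.of_forall fun s hs => ?_)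
    refine (hder s (uIoc_subset_uIcc hs) x (mem_ball_self hr)).lim (e i) ?_
    simp only [hcn]
    exact (tendsto_natCast_atTop_atTop.atTop_add tendsto_const_nhds).atTop_div_const hδ
  have := intervalIntegral.hasFDerivAt_integral_of_dominated_of_fderiv_le (μ := volume)
    (F := fun y s => F s y) (F' := fun y s => fderiv ℂ (F s) y) (a := a) (b := b)
    (bound := fun _ => 2 * M / (r / 2)) (ball_mem_nhds x (half_pos hr))
    (Filter.mem_of_superset (ball_mem_nhds x hr) fun y hy => hmeas y (hrU hy))
    (hc x hx).intervalIntegrable hmeas'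
    (Eventually.of_forall fun s hs y hy =>
      norm_fderiv_le_of_forall_mem_ball (half_pos hr)
        ((hF s (uIoc_subset_uIcc hs)).mono ((hball y hy).trans hrU))
        fun z hz => hM s (uIoc_subset_uIcc hs) z (hball y hy hz))
    intervalIntegrable_const
    (Eventually.of_forall fun s hs y hy => hder s (uIoc_subset_uIcc hs) y
      (ball_subset_ball (by linarith) hy))
  exact this.differentiableAt.differentiableWithinAt

open Metric Set Filter Topology in
/-- A locally normally convergent series of holomorphic functions is holomorphic. -/
theorem differentiable_tsum_of_forall_norm_le {E : Type*} [NormedAddCommGroup E] [NormedSpace ℂ E]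
    {f : ℕ → E → ℂ} (hf : ∀ m, Differentiable ℂ (f m))
    (hb : ∀ x : E, ∃ r > 0, ∃ u : ℕ → ℝ, Summable u ∧ ∀ m, ∀ z ∈ ball x r, ‖f m z‖ ≤ u m) :
    Differentiable ℂ fun z => ∑' m, f m z := by
  intro x
  obtain ⟨r, hr, u, hu, hM⟩ := hb x
  have hball : ∀ y ∈ ball x (r / 2), ball y (r / 2) ⊆ ball x r := fun y hy =>
    ball_subset_ball' (by rw [mem_ball] at hy; linarith)
  let _ : NormedSpace ℝ E := NormedSpace.restrictScalars ℝ ℂ E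
  refine (hasFDerivAt_tsum_of_isPreconnected (u := fun m => 2 * u m / (r / 2))
    ((hu.mul_left 2).div_const _) (isOpen_ball (x := x) (ε := r / 2))
    (convex_ball x (r / 2)).isPreconnected
    (fun m y _ => (hf m y).hasFDerivAt)
    (fun m y hy => norm_fderiv_le_of_forall_mem_ball (half_pos hr) (hf m).differentiableOn
      fun z hz => hM m z (hball y hy hz)) (mem_ball_self (half_pos hr))
    (.of_norm_bounded hu fun m => hM m x (mem_ball_self hr))
    (mem_ball_self (half_pos hr))).differentiableAt

-- By Cauchy's formula the directional derivative is an integral of `f (w + ζ y) / ζ²` over a circle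
-- whose radius is independent of `w` near `x`, and an integral of a holomorphic family is
-- holomorphic.
open Metric Set Filter Topology MeasureTheory in
theorem differentiableOn_fderiv_apply {E : Type*} [NormedAddCommGroup E] [NormedSpace ℂ E]
    [FiniteDimensional ℂ E] {U : Set E} (hU : IsOpen U) {f : E → ℂ} (hf : DifferentiableOn ℂ f U)
    (y : E) : DifferentiableOn ℂ (fun x => fderiv ℂ f x y) U := by
  intro x hx
  obtain ⟨r₀, hr₀, hr₀U⟩ := Metric.isOpen_iff.1 hU x hx
  obtain ⟨r₁, hr₁, hb⟩ : ∃ r₁ > 0, ∀ z ∈ ball x r₁, ‖f z‖ ≤ ‖f x‖ + 1 := by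
    have := (hf.continuousOn.continuousAt (hU.mem_nhds hx)).norm.eventually
      (gt_mem_nhds (lt_add_one ‖f x‖))
    obtain ⟨r₁, hr₁, h⟩ := Metric.eventually_nhds_iff_ball.1 this
    exact ⟨r₁, hr₁, fun z hz => (h z hz).le⟩
  set r := min r₀ r₁ with hr
  have hr0 : 0 < r := lt_min hr₀ hr₁
  set R : ℝ := r / (2 * (‖y‖ + 1)) with hR
  have hR0 : 0 < R := by positivity
  have hmem : ∀ w ∈ ball x (r / 2), ∀ z : ℂ, ‖z‖ ≤ R → w + z • y ∈ ball x r := by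
    intro w hw z hz
    rw [mem_ball_iff_norm] at hw ⊢
    have h1 : ‖z • y‖ ≤ r / 2 := by
      rw [norm_smul]
      calc ‖z‖ * ‖y‖ ≤ R * (‖y‖ + 1) := by gcongr; linarith
        _ = r / 2 := by rw [hR]; field_simp
    calc ‖w + z • y - x‖ = ‖(w - x) + z • y‖ := by congr 1; abel
      _ ≤ ‖w - x‖ + ‖z • y‖ := norm_add_le _ _
      _ < r := by linarith
  have hrU : ball x r ⊆ U := (ball_subset_ball (min_le_left _ _)).trans hr₀U
  have hdiff : ∀ w ∈ ball x (r / 2), ∀ z : ℂ, ‖z‖ ≤ R →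
      HasDerivAt (fun z : ℂ => f (w + z • y)) (fderiv ℂ f (w + z • y) y) z := fun w hw z hz => by
    refine ((hf.differentiableAt (hU.mem_nhds (hrU (hmem w hw z hz)))).hasFDerivAt).comp_hasDerivAt
      z ?_
    simpa using ((hasDerivAt_id z).smul_const y).const_add w
  have hform : ∀ w ∈ ball x (r / 2), fderiv ℂ f w y = (2 * Real.pi * Complex.I : ℂ)⁻¹ *
      ∫ θ in (0 : ℝ)..2 * Real.pi, deriv (circleMap 0 R) θ *
        ((circleMap 0 R θ ^ 2)⁻¹ * f (w + circleMap 0 R θ • y)) := by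
    intro w hw
    have h := Complex.two_pi_I_inv_smul_circleIntegral_sub_sq_inv_smul_of_differentiable
      (U := {z | w + z • y ∈ U}) (c := 0) (w₀ := 0) (R := R) (f := fun z : ℂ => f (w + z • y))
      (hU.preimage (by fun_prop))
      (fun z hz => hrU (hmem w hw z (by simpa using hz)))
      (fun z hz => ((hf.differentiableAt (hU.mem_nhds hz)).comp z (by fun_prop :
        DifferentiableAt ℂ (fun z : ℂ => w + z • y) z)).differentiableWithinAt)
      (mem_ball_self hR0)
    rw [(hdiff w hw 0 (by simpa using hR0.le)).deriv] at h
    simpa [circleIntegral, smul_eq_mul] using h.symm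
  have hmain : DifferentiableOn ℂ (fun w => ∫ θ in (0 : ℝ)..2 * Real.pi, deriv (circleMap 0 R) θ *
        ((circleMap 0 R θ ^ 2)⁻¹ * f (w + circleMap 0 R θ • y))) (ball x (r / 2)) := by
    have hcm : ∀ θ, ‖circleMap 0 R θ‖ ≤ R := fun θ => by simp [abs_of_pos hR0]
    have hcn : ∀ θ, circleMap 0 R θ ≠ 0 := fun θ => by simp [hR0.ne']
    refine differentiableOn_intervalIntegral (fun θ _ => ?_) (fun w hw => ?_) fun w hw => ?_
    · refine DifferentiableOn.const_mul (DifferentiableOn.const_mul (hf.comp ?_ ?_) _) _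
      · fun_prop
      · exact fun w hw => hrU (hmem w hw _ (hcm θ))
    · refine Continuous.continuousOn ?_
      have h1 : Continuous fun θ : ℝ => f (w + circleMap 0 R θ • y) :=
        hf.continuousOn.comp_continuous
          (continuous_const.add ((continuous_circleMap 0 R).smul continuous_const))
          fun θ => hrU (hmem w hw _ (hcm θ))
      simp only [deriv_circleMap]
      exact ((continuous_circleMap 0 R).mul continuous_const).mul
        ((((continuous_circleMap 0 R).pow 2).inv₀ fun θ => pow_ne_zero 2 (hcn θ)).mul h1)
    · obtain ⟨ρ, hρ, hρs⟩ := Metric.isOpen_iff.1 isOpen_ball w hw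
      refine ⟨ρ, hρ, R * ((R ^ 2)⁻¹ * (‖f x‖ + 1)), hρs, fun θ _ z hz => ?_⟩
      rw [norm_mul, norm_mul, deriv_circleMap]
      have := hb _ (ball_subset_ball (min_le_right _ _) (hmem z (hρs hz) _ (hcm θ)))
      simp only [norm_mul, norm_inv, norm_pow, norm_circleMap_zero, abs_of_pos hR0, Complex.norm_I,
        mul_one]
      gcongr
  have hxb : x ∈ ball x (r / 2) := mem_ball_self (half_pos hr0)
  have h2 := (hmain.const_mul ((2 * Real.pi * Complex.I : ℂ)⁻¹)).differentiableAt
    (isOpen_ball.mem_nhds hxb)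
  refine (h2.congr_of_eventuallyEq ?_).differentiableWithinAt
  filter_upwards [isOpen_ball.mem_nhds hxb] with w hw using hform w hw

/-- Holomorphic functions of several variables are smooth. -/
theorem DifferentiableOn.contDiffOn_complex {E : Type*} [NormedAddCommGroup E] [NormedSpace ℂ E]
    [FiniteDimensional ℂ E] {U : Set E} (hU : IsOpen U) {f : E → ℂ} (hf : DifferentiableOn ℂ f U) :
    ContDiffOn ℂ ∞ f U := by
  refine contDiffOn_infty.2 fun m => ?_
  induction m generalizing f with
  | zero => exact contDiffOn_zero.2 hf.continuousOn
  | succ m ih =>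
    rw [Nat.cast_add, Nat.cast_one, contDiffOn_succ_iff_fderiv_of_isOpen hU]
    refine ⟨hf, fun h => by simp at h, contDiffOn_clm_apply.2 fun y => ?_⟩
    exact ih (differentiableOn_fderiv_apply hU hf y)

open Metric Set Filter Topology in
/-- Cauchy's estimates for the real derivatives of a holomorphic function composed with a real
linear map of norm at most one. -/
theorem norm_iteratedFDeriv_comp_le_of_forall_mem_ball {V E : Type*} [NormedAddCommGroup V]
    [NormedSpace ℝ V] [NormedAddCommGroup E] [NormedSpace ℂ E] [FiniteDimensional ℂ E]
    (L : V →L[ℝ] E) (hL : ∀ y, ‖L y‖ ≤ ‖y‖) (m : ℕ) :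
    ∃ C : ℝ, 0 < C ∧ ∀ (f : E → ℂ) (x : V) (r M : ℝ), 0 < r →
      DifferentiableOn ℂ f (ball (L x) r) → (∀ z ∈ ball (L x) r, ‖f z‖ ≤ M) →
      ‖iteratedFDeriv ℝ m (fun v => f (L v)) x‖ ≤ C * M / r ^ m := by
  induction m with
  | zero =>
    refine ⟨1, one_pos, fun f x r M hr _ hM => ?_⟩
    simpa using hM _ (mem_ball_self hr)
  | succ m ih =>
    obtain ⟨C, hC, ih⟩ := ih
    -- One derivative is spent on the half ball, where the directional derivative is at most `4 M
    -- ‖y‖ / r`; the induction hypothesis with radius `r / 2` contributes the other `2 ^ m`.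
    refine ⟨C * 2 ^ (m + 2), by positivity, fun f x r M hr hf hM => ?_⟩
    have hM0 : 0 ≤ M := (norm_nonneg _).trans (hM _ (mem_ball_self hr))
    have hsmooth : ContDiffOn ℝ ∞ (fun v => f (L v)) (L ⁻¹' ball (L x) r) :=
      ((hf.contDiffOn_complex isOpen_ball).restrict_scalars ℝ).comp L.contDiff.contDiffOn
        fun v hv => hv
    have hopen : IsOpen (L ⁻¹' ball (L x) r) := isOpen_ball.preimage L.continuous
    have hxm : x ∈ L ⁻¹' ball (L x) r := mem_ball_self hr
    have hsm : ContDiffOn ℝ ∞ (fderiv ℝ fun v => f (L v)) (L ⁻¹' ball (L x) r) :=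
      hsmooth.fderiv_of_isOpen hopen (by simp)
    have hsmAt : ContDiffAt ℝ m (fderiv ℝ fun v => f (L v)) x :=
      ((hsm x hxm).contDiffAt (hopen.mem_nhds hxm)).of_le (by exact_mod_cast le_top)
    rw [← norm_iteratedFDeriv_fderiv]
    refine ContinuousMultilinearMap.opNorm_le_bound (by positivity) fun v => ?_
    refine ContinuousLinearMap.opNorm_le_bound _ (by positivity) fun y => ?_
    have heval := (ContinuousLinearMap.apply ℝ ℂ y).iteratedFDeriv_comp_left hsmAt le_rfl
    have heval' : iteratedFDeriv ℝ m (fderiv ℝ fun v => f (L v)) x v y =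
        iteratedFDeriv ℝ m (fun w => fderiv ℝ (fun v => f (L v)) w y) x v :=
      (congrArg (fun T => T v) heval).symm
    rw [heval']
    have hcongr : (fun w => fderiv ℝ (fun v => f (L v)) w y) =ᶠ[𝓝 x]
        fun w => (fun z => fderiv ℂ f z (L y)) (L w) := by
      filter_upwards [hopen.mem_nhds hxm] with w hw
      have h1 : HasFDerivAt f (fderiv ℂ f (L w)) (L w) :=
        (hf.differentiableAt (isOpen_ball.mem_nhds hw)).hasFDerivAt
      exact congrArg (fun T => T y) ((h1.restrictScalars ℝ).comp w L.hasFDerivAt).fderiv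
    rw [(Filter.EventuallyEq.iteratedFDeriv ℝ hcongr m).self_of_nhds]
    have hsub : ∀ z ∈ ball (L x) (r / 2), ball z (r / 2) ⊆ ball (L x) r := fun z hz =>
      ball_subset_ball' (by rw [mem_ball] at hz; linarith)
    have := ih (fun z => fderiv ℂ f z (L y)) x (r / 2) (2 * M / (r / 2) * ‖y‖) (half_pos hr)
      ((differentiableOn_fderiv_apply isOpen_ball hf _).mono (ball_subset_ball (by linarith)))
      fun z hz => ((fderiv ℂ f z).le_opNorm _).trans (by
        gcongr
        · exact norm_fderiv_le_of_forall_mem_ball (half_pos hr) (hf.mono (hsub z hz))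
            fun w hw => hM w (hsub z hz hw)
        · exact hL y)
    refine (ContinuousMultilinearMap.le_opNorm _ _).trans ?_
    calc _ ≤ (C * (2 * M / (r / 2) * ‖y‖) / (r / 2) ^ m) * ∏ i, ‖v i‖ := by gcongr
      _ = _ := by rw [div_pow]; field_simp; ring

/-! ### The Picard series of `y'' + q y = 0`. -/

-- In the norm weighted by `exp (-μ|t|)` each integration from `0` gains `1/μ`, which makes the
-- Picard series converge geometrically on the whole time axis at once.
open MeasureTheory in
theorem norm_integral_le_of_norm_le_exp {h : ℝ → ℂ} {K μ : ℝ} (hμ : 0 < μ)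
    (hK : ∀ s, ‖h s‖ ≤ K * Real.exp (μ * |s|)) (t : ℝ) :
    ‖∫ s in (0 : ℝ)..t, h s‖ ≤ K * Real.exp (μ * |t|) / μ := by
  have hK0 : 0 ≤ K := by
    by_contra! hneg
    have := (norm_nonneg _).trans (hK 0)
    simp at this
    linarith
  have key : ∀ (h : ℝ → ℂ), (∀ s, ‖h s‖ ≤ K * Real.exp (μ * |s|)) → ∀ t : ℝ, 0 ≤ t →
      ‖∫ s in (0 : ℝ)..t, h s‖ ≤ K * Real.exp (μ * |t|) / μ := by
    intro h hK t ht
    have hd : ∀ s : ℝ, HasDerivAt (fun s => K * Real.exp (μ * s) / μ) (K * Real.exp (μ * s)) s := by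
      intro s
      have h1 : HasDerivAt (fun s : ℝ => μ * s) μ s := by simpa using (hasDerivAt_id s).const_mul μ
      convert! (h1.exp.const_mul K).div_const μ using 1
      field_simp
    have hint : ∫ s in (0 : ℝ)..t, K * Real.exp (μ * s) =
        K * Real.exp (μ * t) / μ - K * Real.exp (μ * 0) / μ :=
      intervalIntegral.integral_eq_sub_of_hasDerivAt (fun s _ => hd s)
        (Continuous.intervalIntegrable (by fun_prop) _ _)
    calc ‖∫ s in (0 : ℝ)..t, h s‖ ≤ ∫ s in (0 : ℝ)..t, K * Real.exp (μ * s) := by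
          refine intervalIntegral.norm_integral_le_of_norm_le ht
            (Filter.Eventually.of_forall fun s hs => ?_)
            (Continuous.intervalIntegrable (by fun_prop) _ _)
          simpa [abs_of_pos hs.1] using hK s
      _ ≤ K * Real.exp (μ * |t|) / μ := by
          rw [hint, abs_of_nonneg ht]
          have : 0 ≤ K * Real.exp (μ * 0) / μ := by positivity
          linarith
  rcases le_total 0 t with ht | ht
  · exact key h hK t ht
  · have h1 := key (fun s => h (-s)) (fun s => by simpa using hK (-s)) (-t) (by linarith)
    rw [intervalIntegral.integral_comp_neg, neg_neg, neg_zero, abs_neg] at h1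
    rwa [intervalIntegral.integral_symm, norm_neg]

/-- The terms of the Picard series of `y'' + q y = 0`, `y(0) = α`, `y'(0) = β`. -/
noncomputable def picardTerm {E : Type*} (q : ℝ → E → ℂ) (α β : ℂ) : ℕ → ℝ → E → ℂ
  | 0, t, _ => α + β * t
  | m + 1, t, z => ∫ s in (0 : ℝ)..t, -∫ r in (0 : ℝ)..s, q r z * picardTerm q α β m r z

/-- The derivatives of the terms of the Picard series. -/
noncomputable def picardDeriv {E : Type*} (q : ℝ → E → ℂ) (α β : ℂ) : ℕ → ℝ → E → ℂ
  | 0, _, _ => β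
  | m + 1, t, z => -∫ r in (0 : ℝ)..t, q r z * picardTerm q α β m r z

/-- The solution of `y'' + q y = 0`, `y(0) = α`, `y'(0) = β`. -/
noncomputable def picardSol {E : Type*} (q : ℝ → E → ℂ) (α β : ℂ) (t : ℝ) (z : E) : ℂ :=
  ∑' m, picardTerm q α β m t z

/-- The time derivative of `picardSol`. -/
noncomputable def picardVel {E : Type*} (q : ℝ → E → ℂ) (α β : ℂ) (t : ℝ) (z : E) : ℂ :=
  ∑' m, picardDeriv q α β m t z

section Picard

variable {E : Type*} {q : ℝ → E → ℂ} {α β : ℂ}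

theorem continuous_picardTerm {z : E} (hq : Continuous fun t => q t z) (m : ℕ) :
    Continuous fun t => picardTerm q α β m t z := by
  induction m with
  | zero => simp only [picardTerm]; fun_prop
  | succ m ih =>
    have h1 : Continuous fun s => ∫ r in (0 : ℝ)..s, q r z * picardTerm q α β m r z :=
      intervalIntegral.continuous_primitive
        (fun a b => (hq.mul ih).intervalIntegrable a b) 0
    exact intervalIntegral.continuous_primitive (fun a b => h1.neg.intervalIntegrable a b) 0

theorem hasDerivAt_picardDeriv {z : E} (hq : Continuous fun t => q t z) (m : ℕ) (t : ℝ) :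
    HasDerivAt (fun t => picardDeriv q α β (m + 1) t z) (-(q t z * picardTerm q α β m t z)) t := by
  have hc : Continuous fun r => q r z * picardTerm q α β m r z :=
    hq.mul (continuous_picardTerm hq m)
  exact (intervalIntegral.integral_hasDerivAt_right (hc.intervalIntegrable 0 t)
    (hc.stronglyMeasurableAtFilter _ _) hc.continuousAt).fun_neg

theorem continuous_picardDeriv {z : E} (hq : Continuous fun t => q t z) (m : ℕ) :
    Continuous fun t => picardDeriv q α β m t z := by
  cases m with
  | zero => exact continuous_const
  | succ m => exact continuous_iff_continuousAt.2 fun t => (hasDerivAt_picardDeriv hq m t).continuousAt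

theorem hasDerivAt_picardTerm {z : E} (hq : Continuous fun t => q t z) (m : ℕ) (t : ℝ) :
    HasDerivAt (fun t => picardTerm q α β m t z) (picardDeriv q α β m t z) t := by
  cases m with
  | zero =>
    simp only [picardTerm, picardDeriv]
    simpa using (((hasDerivAt_id t).ofReal_comp).const_mul β).const_add α
  | succ m =>
    have hc : Continuous fun t => picardDeriv q α β (m + 1) t z := continuous_picardDeriv hq (m + 1)
    exact intervalIntegral.integral_hasDerivAt_right (hc.intervalIntegrable 0 t)
      (hc.stronglyMeasurableAtFilter _ _) hc.continuousAt

/-- One Picard step is a multiplication by `q` and two integrations, hence a factor `Q/μ² ≤ 1/2` in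
the weighted norm. `μ` is left free so that it can later be adapted to `|ξ|` or to `1/(1 + t)`. -/
theorem norm_picardTerm_le {z : E} {Q μ G : ℝ} (hQ : ∀ t, ‖q t z‖ ≤ Q) (hμ : 0 < μ)
    (hQμ : 2 * Q ≤ μ ^ 2) (hG : ∀ t : ℝ, ‖α + β * t‖ ≤ G * Real.exp (μ * |t|)) (m : ℕ) :
    (∀ t, ‖picardTerm q α β m t z‖ ≤ G * (1 / 2) ^ m * Real.exp (μ * |t|)) ∧
    ∀ t, ‖picardDeriv q α β (m + 1) t z‖ ≤ μ * G * (1 / 2) ^ (m + 1) * Real.exp (μ * |t|) := by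
  have hQ0 : 0 ≤ Q := (norm_nonneg _).trans (hQ 0)
  have hG0 : 0 ≤ G := by
    have := (norm_nonneg _).trans (hG 0)
    simpa using this
  have step : ∀ m, (∀ t, ‖picardTerm q α β m t z‖ ≤ G * (1 / 2) ^ m * Real.exp (μ * |t|)) →
      ∀ t, ‖picardDeriv q α β (m + 1) t z‖ ≤ μ * G * (1 / 2) ^ (m + 1) * Real.exp (μ * |t|) := by
    intro m hm t
    rw [picardDeriv, norm_neg]
    refine (norm_integral_le_of_norm_le_exp (K := Q * (G * (1 / 2) ^ m)) hμ
      (fun s => ?_) t).trans ?_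
    · rw [norm_mul, mul_assoc]
      gcongr
      exacts [hQ s, hm s]
    · rw [div_le_iff₀ hμ, pow_succ]
      have h1 : 0 ≤ G * (1 / 2) ^ m * Real.exp (μ * |t|) := by positivity
      nlinarith
  induction m with
  | zero =>
    have h0 : ∀ t, ‖picardTerm q α β 0 t z‖ ≤ G * (1 / 2) ^ 0 * Real.exp (μ * |t|) :=
      fun t => by simpa [picardTerm] using hG t
    exact ⟨h0, step 0 h0⟩
  | succ m ih =>
    have h1 : ∀ t, ‖picardTerm q α β (m + 1) t z‖ ≤ G * (1 / 2) ^ (m + 1) * Real.exp (μ * |t|) := by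
      intro t
      refine (norm_integral_le_of_norm_le_exp hμ ih.2 t).trans (le_of_eq ?_)
      field_simp
    exact ⟨h1, step _ h1⟩

theorem norm_picardDeriv_le {z : E} {Q μ G : ℝ} (hQ : ∀ t, ‖q t z‖ ≤ Q) (hμ : 0 < μ)
    (hQμ : 2 * Q ≤ μ ^ 2) (hG : ∀ t : ℝ, ‖α + β * t‖ ≤ G * Real.exp (μ * |t|)) (m : ℕ) (t : ℝ) :
    ‖picardDeriv q α β m t z‖ ≤ (‖β‖ + μ * G * Real.exp (μ * |t|)) * (1 / 2) ^ m := by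
  have hG0 : 0 ≤ G := by
    have := (norm_nonneg _).trans (hG 0)
    simpa using this
  cases m with
  | zero =>
    have : 0 ≤ μ * G * Real.exp (μ * |t|) := by positivity
    simpa [picardDeriv] using this
  | succ m =>
    refine ((norm_picardTerm_le hQ hμ hQμ hG m).2 t).trans ?_
    have : 0 ≤ ‖β‖ * (1 / 2) ^ (m + 1) := by positivity
    linarith

theorem summable_geometric_half_mul (c : ℝ) : Summable fun m : ℕ => c * (1 / 2 : ℝ) ^ m :=
  (summable_geometric_of_lt_one (by norm_num) (by norm_num)).mul_left c

theorem tsum_norm_le_of_le_half_pow {f : ℕ → ℂ} {c : ℝ} (hf : ∀ m, ‖f m‖ ≤ c * (1 / 2) ^ m) :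
    ‖∑' m, f m‖ ≤ 2 * c := by
  refine tsum_of_norm_bounded (?_ : HasSum (fun m : ℕ => c * (1 / 2 : ℝ) ^ m) (2 * c)) hf
  rw [mul_comm]
  exact hasSum_geometric_two.mul_left c

theorem norm_picardSol_le {z : E} {Q μ G : ℝ} (hQ : ∀ t, ‖q t z‖ ≤ Q) (hμ : 0 < μ)
    (hQμ : 2 * Q ≤ μ ^ 2) (hG : ∀ t : ℝ, ‖α + β * t‖ ≤ G * Real.exp (μ * |t|)) (t : ℝ) :
    ‖picardSol q α β t z‖ ≤ 2 * (G * Real.exp (μ * |t|)) :=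
  tsum_norm_le_of_le_half_pow fun m => ((norm_picardTerm_le hQ hμ hQμ hG m).1 t).trans
    (le_of_eq (by ring))

theorem norm_picardVel_le {z : E} {Q μ G : ℝ} (hQ : ∀ t, ‖q t z‖ ≤ Q) (hμ : 0 < μ)
    (hQμ : 2 * Q ≤ μ ^ 2) (hG : ∀ t : ℝ, ‖α + β * t‖ ≤ G * Real.exp (μ * |t|)) (t : ℝ) :
    ‖picardVel q α β t z‖ ≤ 2 * (‖β‖ + μ * G * Real.exp (μ * |t|)) :=
  tsum_norm_le_of_le_half_pow fun m => norm_picardDeriv_le hQ hμ hQμ hG m t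

theorem exists_picard_majorant (α β : ℂ) (Q : ℝ) :
    ∃ μ G : ℝ, 0 < μ ∧ 0 ≤ G ∧ 2 * Q ≤ μ ^ 2 ∧
      ∀ t : ℝ, ‖α + β * t‖ ≤ G * Real.exp (μ * |t|) := by
  refine ⟨|Q| + 1, ‖α‖ + ‖β‖, by positivity, by positivity, ?_, fun t => ?_⟩
  · nlinarith [abs_nonneg Q, le_abs_self Q]
  · have h1 : |t| + 1 ≤ Real.exp |t| := Real.add_one_le_exp _
    have h2 : Real.exp |t| ≤ Real.exp ((|Q| + 1) * |t|) :=
      Real.exp_le_exp.2 (by nlinarith [abs_nonneg Q, abs_nonneg t])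
    calc ‖α + β * t‖ ≤ ‖α‖ + ‖β‖ * |t| := by
          refine (norm_add_le _ _).trans ?_
          rw [norm_mul, Complex.norm_real, Real.norm_eq_abs]
      _ ≤ (‖α‖ + ‖β‖) * (|t| + 1) := by
          nlinarith [norm_nonneg α, norm_nonneg β, abs_nonneg t, mul_nonneg (norm_nonneg α) (abs_nonneg t)]
      _ ≤ _ := by gcongr; exact h1.trans h2

open Metric in
theorem hasDerivAt_picardSol {z : E} {Q : ℝ} (hq : Continuous fun t => q t z)
    (hQ : ∀ t, ‖q t z‖ ≤ Q) (t : ℝ) :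
    HasDerivAt (fun t => picardSol q α β t z) (picardVel q α β t z) t := by
  obtain ⟨μ, G, hμ, hG0, hQμ, hG⟩ := exists_picard_majorant α β Q
  have hmem : t ∈ ball (0 : ℝ) (|t| + 1) := by simp
  refine hasDerivAt_tsum_of_isPreconnected (t := ball (0 : ℝ) (|t| + 1)) (y₀ := t)
    (summable_geometric_half_mul (‖β‖ + μ * G * Real.exp (μ * (|t| + 1)))) isOpen_ball
    (convex_ball _ _).isPreconnected (fun m s _ => hasDerivAt_picardTerm hq m s)
    (fun m s hs => (norm_picardDeriv_le hQ hμ hQμ hG m s).trans ?_) hmem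
    (.of_norm_bounded (summable_geometric_half_mul (G * Real.exp (μ * |t|)))
      fun m => ((norm_picardTerm_le hQ hμ hQμ hG m).1 t).trans (le_of_eq (by ring))) hmem
  have : |s| ≤ |t| + 1 := by simpa using (mem_ball_iff_norm.1 hs).le
  gcongr

open Metric in
theorem hasDerivAt_picardVel {z : E} {Q : ℝ} (hq : Continuous fun t => q t z)
    (hQ : ∀ t, ‖q t z‖ ≤ Q) (t : ℝ) :
    HasDerivAt (fun t => picardVel q α β t z) (-(q t z * picardSol q α β t z)) t := by
  obtain ⟨μ, G, hμ, hG0, hQμ, hG⟩ := exists_picard_majorant α β Q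
  have hQ0 : 0 ≤ Q := (norm_nonneg _).trans (hQ 0)
  have hmem : t ∈ ball (0 : ℝ) (|t| + 1) := by simp
  have hsum : ∀ s, Summable fun m => picardDeriv q α β m s z := fun s =>
    .of_norm_bounded (summable_geometric_half_mul _) fun m => norm_picardDeriv_le hQ hμ hQμ hG m s
  -- The zeroth term is the constant `β`; after it is split off, the velocity term of index `m + 1`
  -- has derivative `-q` times the solution term of index `m`.
  have hvel : (fun t => picardVel q α β t z) =
      fun t => β + ∑' m, picardDeriv q α β (m + 1) t z := funext fun s => by
    rw [picardVel, (hsum s).tsum_eq_zero_add]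
    rfl
  have hder := hasDerivAt_tsum_of_isPreconnected (t := ball (0 : ℝ) (|t| + 1)) (y₀ := t)
    (g := fun m t => picardDeriv q α β (m + 1) t z)
    (g' := fun m t => -(q t z * picardTerm q α β m t z))
    (summable_geometric_half_mul (Q * (G * Real.exp (μ * (|t| + 1))))) isOpen_ball
    (convex_ball _ _).isPreconnected (fun m s _ => hasDerivAt_picardDeriv hq m s)
    (fun m s hs => by
      have hs' : |s| ≤ |t| + 1 := by
        simpa using (mem_ball_iff_norm.1 hs).le
      rw [norm_neg, norm_mul, mul_assoc]
      refine mul_le_mul (hQ s) (((norm_picardTerm_le hQ hμ hQμ hG m).1 s).trans ?_)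
        (norm_nonneg _) hQ0
      calc G * (1 / 2) ^ m * Real.exp (μ * |s|) ≤ G * (1 / 2) ^ m * Real.exp (μ * (|t| + 1)) := by
            gcongr
        _ = _ := by ring) hmem
    ((summable_nat_add_iff 1).2 (hsum t)) hmem
  rw [hvel]
  convert! hder.const_add β using 1
  rw [tsum_neg, tsum_mul_left, picardSol]

theorem picardSol_zero (z : E) : picardSol q α β 0 z = α := by
  rw [picardSol, tsum_eq_single 0]
  · simp [picardTerm]
  · rintro (_ | m) hm
    · exact absurd rfl hm
    · simp [picardTerm]

theorem picardVel_zero (z : E) : picardVel q α β 0 z = β := by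
  rw [picardVel, tsum_eq_single 0]
  · simp [picardDeriv]
  · rintro (_ | m) hm
    · exact absurd rfl hm
    · simp [picardDeriv]

theorem picard_wronskian {z : E} {Q : ℝ} (hq : Continuous fun t => q t z)
    (hQ : ∀ t, ‖q t z‖ ≤ Q) (t : ℝ) :
    picardSol q 1 0 t z * picardVel q 0 1 t z - picardVel q 1 0 t z * picardSol q 0 1 t z = 1 := by
  have hd : ∀ t, HasDerivAt (fun t => picardSol q 1 0 t z * picardVel q 0 1 t z -
      picardVel q 1 0 t z * picardSol q 0 1 t z) 0 t := fun t => by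
    convert! ((hasDerivAt_picardSol (α := 1) (β := 0) hq hQ t).mul
      (hasDerivAt_picardVel (α := 0) (β := 1) hq hQ t)).sub
      ((hasDerivAt_picardVel (α := 1) (β := 0) hq hQ t).mul
      (hasDerivAt_picardSol (α := 0) (β := 1) hq hQ t)) using 1
    ring
  have := is_const_of_deriv_eq_zero (fun t => (hd t).differentiableAt) (fun t => (hd t).deriv) t 0
  simpa [picardSol_zero, picardVel_zero] using this

end Picard

/-! ### Holomorphic dependence of the solutions on the parameter. -/

section PicardHolomorphic

open Metric Set

variable {E : Type*} [NormedAddCommGroup E] {q : ℝ → E → ℂ} {α β : ℂ} {Q : ℝ}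

theorem exists_picard_locally_uniform_majorant (α β : ℂ)
    (hQ : ∀ t z, ‖q t z‖ ≤ Q * ‖z‖ ^ 2) (x : E) :
    ∃ μ G Q' : ℝ, 0 < μ ∧ 0 ≤ G ∧ 2 * Q' ≤ μ ^ 2 ∧
      (∀ t : ℝ, ‖α + β * t‖ ≤ G * Real.exp (μ * |t|)) ∧ ∀ z ∈ ball x 1, ∀ t, ‖q t z‖ ≤ Q' := by
  obtain ⟨μ, G, hμ, hG0, hQμ, hG⟩ := exists_picard_majorant α β (|Q| * (‖x‖ + 1) ^ 2)
  refine ⟨μ, G, _, hμ, hG0, hQμ, hG, fun z hz t => (hQ t z).trans ?_⟩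
  have hz' : ‖z‖ ≤ ‖x‖ + 1 := by
    rw [mem_ball_iff_norm] at hz
    have := norm_le_norm_add_norm_sub' z x
    linarith
  gcongr
  exact le_abs_self Q

variable [NormedSpace ℂ E] [FiniteDimensional ℂ E]

theorem differentiable_picardTerm_and_deriv (hq : ∀ t, Differentiable ℂ (q t))
    (hqc : ∀ z, Continuous fun t => q t z) (hQ : ∀ t z, ‖q t z‖ ≤ Q * ‖z‖ ^ 2) (m : ℕ) :
    (∀ t, Differentiable ℂ (picardTerm q α β m t)) ∧
      ∀ t, Differentiable ℂ (picardDeriv q α β (m + 1) t) := by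
  have step : ∀ m, (∀ t, Differentiable ℂ (picardTerm q α β m t)) →
      ∀ t, Differentiable ℂ (picardDeriv q α β (m + 1) t) := by
    intro m hm t
    refine Differentiable.fun_neg (differentiableOn_univ.1 ?_)
    refine differentiableOn_intervalIntegral (fun s _ => ((hq s).mul (hm s)).differentiableOn)
      (fun z _ => ((hqc z).mul (continuous_picardTerm (hqc z) m)).continuousOn) fun x _ => ?_
    obtain ⟨μ, G, Q', hμ, hG0, hQμ, hG, hQ'⟩ := exists_picard_locally_uniform_majorant α β hQ x
    refine ⟨1, one_pos, |Q'| * (G * (1 / 2) ^ m * Real.exp (μ * |t|)), subset_univ _,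
      fun s hs z hz => ?_⟩
    have hst : |s| ≤ |t| := by
      have := abs_sub_left_of_mem_uIcc hs
      simpa using this
    rw [norm_mul]
    refine mul_le_mul ((hQ' z hz s).trans (le_abs_self _))
      (((norm_picardTerm_le (hQ' z hz) hμ hQμ hG m).1 s).trans ?_) (norm_nonneg _) (abs_nonneg _)
    gcongr
  induction m with
  | zero =>
    have h0 : ∀ t, Differentiable ℂ (picardTerm q α β 0 t) := fun t => by
      simp only [picardTerm]
      exact differentiable_const _
    exact ⟨h0, step 0 h0⟩
  | succ m ih =>
    have h1 : ∀ t, Differentiable ℂ (picardTerm q α β (m + 1) t) := by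
      intro t
      refine differentiableOn_univ.1 (differentiableOn_intervalIntegral
        (F := fun s z => picardDeriv q α β (m + 1) s z) (fun s _ => (ih.2 s).differentiableOn)
        (fun z _ => (continuous_picardDeriv (hqc z) (m + 1)).continuousOn) fun x _ => ?_)
      obtain ⟨μ, G, Q', hμ, hG0, hQμ, hG, hQ'⟩ := exists_picard_locally_uniform_majorant α β hQ x
      refine ⟨1, one_pos, μ * G * (1 / 2) ^ (m + 1) * Real.exp (μ * |t|), subset_univ _,
        fun s hs z hz => ?_⟩
      have hst : |s| ≤ |t| := by
        have := abs_sub_left_of_mem_uIcc hs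
        simpa using this
      refine ((norm_picardTerm_le (hQ' z hz) hμ hQμ hG m).2 s).trans ?_
      gcongr
    exact ⟨h1, step _ h1⟩

theorem differentiable_picardSol (hq : ∀ t, Differentiable ℂ (q t))
    (hqc : ∀ z, Continuous fun t => q t z) (hQ : ∀ t z, ‖q t z‖ ≤ Q * ‖z‖ ^ 2) (t : ℝ) :
    Differentiable ℂ (picardSol q α β t) := by
  refine differentiable_tsum_of_forall_norm_le
    (fun m => (differentiable_picardTerm_and_deriv hq hqc hQ m).1 t) fun x => ?_
  obtain ⟨μ, G, Q', hμ, hG0, hQμ, hG, hQ'⟩ := exists_picard_locally_uniform_majorant α β hQ x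
  exact ⟨1, one_pos, _, summable_geometric_half_mul (G * Real.exp (μ * |t|)), fun m z hz =>
    ((norm_picardTerm_le (hQ' z hz) hμ hQμ hG m).1 t).trans (le_of_eq (by ring))⟩

theorem differentiable_picardVel (hq : ∀ t, Differentiable ℂ (q t))
    (hqc : ∀ z, Continuous fun t => q t z) (hQ : ∀ t z, ‖q t z‖ ≤ Q * ‖z‖ ^ 2) (t : ℝ) :
    Differentiable ℂ (picardVel q α β t) := by
  refine differentiable_tsum_of_forall_norm_le (fun m => ?_) fun x => ?_
  · cases m with
    | zero => exact differentiable_const _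
    | succ m => exact (differentiable_picardTerm_and_deriv hq hqc hQ m).2 t
  · obtain ⟨μ, G, Q', hμ, hG0, hQμ, hG, hQ'⟩ := exists_picard_locally_uniform_majorant α β hQ x
    exact ⟨1, one_pos, _, summable_geometric_half_mul _, fun m z hz =>
      norm_picardDeriv_le (hQ' z hz) hμ hQμ hG m t⟩

end PicardHolomorphic

/-! ### Calculus of holomorphic symbols with time derivatives. -/

section Symbols

open Set

/-- The one-sided time derivative on `[0, ∞)`. -/
noncomputable def timeDeriv {E : Type*} (g : ℝ → E → ℂ) (t : ℝ) (z : E) : ℂ :=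
  derivWithin (fun s => g s z) (Ici 0) t

section NoNorm

variable {E : Type*} {g₁ g₂ q : ℝ → E → ℂ}

theorem timeDeriv_congr {z : E} (h : ∀ t, 0 ≤ t → g₁ t z = g₂ t z) {t : ℝ} (ht : 0 ≤ t) :
    timeDeriv g₁ t z = timeDeriv g₂ t z :=
  derivWithin_congr (fun s hs => h s hs) (h t ht)

theorem timeDeriv_add {z : E} (h₁ : DifferentiableOn ℝ (fun t => g₁ t z) (Ici 0))
    (h₂ : DifferentiableOn ℝ (fun t => g₂ t z) (Ici 0)) {t : ℝ} (ht : 0 ≤ t) :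
    timeDeriv (fun t z => g₁ t z + g₂ t z) t z = timeDeriv g₁ t z + timeDeriv g₂ t z :=
  derivWithin_add (h₁ t ht) (h₂ t ht)

theorem timeDeriv_mul {z : E} (h₁ : DifferentiableOn ℝ (fun t => g₁ t z) (Ici 0))
    (h₂ : DifferentiableOn ℝ (fun t => g₂ t z) (Ici 0)) {t : ℝ} (ht : 0 ≤ t) :
    timeDeriv (fun t z => g₁ t z * g₂ t z) t z =
      timeDeriv g₁ t z * g₂ t z + g₁ t z * timeDeriv g₂ t z :=
  derivWithin_mul (h₁ t ht) (h₂ t ht)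

/-- The square root of a function with values in the slit plane. -/
noncomputable def slitRoot {E : Type*} (q : ℝ → E → ℂ) (t : ℝ) (z : E) : ℂ := Complex.exp (Complex.log (q t z) / 2)

/-- The inverse square root of a function with values in the slit plane. -/
noncomputable def slitRootInv {E : Type*} (q : ℝ → E → ℂ) (t : ℝ) (z : E) : ℂ :=
  Complex.exp (-(Complex.log (q t z) / 2))

theorem slitRoot_mul_slitRootInv (t : ℝ) (z : E) : slitRoot q t z * slitRootInv q t z = 1 := by
  rw [slitRoot, slitRootInv, ← Complex.exp_add, add_neg_cancel, Complex.exp_zero]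

theorem slitRoot_sq {t : ℝ} {z : E} (h : q t z ≠ 0) : slitRoot q t z ^ 2 = q t z := by
  rw [slitRoot, ← Complex.exp_nat_mul, Nat.cast_ofNat, mul_div_cancel₀ _ two_ne_zero,
    Complex.exp_log h]

end NoNorm

variable {E : Type*} [NormedAddCommGroup E] [NormedSpace ℂ E]

/-- Functions on `[0, ∞) × Γ` that are holomorphic in `z`, continuous in `t`, and
`O(|z|^d ((1 + t)|z|)^(-e))` in the region `(1 + t)|z| ≥ 1`. -/
structure HolSymbolBound (Γ : Set E) (d : ℤ) (e : ℕ) (g : ℝ → E → ℂ) : Prop where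
  hol : ∀ t, 0 ≤ t → DifferentiableOn ℂ (g t) Γ
  cont : ∀ z ∈ Γ, ContinuousOn (fun t => g t z) (Ici 0)
  bound : ∃ C : ℝ, 0 ≤ C ∧ ∀ t, 0 ≤ t → ∀ z ∈ Γ, 1 ≤ (1 + t) * ‖z‖ →
    ‖g t z‖ ≤ C * ‖z‖ ^ d * (((1 + t) * ‖z‖)⁻¹) ^ e

/-- Holomorphic symbols with `N` time derivatives, each of which gains a factor `(1 + t)⁻¹`. -/
def HolSymbolN (Γ : Set E) : ℕ → ℤ → ℕ → (ℝ → E → ℂ) → Prop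
  | 0, d, e, g => HolSymbolBound Γ d e g
  | N + 1, d, e, g => HolSymbolBound Γ d e g ∧
      (∀ z ∈ Γ, DifferentiableOn ℝ (fun t => g t z) (Ici 0)) ∧
      HolSymbolN Γ N (d + 1) (e + 1) (timeDeriv g)

/-- Holomorphic symbols of all orders of differentiability in time. -/
def HolSymbol (Γ : Set E) (d : ℤ) (e : ℕ) (g : ℝ → E → ℂ) : Prop := ∀ N, HolSymbolN Γ N d e g

variable {Γ : Set E} {N : ℕ} {d d₁ d₂ : ℤ} {e e₁ e₂ : ℕ} {g g₁ g₂ q : ℝ → E → ℂ}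

theorem HolSymbolN.base (h : HolSymbolN Γ N d e g) : HolSymbolBound Γ d e g := by
  cases N with
  | zero => exact h
  | succ N => exact h.1

theorem HolSymbolN.of_succ (h : HolSymbolN Γ (N + 1) d e g) : HolSymbolN Γ N d e g := by
  induction N generalizing d e g with
  | zero => exact h.1
  | succ N ih => exact ⟨h.1, h.2.1, ih h.2.2⟩

theorem HolSymbolBound.congr (h : HolSymbolBound Γ d e g₁)
    (heq : ∀ t, 0 ≤ t → ∀ z ∈ Γ, g₁ t z = g₂ t z) : HolSymbolBound Γ d e g₂ where
  hol t ht := (h.hol t ht).congr fun z hz => (heq t ht z hz).symm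
  cont z hz := (h.cont z hz).congr fun t ht => (heq t ht z hz).symm
  bound := by
    obtain ⟨C, hC, hb⟩ := h.bound
    exact ⟨C, hC, fun t ht z hz h1 => by rw [← heq t ht z hz]; exact hb t ht z hz h1⟩

theorem HolSymbolN.congr (h : HolSymbolN Γ N d e g₁)
    (heq : ∀ t, 0 ≤ t → ∀ z ∈ Γ, g₁ t z = g₂ t z) : HolSymbolN Γ N d e g₂ := by
  induction N generalizing d e g₁ g₂ with
  | zero => exact HolSymbolBound.congr h heq
  | succ N ih =>
    exact ⟨h.1.congr heq, fun z hz => (h.2.1 z hz).congr fun t ht => (heq t ht z hz).symm,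
      ih h.2.2 fun t ht z hz => timeDeriv_congr (fun s hs => heq s hs z hz) ht⟩

theorem HolSymbolBound.of_le (h : HolSymbolBound Γ d e₁ g) (he : e ≤ e₁) :
    HolSymbolBound Γ d e g where
  hol := h.hol
  cont := h.cont
  bound := by
    obtain ⟨C, hC, hb⟩ := h.bound
    refine ⟨C, hC, fun t ht z hz h1 => (hb t ht z hz h1).trans ?_⟩
    exact mul_le_mul_of_nonneg_left (pow_le_pow_of_le_one (by positivity) (inv_le_one_of_one_le₀ h1) he)
      (by positivity)

theorem HolSymbolN.of_le (h : HolSymbolN Γ N d e₁ g) (he : e ≤ e₁) : HolSymbolN Γ N d e g := by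
  induction N generalizing d e e₁ g with
  | zero => exact HolSymbolBound.of_le h he
  | succ N ih => exact ⟨h.1.of_le he, h.2.1, ih h.2.2 (by omega)⟩

theorem HolSymbolBound.add (h₁ : HolSymbolBound Γ d e g₁) (h₂ : HolSymbolBound Γ d e g₂) :
    HolSymbolBound Γ d e fun t z => g₁ t z + g₂ t z where
  hol t ht := (h₁.hol t ht).add (h₂.hol t ht)
  cont z hz := (h₁.cont z hz).add (h₂.cont z hz)
  bound := by
    obtain ⟨C₁, hC₁, hb₁⟩ := h₁.bound
    obtain ⟨C₂, hC₂, hb₂⟩ := h₂.bound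
    refine ⟨C₁ + C₂, by positivity, fun t ht z hz h1 => (norm_add_le _ _).trans ?_⟩
    linarith [hb₁ t ht z hz h1, hb₂ t ht z hz h1]

theorem HolSymbolN.add (h₁ : HolSymbolN Γ N d e g₁) (h₂ : HolSymbolN Γ N d e g₂) :
    HolSymbolN Γ N d e fun t z => g₁ t z + g₂ t z := by
  induction N generalizing d e g₁ g₂ with
  | zero => exact HolSymbolBound.add h₁ h₂
  | succ N ih =>
    exact ⟨h₁.1.add h₂.1, fun z hz => (h₁.2.1 z hz).add (h₂.2.1 z hz),
      (ih h₁.2.2 h₂.2.2).congr fun t ht z hz =>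
        (timeDeriv_add (h₁.2.1 z hz) (h₂.2.1 z hz) ht).symm⟩

theorem HolSymbolBound.mul (hΓ : ∀ z ∈ Γ, z ≠ 0) (h₁ : HolSymbolBound Γ d₁ e₁ g₁)
    (h₂ : HolSymbolBound Γ d₂ e₂ g₂) :
    HolSymbolBound Γ (d₁ + d₂) (e₁ + e₂) fun t z => g₁ t z * g₂ t z where
  hol t ht := (h₁.hol t ht).mul (h₂.hol t ht)
  cont z hz := (h₁.cont z hz).mul (h₂.cont z hz)
  bound := by
    obtain ⟨C₁, hC₁, hb₁⟩ := h₁.bound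
    obtain ⟨C₂, hC₂, hb₂⟩ := h₂.bound
    refine ⟨C₁ * C₂, by positivity, fun t ht z hz h1 => ?_⟩
    rw [norm_mul, zpow_add₀ (norm_ne_zero_iff.2 (hΓ z hz)), pow_add]
    calc ‖g₁ t z‖ * ‖g₂ t z‖ ≤ _ * _ :=
          mul_le_mul (hb₁ t ht z hz h1) (hb₂ t ht z hz h1) (norm_nonneg _)
            ((norm_nonneg _).trans (hb₁ t ht z hz h1))
      _ = _ := by ring

/-- The indices enter through `hd` and `he` so that both Leibniz terms, in which one factor or the
other has its indices raised by one, fall into the same class during the induction. -/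
theorem HolSymbolN.mul (hΓ : ∀ z ∈ Γ, z ≠ 0) (h₁ : HolSymbolN Γ N d₁ e₁ g₁)
    (h₂ : HolSymbolN Γ N d₂ e₂ g₂) (hd : d = d₁ + d₂) (he : e ≤ e₁ + e₂) :
    HolSymbolN Γ N d e fun t z => g₁ t z * g₂ t z := by
  induction N generalizing d₁ d₂ d e₁ e₂ e g₁ g₂ with
  | zero => subst hd; exact (HolSymbolBound.mul hΓ h₁ h₂).of_le he
  | succ N ih =>
    refine ⟨hd ▸ (h₁.1.mul hΓ h₂.1).of_le he, fun z hz => (h₁.2.1 z hz).mul (h₂.2.1 z hz), ?_⟩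
    have h3 : HolSymbolN Γ N (d + 1) (e + 1) fun t z => timeDeriv g₁ t z * g₂ t z :=
      ih h₁.2.2 h₂.of_succ (by omega) (by omega)
    have h4 : HolSymbolN Γ N (d + 1) (e + 1) fun t z => g₁ t z * timeDeriv g₂ t z :=
      ih h₁.of_succ h₂.2.2 (by omega) (by omega)
    exact (h3.add h4).congr fun t ht z hz =>
      (timeDeriv_mul (h₁.2.1 z hz) (h₂.2.1 z hz) ht).symm

theorem HolSymbolN.zero (N : ℕ) (d : ℤ) (e : ℕ) : HolSymbolN Γ N d e fun _ _ => 0 := by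
  have hb : ∀ (d : ℤ) (e : ℕ), HolSymbolBound Γ d e fun _ _ => 0 := fun d e =>
    ⟨fun t _ => differentiableOn_const 0, fun z _ => continuousOn_const,
      ⟨0, le_rfl, fun t _ z _ _ => by simp⟩⟩
  induction N generalizing d e with
  | zero => exact hb d e
  | succ N ih =>
    exact ⟨hb d e, fun z _ => differentiableOn_const 0,
      (ih (d + 1) (e + 1)).congr fun t _ z _ => by simp [timeDeriv]⟩

theorem HolSymbolN.of_timeDeriv_eq_zero (hg : HolSymbolBound Γ d 0 g)
    (hd : ∀ z ∈ Γ, DifferentiableOn ℝ (fun t => g t z) (Ici 0))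
    (h0 : ∀ t, 0 ≤ t → ∀ z ∈ Γ, timeDeriv g t z = 0) (N : ℕ) : HolSymbolN Γ N d 0 g := by
  cases N with
  | zero => exact hg
  | succ N => exact ⟨hg, hd, (HolSymbolN.zero N _ _).congr fun t ht z hz => (h0 t ht z hz).symm⟩

theorem HolSymbol.const (c : ℂ) : HolSymbol Γ 0 0 fun _ _ => c :=
  HolSymbolN.of_timeDeriv_eq_zero
    ⟨fun t _ => differentiableOn_const c, fun z _ => continuousOn_const,
      ⟨‖c‖, norm_nonneg _, fun t _ z _ _ => by simp⟩⟩ (fun z _ => differentiableOn_const c)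
    (fun t _ z _ => by simp [timeDeriv])

theorem HolSymbol.congr (h : HolSymbol Γ d e g₁)
    (heq : ∀ t, 0 ≤ t → ∀ z ∈ Γ, g₁ t z = g₂ t z) : HolSymbol Γ d e g₂ :=
  fun N => (h N).congr heq

theorem HolSymbol.of_le (h : HolSymbol Γ d e₁ g) (he : e ≤ e₁) : HolSymbol Γ d e g :=
  fun N => (h N).of_le he

theorem HolSymbol.add (h₁ : HolSymbol Γ d e g₁) (h₂ : HolSymbol Γ d e g₂) :
    HolSymbol Γ d e fun t z => g₁ t z + g₂ t z := fun N => (h₁ N).add (h₂ N)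

theorem HolSymbol.mul (hΓ : ∀ z ∈ Γ, z ≠ 0) (h₁ : HolSymbol Γ d₁ e₁ g₁)
    (h₂ : HolSymbol Γ d₂ e₂ g₂) (hd : d = d₁ + d₂) (he : e ≤ e₁ + e₂) :
    HolSymbol Γ d e fun t z => g₁ t z * g₂ t z := fun N => (h₁ N).mul hΓ (h₂ N) hd he

theorem HolSymbol.const_mul (hΓ : ∀ z ∈ Γ, z ≠ 0) (c : ℂ) (h : HolSymbol Γ d e g) :
    HolSymbol Γ d e fun t z => c * g t z :=
  (HolSymbol.const c).mul hΓ h (by simp) (by simp)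

theorem HolSymbol.time_derivative (h : HolSymbol Γ d e g) : HolSymbol Γ (d + 1) (e + 1) (timeDeriv g) :=
  fun N => (h (N + 1)).2.2

theorem HolSymbol.differentiableOn_time (h : HolSymbol Γ d e g) {z : E} (hz : z ∈ Γ) :
    DifferentiableOn ℝ (fun t => g t z) (Ici 0) := (h 1).2.1 z hz

theorem HolSymbol.hasDerivWithinAt (h : HolSymbol Γ d e g) {z : E} (hz : z ∈ Γ) {t : ℝ}
    (ht : 0 ≤ t) : HasDerivWithinAt (fun t => g t z) (timeDeriv g t z) (Ici 0) t :=
  (h.differentiableOn_time hz t ht).hasDerivWithinAt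

theorem HolSymbol.sum {ι : Type*} (s : Finset ι) {G : ι → ℝ → E → ℂ}
    (h : ∀ i ∈ s, HolSymbol Γ d e (G i)) : HolSymbol Γ d e fun t z => ∑ i ∈ s, G i t z := by
  classical
  induction s using Finset.induction_on with
  | empty => exact fun N => by simpa using HolSymbolN.zero N d e
  | insert i s hi ih =>
    simp only [Finset.sum_insert hi]
    exact (h i (Finset.mem_insert_self i s)).add
      (ih fun j hj => h j (Finset.mem_insert_of_mem hj))

/-! ### Square roots of symbols and approximate solutions of the Riccati equation. -/

variable {c : ℝ}

/-- Ellipticity keeps `q` in the right half-plane, so the logarithm is holomorphic. With `τ =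
q^(-1/2)` one has `τ' = -q' τ³ / 2`, and the product rule for symbols closes an induction on the
number of time derivatives. The inverse root is treated first because then `√q = q τ` is a mere
product. -/
theorem holSymbol_slitRootInv (hΓ : ∀ z ∈ Γ, z ≠ 0) (hq : HolSymbol Γ 2 0 q) (hc : 0 < c)
    (hre : ∀ t, 0 ≤ t → ∀ z ∈ Γ, c * ‖z‖ ^ 2 ≤ (q t z).re) : HolSymbol Γ (-1) 0 (slitRootInv q) := by
  have hpos : ∀ t, 0 ≤ t → ∀ z ∈ Γ, 0 < (q t z).re := fun t ht z hz =>
    lt_of_lt_of_le (mul_pos hc (pow_pos (norm_pos_iff.2 (hΓ z hz)) 2)) (hre t ht z hz)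
  have hslit : ∀ t, 0 ≤ t → ∀ z ∈ Γ, q t z ∈ Complex.slitPlane := fun t ht z hz =>
    Or.inl (hpos t ht z hz)
  have hdiff : ∀ t, 0 ≤ t → ∀ z ∈ Γ, HasDerivWithinAt (fun t => slitRootInv q t z)
      (-(1 / 2) * (timeDeriv q t z *
        (slitRootInv q t z * (slitRootInv q t z * slitRootInv q t z))))
      (Ici 0) t := by
    intro t ht z hz
    have h1 := (((hq.hasDerivWithinAt hz ht).clog_real (hslit t ht z hz)).div_const 2).fun_neg.cexp
    have h2 : q t z ≠ 0 := Complex.slitPlane_ne_zero (hslit t ht z hz)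
    convert! h1 using 1
    have h3 : slitRootInv q t z * slitRootInv q t z = (q t z)⁻¹ := by
      rw [slitRootInv, ← Complex.exp_add, ← neg_add, add_halves, Complex.exp_neg,
        Complex.exp_log h2]
    rw [h3, ← slitRootInv]
    field_simp
  have hbase : HolSymbolBound Γ (-1) 0 (slitRootInv q) := by
    refine ⟨fun t ht => ?_, fun z hz t ht => (hdiff t ht z hz).continuousWithinAt,
      ⟨Real.sqrt c⁻¹, Real.sqrt_nonneg _, fun t ht z hz _ => ?_⟩⟩
    · have h1 := ((hq 0).base.hol t ht).clog fun z hz => hslit t ht z hz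
      refine DifferentiableOn.cexp (DifferentiableOn.fun_neg ?_)
      simp only [div_eq_mul_inv]
      exact h1.mul_const _
    · have hz0 : 0 < ‖z‖ := norm_pos_iff.2 (hΓ z hz)
      have h2 : q t z ≠ 0 := Complex.slitPlane_ne_zero (hslit t ht z hz)
      rw [pow_zero, mul_one, zpow_neg_one]
      refine abs_le_of_sq_le_sq' ?_ (by positivity) |>.2
      have h3 : slitRootInv q t z ^ 2 = (q t z)⁻¹ := by
        rw [sq, slitRootInv, ← Complex.exp_add, ← neg_add, add_halves, Complex.exp_neg,
          Complex.exp_log h2]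
      rw [← norm_pow, h3, norm_inv, mul_pow, Real.sq_sqrt (by positivity), inv_pow, ← mul_inv]
      refine inv_anti₀ (by positivity) ((hre t ht z hz).trans ?_)
      exact (le_abs_self _).trans (Complex.abs_re_le_norm _)
  intro N
  induction N with
  | zero => exact hbase
  | succ N ih =>
    refine ⟨hbase, fun z hz t ht => (hdiff t ht z hz).differentiableWithinAt, ?_⟩
    have h1 := ih.mul hΓ (ih.mul hΓ ih rfl le_rfl) rfl le_rfl
    have h2 := ((hq.time_derivative) N).mul hΓ h1 rfl le_rfl
    have h3 := (HolSymbol.const (Γ := Γ) (-(1 / 2)) N).mul hΓ h2 (d := -1 + 1) (e := 0 + 1)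
      (by norm_num) (by norm_num)
    exact h3.congr fun t ht z hz =>
      ((hdiff t ht z hz).derivWithin (uniqueDiffOn_Ici 0 t ht)).symm

theorem holSymbol_slitRoot (hΓ : ∀ z ∈ Γ, z ≠ 0) (hq : HolSymbol Γ 2 0 q) (hc : 0 < c)
    (hre : ∀ t, 0 ≤ t → ∀ z ∈ Γ, c * ‖z‖ ^ 2 ≤ (q t z).re) : HolSymbol Γ 1 0 (slitRoot q) := by
  refine (hq.mul hΓ (holSymbol_slitRootInv hΓ hq hc hre) (d := 1) (e := 0) (by norm_num) le_rfl).congr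
    fun t ht z hz => ?_
  have h2 : q t z ≠ 0 := fun h0 => by
    have := hre t ht z hz
    rw [h0, Complex.zero_re] at this
    exact absurd this (not_le.2 (mul_pos hc (pow_pos (norm_pos_iff.2 (hΓ z hz)) 2)))
  rw [← slitRoot_sq h2, sq, mul_assoc, slitRoot_mul_slitRootInv, mul_one]

/-- The defect `p' + p² + q` of `p = κ σ + u`, where `σ² = q` and `κ² = -1`. -/
noncomputable def riccatiDefect (q : ℝ → E → ℂ) (κ : ℂ) (u : ℝ → E → ℂ) (t : ℝ) (z : E) : ℂ :=
  κ * timeDeriv (slitRoot q) t z + timeDeriv u t z + 2 * κ * slitRoot q t z * u t z + u t z ^ 2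

/-- The lower order terms `u` of the approximate solutions `κ σ + u` of the Riccati equation
`p' + p² + q = 0`, where `σ` is the square root of `q` and `κ² = -1`. -/
noncomputable def riccatiCorr (q : ℝ → E → ℂ) (κ : ℂ) : ℕ → ℝ → E → ℂ
  | 0 => fun _ _ => 0
  | m + 1 => fun t z => riccatiCorr q κ m t z +
      κ / 2 * (slitRootInv q t z * riccatiDefect q κ (riccatiCorr q κ m) t z)

/-- With `r` the current defect, the correction `h = κ r / (2σ)` cancels it to leading order, `2κσh
= -r` by `κ² = -1`. What remains is `h' + 2uh + h²`, and each of these terms has gained one more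
factor `((1 + t)|z|)⁻¹`. -/
theorem riccatiCorr_symbol (hΓ : ∀ z ∈ Γ, z ≠ 0) (hq : HolSymbol Γ 2 0 q) (hc : 0 < c)
    (hre : ∀ t, 0 ≤ t → ∀ z ∈ Γ, c * ‖z‖ ^ 2 ≤ (q t z).re) {κ : ℂ} (hκ : κ ^ 2 = -1) (m : ℕ) :
    HolSymbol Γ 1 1 (riccatiCorr q κ m) ∧
      HolSymbol Γ 2 (m + 1) (riccatiDefect q κ (riccatiCorr q κ m)) := by
  have hσ := holSymbol_slitRoot hΓ hq hc hre
  have hτ := holSymbol_slitRootInv hΓ hq hc hre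
  induction m with
  | zero =>
    have h0 : HolSymbol Γ 1 1 (fun (_ : ℝ) (_ : E) => (0 : ℂ)) := fun N => HolSymbolN.zero N 1 1
    refine ⟨h0, (hσ.time_derivative.const_mul hΓ κ).congr fun t ht z hz => ?_⟩
    simp [riccatiDefect, riccatiCorr, timeDeriv]
  | succ m ih =>
    obtain ⟨hu, hr⟩ := ih
    set u := riccatiCorr q κ m with hudef
    set r := riccatiDefect q κ u with hrdef
    have hh : HolSymbol Γ 1 (m + 1) fun t z => κ / 2 * (slitRootInv q t z * r t z) :=
      (hτ.mul hΓ hr (d := 1) (by norm_num) (by omega)).const_mul hΓ _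
    set h : ℝ → E → ℂ := fun t z => κ / 2 * (slitRootInv q t z * r t z) with hhdef
    have hcorr : riccatiCorr q κ (m + 1) = fun t z => u t z + h t z := rfl
    refine ⟨hu.add (hh.of_le (by omega)), ?_⟩
    have h1 : HolSymbol Γ 2 (m + 2) (timeDeriv h) := hh.time_derivative
    have h2 : HolSymbol Γ 2 (m + 2) fun t z => 2 * (u t z * h t z) :=
      (hu.mul hΓ hh (d := 2) (by norm_num) (by omega)).const_mul hΓ 2
    have h3 : HolSymbol Γ 2 (m + 2) fun t z => h t z * h t z :=
      hh.mul hΓ hh (by norm_num) (by omega)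
    refine ((h1.add h2).add h3).congr fun t ht z hz => ?_
    rw [hcorr, riccatiDefect, timeDeriv_add (hu.differentiableOn_time hz)
      (hh.differentiableOn_time hz) ht]
    have e1 : slitRoot q t z * slitRootInv q t z = 1 := slitRoot_mul_slitRootInv t z
    have e2 : 2 * κ * slitRoot q t z * h t z = -r t z := by
      calc 2 * κ * slitRoot q t z * h t z
          = κ ^ 2 * (slitRoot q t z * slitRootInv q t z) * r t z := by rw [hhdef]; ring
        _ = -r t z := by rw [hκ, e1]; ring
    have e3 : r t z = κ * timeDeriv (slitRoot q) t z + timeDeriv u t z +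
      2 * κ * slitRoot q t z * u t z + u t z ^ 2 := rfl
    linear_combination -e2 + e3

/-- The first correction is exactly `κ² σ'/(2σ) = -σ'/(2σ)`, the logarithmic derivative of
`σ^(-1/2)`. All later ones have index `(1, 2)`, that is `O(1/(|z|(1 + t)²))`, and are integrable in
time. The class `(1, 1)` alone would only give a logarithmically divergent integral. -/
theorem riccatiCorr_add_symbol (hΓ : ∀ z ∈ Γ, z ≠ 0) (hq : HolSymbol Γ 2 0 q) (hc : 0 < c)
    (hre : ∀ t, 0 ≤ t → ∀ z ∈ Γ, c * ‖z‖ ^ 2 ≤ (q t z).re) {κ : ℂ} (hκ : κ ^ 2 = -1) (m : ℕ) :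
    HolSymbol Γ 1 2 fun t z => riccatiCorr q κ (m + 1) t z +
      1 / 2 * (slitRootInv q t z * timeDeriv (slitRoot q) t z) := by
  induction m with
  | zero =>
    have h0 : HolSymbol Γ 1 2 (fun (_ : ℝ) (_ : E) => (0 : ℂ)) := fun N => HolSymbolN.zero N 1 2
    refine h0.congr fun t ht z hz => ?_
    have e0 : timeDeriv (fun (_ : ℝ) (_ : E) => (0 : ℂ)) t z = 0 := by simp [timeDeriv]
    simp only [riccatiCorr, riccatiDefect, e0]
    linear_combination (-(slitRootInv q t z * timeDeriv (slitRoot q) t z) / 2) * hκ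
  | succ m ih =>
    have hr := (riccatiCorr_symbol hΓ hq hc hre hκ (m + 1)).2
    have hh := (((holSymbol_slitRootInv hΓ hq hc hre).mul hΓ hr (d := 1) (e := 2) (by norm_num)
      (by omega))).const_mul hΓ (κ / 2)
    refine (ih.add hh).congr fun t ht z hz => ?_
    rw [riccatiCorr.eq_2 q κ (m + 1)]
    ring

/-- `p = κ σ + u` satisfies `p' + p² + q = r` with `r` the defect. -/
theorem hasDerivWithinAt_riccati (hΓ : ∀ z ∈ Γ, z ≠ 0) (hq : HolSymbol Γ 2 0 q) (hc : 0 < c)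
    (hre : ∀ t, 0 ≤ t → ∀ z ∈ Γ, c * ‖z‖ ^ 2 ≤ (q t z).re) {κ : ℂ} (hκ : κ ^ 2 = -1) (m : ℕ)
    {z : E} (hz : z ∈ Γ) {t : ℝ} (ht : 0 ≤ t) :
    HasDerivWithinAt (fun t => κ * slitRoot q t z + riccatiCorr q κ m t z)
      (riccatiDefect q κ (riccatiCorr q κ m) t z -
        (κ * slitRoot q t z + riccatiCorr q κ m t z) ^ 2 - q t z) (Ici 0) t := by
  have h1 := ((holSymbol_slitRoot hΓ hq hc hre).hasDerivWithinAt hz ht).const_mul κ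
  have h2 := (riccatiCorr_symbol hΓ hq hc hre hκ m).1.hasDerivWithinAt hz ht
  have hq0 : q t z ≠ 0 := fun h0 => by
    have := hre t ht z hz
    rw [h0, Complex.zero_re] at this
    exact absurd this (not_le.2 (mul_pos hc (pow_pos (norm_pos_iff.2 (hΓ z hz)) 2)))
  convert! h1.add h2 using 1
  rw [riccatiDefect]
  have := slitRoot_sq hq0
  linear_combination (-(slitRoot q t z) ^ 2) * hκ + this

end Symbols

/-! ### The symbol of the equation on a complex cone. -/

section QuadraticForm

open Set

/-- The inclusion `ℝⁿ → ℂⁿ`. -/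
noncomputable def complexify (n : ℕ) : EuclideanSpace ℝ (Fin n) →L[ℝ] EuclideanSpace ℂ (Fin n) :=
  LinearMap.toContinuousLinearMap
    { toFun := fun ξ => WithLp.toLp 2 fun i => (ξ i : ℂ)
      map_add' := fun x y => by ext i; simp
      map_smul' := fun c x => by ext i; simp }

@[simp]
theorem complexify_apply {n : ℕ} (ξ : EuclideanSpace ℝ (Fin n)) (i : Fin n) :
    complexify n ξ i = (ξ i : ℂ) := rfl

@[simp]
theorem norm_complexify {n : ℕ} (ξ : EuclideanSpace ℝ (Fin n)) : ‖complexify n ξ‖ = ‖ξ‖ := by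
  simp [EuclideanSpace.norm_eq]

/-- The quadratic form `∑ a_ij(t) z_i z_j` on `ℂⁿ`, constant for negative times. -/
noncomputable def complexForm {n : ℕ} (a : Fin n → Fin n → ℝ → ℝ) (t : ℝ)
    (z : EuclideanSpace ℂ (Fin n)) : ℂ :=
  ∑ i, ∑ j, (a i j (max t 0) : ℂ) * (z i * z j)

/-- The conic neighbourhood of `ℝⁿ \ {0}` in `ℂⁿ` of aperture `ε`. -/
def realCone (n : ℕ) (ε : ℝ) : Set (EuclideanSpace ℂ (Fin n)) :=
  {z | ∃ ξ : EuclideanSpace ℝ (Fin n), ‖z - complexify n ξ‖ < ε * ‖ξ‖}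

variable {n : ℕ} {a : Fin n → Fin n → ℝ → ℝ}

theorem complexForm_complexify {t : ℝ} (ht : 0 ≤ t) (ξ : EuclideanSpace ℝ (Fin n)) :
    complexForm a t (complexify n ξ) = (symbolForm a t ξ : ℂ) := by
  simp [complexForm, symbolForm, max_eq_left ht, mul_assoc]

theorem differentiable_complexForm (t : ℝ) : Differentiable ℂ (complexForm a t) := by
  unfold complexForm
  fun_prop

theorem IsSymbolT.continuous_max {f : ℝ → ℝ} {ℓ : ℕ} (hf : IsSymbolT ℓ f) :
    Continuous fun t => f (max t 0) :=
  hf.1.continuousOn.comp_continuous (by fun_prop) fun t => le_max_right t 0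

theorem continuous_complexForm (ha : ∀ i j, IsSymbolT 0 (a i j)) (z : EuclideanSpace ℂ (Fin n)) :
    Continuous fun t => complexForm a t z := by
  unfold complexForm
  refine continuous_finsetSum _ fun i _ => continuous_finsetSum _ fun j _ => ?_
  exact (Complex.continuous_ofReal.comp (ha i j).continuous_max).mul continuous_const

theorem norm_sum_sum_mul_le {b : Fin n → Fin n → ℂ} {B : ℝ} (hB : 0 ≤ B)
    (hb : ∀ i j, ‖b i j‖ ≤ B) (z w : EuclideanSpace ℂ (Fin n)) :
    ‖∑ i, ∑ j, b i j * (z i * w j)‖ ≤ (n * n * B) * (‖z‖ * ‖w‖) := by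
  refine (norm_sum_le _ _).trans ?_
  calc ∑ i, ‖∑ j, b i j * (z i * w j)‖ ≤ ∑ _i : Fin n, ∑ _j : Fin n, B * (‖z‖ * ‖w‖) := by
        refine Finset.sum_le_sum fun i _ => (norm_sum_le _ _).trans
          (Finset.sum_le_sum fun j _ => ?_)
        rw [norm_mul, norm_mul]
        gcongr
        exacts [hb i j, PiLp.norm_apply_le z i, PiLp.norm_apply_le w j]
    _ = _ := by simp; ring

theorem exists_bound_coeff (ha : ∀ i j, IsSymbolT 0 (a i j)) :
    ∃ A : ℝ, 0 ≤ A ∧ (∀ i j t, |a i j (max t 0)| ≤ A) ∧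
      ∀ i j s t, 0 ≤ s → 0 ≤ t → |a i j s - a i j t| ≤ A * |s - t| := by
  have h0 : ∀ i j, ∃ C : ℝ, 0 ≤ C ∧ (∀ t, |a i j (max t 0)| ≤ C) ∧
      ∀ s t, 0 ≤ s → 0 ≤ t → |a i j s - a i j t| ≤ C * |s - t| := by
    intro i j
    obtain ⟨C₀, hC₀⟩ := (ha i j).2 0
    obtain ⟨C₁, hC₁⟩ := (ha i j).2 1
    refine ⟨max |C₀| |C₁|, by positivity, fun t => ?_, fun s t hs ht => ?_⟩
    · have := hC₀ (max t 0) (le_max_right _ _)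
      simp only [iteratedDerivWithin_zero, pow_zero, add_zero, mul_one] at this
      exact this.trans ((le_abs_self _).trans (le_max_left _ _))
    · have hd : DifferentiableOn ℝ (a i j) (Ici 0) := (ha i j).1.differentiableOn (by simp)
      refine (convex_Ici (0 : ℝ)).norm_image_sub_le_of_norm_derivWithin_le hd (fun r hr => ?_) ht hs
      have := hC₁ r hr
      rw [iteratedDerivWithin_one] at this
      refine this.trans ?_
      have hr' : (0 : ℝ) ≤ r := hr
      calc C₁ * (1 / (1 + r)) ^ (0 + 1) ≤ |C₁| * 1 := by
            refine mul_le_mul (le_abs_self _) ?_ (by positivity) (abs_nonneg _)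
            rw [zero_add, pow_one, div_le_one (by positivity)]
            linarith
        _ ≤ max |C₀| |C₁| := by rw [mul_one]; exact le_max_right _ _
  choose C hC0 hC1 hC2 using h0
  have hle : ∀ i j, C i j ≤ ∑ i, ∑ j, C i j := fun i j =>
    (Finset.single_le_sum (f := fun j => C i j) (fun j _ => hC0 i j) (Finset.mem_univ j)).trans
      (Finset.single_le_sum (f := fun i => ∑ j, C i j)
        (fun i _ => Finset.sum_nonneg fun j _ => hC0 i j) (Finset.mem_univ i))
  refine ⟨∑ i, ∑ j, C i j, Finset.sum_nonneg fun i _ => Finset.sum_nonneg fun j _ => hC0 i j,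
    fun i j t => (hC1 i j t).trans (hle i j), fun i j s t hs ht => (hC2 i j s t hs ht).trans ?_⟩
  gcongr
  exact hle i j

/-- The increment in `z` splits as `B(z, z) - B(w, w) = B(z - w, z) + B(w, z - w)`, which needs no
symmetry of the coefficients. The Lipschitz bound in time serves the Taylor remainders of the
velocities. -/
theorem exists_bound_complexForm (ha : ∀ i j, IsSymbolT 0 (a i j)) :
    ∃ M : ℝ, 0 < M ∧ (∀ t z, ‖complexForm a t z‖ ≤ M * ‖z‖ ^ 2) ∧
      (∀ t z w, ‖complexForm a t z - complexForm a t w‖ ≤ M * (‖z - w‖ * (‖z‖ + ‖w‖))) ∧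
      ∀ s t, 0 ≤ s → 0 ≤ t → ∀ z,
        ‖complexForm a s z - complexForm a t z‖ ≤ M * |s - t| * ‖z‖ ^ 2 := by
  obtain ⟨A, hA0, hA, hA'⟩ := exists_bound_coeff ha
  have hAc : ∀ t i j, ‖(a i j (max t 0) : ℂ)‖ ≤ A := fun t i j => by
    rw [Complex.norm_real]; exact hA i j t
  refine ⟨n * n * A + 1, by positivity, fun t z => ?_, fun t z w => ?_, fun s t hs ht z => ?_⟩
  · have := norm_sum_sum_mul_le hA0 (hAc t) z z
    rw [complexForm]
    nlinarith [sq_nonneg ‖z‖]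
  · have e : complexForm a t z - complexForm a t w =
        ∑ i, ∑ j, (a i j (max t 0) : ℂ) * ((z - w) i * z j) +
          ∑ i, ∑ j, (a i j (max t 0) : ℂ) * (w i * (z - w) j) := by
      simp only [complexForm, ← Finset.sum_sub_distrib, ← Finset.sum_add_distrib, PiLp.sub_apply]
      refine Finset.sum_congr rfl fun i _ => Finset.sum_congr rfl fun j _ => by ring
    rw [e]
    refine (norm_add_le _ _).trans ?_
    have h1 := norm_sum_sum_mul_le hA0 (hAc t) (z - w) z
    have h2 := norm_sum_sum_mul_le hA0 (hAc t) w (z - w)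
    have h3 : 0 ≤ ‖z - w‖ * (‖z‖ + ‖w‖) := by positivity
    nlinarith
  · have e : complexForm a s z - complexForm a t z =
        ∑ i, ∑ j, ((a i j (max s 0) - a i j (max t 0) : ℝ) : ℂ) * (z i * z j) := by
      simp only [complexForm, ← Finset.sum_sub_distrib]
      refine Finset.sum_congr rfl fun i _ => Finset.sum_congr rfl fun j _ => by push_cast; ring
    rw [e]
    have h1 := norm_sum_sum_mul_le (b := fun i j => ((a i j (max s 0) - a i j (max t 0) : ℝ) : ℂ))
      (B := A * |s - t|) (by positivity) (fun i j => by
        rw [Complex.norm_real, max_eq_left hs, max_eq_left ht]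
        exact hA' i j s t hs ht) z z
    refine h1.trans ?_
    have h3 : 0 ≤ |s - t| * ‖z‖ ^ 2 := by positivity
    nlinarith

theorem norm_bounds_of_mem_ball {ε : ℝ} (hε : ε ≤ 1 / 2) {z : EuclideanSpace ℂ (Fin n)}
    {ξ : EuclideanSpace ℝ (Fin n)} (hz : ‖z - complexify n ξ‖ < ε * ‖ξ‖) :
    ‖ξ‖ / 2 < ‖z‖ ∧ ‖z‖ < 2 * ‖ξ‖ ∧ 0 < ‖ξ‖ := by
  have h1 : ‖z - complexify n ξ‖ < 1 / 2 * ‖ξ‖ := hz.trans_le (by gcongr)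
  have h2 : ‖ξ‖ ≤ ‖z‖ + ‖z - complexify n ξ‖ := by
    have := norm_le_norm_add_norm_sub z (complexify n ξ)
    rwa [norm_complexify] at this
  have h3 : ‖z‖ ≤ ‖ξ‖ + ‖z - complexify n ξ‖ := by
    have := norm_le_norm_add_norm_sub' z (complexify n ξ)
    rwa [norm_complexify] at this
  have h4 := norm_nonneg (z - complexify n ξ)
  refine ⟨by linarith, by linarith, by linarith⟩

theorem ne_zero_of_mem_realCone {ε : ℝ} (hε : ε ≤ 1 / 2) {z : EuclideanSpace ℂ (Fin n)}
    (hz : z ∈ realCone n ε) : z ≠ 0 := by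
  obtain ⟨ξ, hξ⟩ := hz
  obtain ⟨h1, -, h3⟩ := norm_bounds_of_mem_ball hε hξ
  exact norm_pos_iff.1 (by linarith)

theorem exists_elliptic_cone (ha : ∀ i j, IsSymbolT 0 (a i j)) (hell : UniformlyElliptic a) :
    ∃ ε c : ℝ, 0 < ε ∧ ε ≤ 1 / 2 ∧ 0 < c ∧
      ∀ t, 0 ≤ t → ∀ z ∈ realCone n ε, c * ‖z‖ ^ 2 ≤ (complexForm a t z).re := by
  obtain ⟨M, hM, -, hM2, -⟩ := exists_bound_complexForm ha
  obtain ⟨C, hC, hell⟩ := hell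
  -- On the cone `‖z‖ + ‖ξ‖ ≤ 3 ‖ξ‖`, so leaving the real space costs at most `M · C/(6M) · 3 ‖ξ‖² =
  -- C ‖ξ‖² / 2`. The other half is at least `C ‖z‖² / 8` because `‖z‖ ≤ 2 ‖ξ‖`.
  refine ⟨min (1 / 2) (C / (6 * M)), C / 8, by positivity, min_le_left _ _, by positivity,
    fun t ht z ⟨ξ, hξ⟩ => ?_⟩
  obtain ⟨-, h2, h3⟩ := norm_bounds_of_mem_ball (min_le_left _ _) hξ
  have h4 : ‖z - complexify n ξ‖ ≤ C / (6 * M) * ‖ξ‖ :=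
    hξ.le.trans (by gcongr; exact min_le_right _ _)
  have h5 := hM2 t z (complexify n ξ)
  rw [norm_complexify] at h5
  have h6 : ‖complexForm a t z - complexForm a t (complexify n ξ)‖ ≤ C / 2 * ‖ξ‖ ^ 2 := by
    refine h5.trans ?_
    calc M * (‖z - complexify n ξ‖ * (‖z‖ + ‖ξ‖))
        ≤ M * (C / (6 * M) * ‖ξ‖ * (3 * ‖ξ‖)) := by gcongr; linarith
      _ = _ := by field_simp; norm_num
  have h7 := (abs_le.1 ((Complex.abs_re_le_norm _).trans h6)).1
  rw [Complex.sub_re, complexForm_complexify ht, Complex.ofReal_re] at h7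
  have h8 := hell t ht ξ
  have h9 : ‖z‖ ^ 2 ≤ 4 * ‖ξ‖ ^ 2 := by nlinarith [norm_nonneg z]
  nlinarith

/-- Decay in time alone is a symbol estimate since `(1 + t)^(-l) = |z|^l ((1 + t)|z|)^(-l)`. All
derivatives of `f` are treated simultaneously because the induction on `N` passes from `l` to `l +
1`. -/
theorem holSymbolN_coeff {Γ : Set (EuclideanSpace ℂ (Fin n))} (hΓ : ∀ z ∈ Γ, z ≠ 0) {f : ℝ → ℝ}
    (hf : IsSymbolT 0 f) (N l : ℕ) :
    HolSymbolN Γ N l l fun t _ => ((iteratedDerivWithin l f (Ici 0) t : ℝ) : ℂ) := by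
  have hd : ∀ l, DifferentiableOn ℝ (iteratedDerivWithin l f (Ici 0)) (Ici 0) := fun l =>
    hf.1.differentiableOn_iteratedDerivWithin (by exact_mod_cast WithTop.coe_lt_top l)
      (uniqueDiffOn_Ici 0)
  have hbase : ∀ l : ℕ, HolSymbolBound Γ l l fun t _ =>
      ((iteratedDerivWithin l f (Ici 0) t : ℝ) : ℂ) := by
    intro l
    obtain ⟨C, hC⟩ := hf.2 l
    refine ⟨fun t _ => differentiableOn_const _, fun z _ =>
      Complex.continuous_ofReal.comp_continuousOn (hd l).continuousOn,
      ⟨|C|, abs_nonneg C, fun t ht z hz _ => ?_⟩⟩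
    rw [Complex.norm_real, Real.norm_eq_abs]
    refine (hC t ht).trans ?_
    have hz0 : ‖z‖ ≠ 0 := norm_ne_zero_iff.2 (hΓ z hz)
    rw [zero_add, zpow_natCast, mul_assoc, ← mul_pow, mul_inv, mul_comm ‖z‖, mul_assoc,
      inv_mul_cancel₀ hz0, mul_one, one_div]
    gcongr
    exact le_abs_self C
  induction N generalizing l with
  | zero => exact hbase l
  | succ N ih =>
    refine ⟨hbase l, fun z _ t ht => ((hd l t ht).hasDerivWithinAt.ofReal_comp).differentiableWithinAt,
      ?_⟩
    have := ih (l + 1)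
    rw [Nat.cast_add, Nat.cast_one] at this
    refine this.congr fun t ht z _ => ?_
    rw [timeDeriv, ((hd l t ht).hasDerivWithinAt.ofReal_comp).derivWithin
      (uniqueDiffOn_Ici (0 : ℝ) t ht), iteratedDerivWithin_succ]

theorem holSymbol_complexForm {Γ : Set (EuclideanSpace ℂ (Fin n))} (hΓ : ∀ z ∈ Γ, z ≠ 0)
    (ha : ∀ i j, IsSymbolT 0 (a i j)) : HolSymbol Γ 2 0 (complexForm a) := by
  have hcoord : ∀ i : Fin n, HolSymbol Γ 1 0 fun (_ : ℝ) (z : EuclideanSpace ℂ (Fin n)) => z i :=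
    fun i => HolSymbolN.of_timeDeriv_eq_zero
      ⟨fun t _ => by fun_prop, fun z _ => continuousOn_const, ⟨1, zero_le_one, fun t _ z _ _ => by
        simpa using PiLp.norm_apply_le z i⟩⟩ (fun z _ => differentiableOn_const _)
      (fun t _ z _ => by simp [timeDeriv])
  have h : HolSymbol Γ 2 0 fun t z => ∑ i, ∑ j,
      ((iteratedDerivWithin 0 (a i j) (Ici 0) t : ℝ) : ℂ) * (z i * z j) :=
    HolSymbol.sum _ fun i _ => HolSymbol.sum _ fun j _ =>
      HolSymbol.mul (d₁ := 0) (e₁ := 0) (e₂ := 0) hΓ (fun N => holSymbolN_coeff hΓ (ha i j) N 0)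
        ((hcoord i).mul hΓ (hcoord j) rfl le_rfl) (by norm_num) le_rfl
  exact h.congr fun t ht z _ => by simp [complexForm, max_eq_left ht]

end QuadraticForm

/-! ### Gronwall estimates, dyadic summation and the factorized equation. -/

section Auxiliary

open Set Filter Topology

/-- A Gronwall inequality for the integrable weight `1 / (lam (1 + t)²)`. -/
theorem norm_le_of_norm_deriv_le_weight {F : Type*} [NormedAddCommGroup F] [NormedSpace ℝ F]
    {f f' : ℝ → F} {t₀ t₁ lam C : ℝ} (ht₀ : 0 ≤ t₀) (hlam : 1 ≤ (1 + t₀) * lam) (hC : 0 ≤ C)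
    (hf : ∀ s ∈ Icc t₀ t₁, HasDerivWithinAt f (f' s) (Ici 0) s)
    (hf' : ∀ s ∈ Icc t₀ t₁, ‖f' s‖ ≤ C / (lam * (1 + s) ^ 2) * ‖f s‖) {t : ℝ}
    (ht : t ∈ Icc t₀ t₁) : ‖f t‖ ≤ Real.exp (C + 1) * ‖f t₀‖ := by
  have hl : 0 < lam := by
    by_contra! h
    nlinarith
  -- `g` vanishes at `t₀`, increases by at most `C + 1` because `lam (1 + t₀) ≥ 1`, and has `C + 1`
  -- times the weight as derivative. The excess over `C`, and below the choice `M > ‖f t₀‖`, give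
  -- the strict inequality that the comparison with a boundary function needs; `M` tends to `‖f t₀‖`
  -- at the end.
  set g : ℝ → ℝ := fun s => (C + 1) * (1 / (lam * (1 + t₀)) - 1 / (lam * (1 + s))) with hg
  have hgd : ∀ s, t₀ ≤ s → HasDerivAt g ((C + 1) * (1 / (lam * (1 + s) ^ 2))) s := by
    intro s hs
    have h1 : HasDerivAt (fun s : ℝ => lam * (1 + s)) lam s := by
      simpa using ((hasDerivAt_id s).const_add 1).const_mul lam
    have hne : lam * (1 + s) ≠ 0 := by
      have : 0 < 1 + s := by linarith
      positivity
    have h2 := (((hasDerivAt_const s (1 : ℝ)).fun_div h1 hne).const_sub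
      (1 / (lam * (1 + t₀)))).const_mul (C + 1)
    convert! h2 using 1
    have : (1 + s) ≠ 0 := by
      have : 0 < 1 + s := by linarith
      positivity
    field_simp
    ring
  have main : ∀ M, ‖f t₀‖ < M → ‖f t‖ ≤ M * Real.exp (C + 1) := by
    intro M hM
    have hM0 : 0 < M := (norm_nonneg _).trans_lt hM
    have key := image_norm_le_of_norm_deriv_right_lt_deriv_boundary' (f := f) (f' := f')
      (a := t₀) (b := t₁) (B := fun s => M * Real.exp (g s))
      (B' := fun s => M * (Real.exp (g s) * ((C + 1) * (1 / (lam * (1 + s) ^ 2)))))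
      (fun s hs => (hf s hs).continuousWithinAt.mono fun x hx => ht₀.trans hx.1)
      (fun s hs => (hf s ⟨hs.1, hs.2.le⟩).mono (Ici_subset_Ici.2 (ht₀.trans hs.1)))
      (by simpa [hg] using hM.le)
      (fun s hs => (((hgd s hs.1).exp.const_mul M).continuousAt).continuousWithinAt)
      (fun s hs => ((hgd s hs.1).exp.const_mul M).hasDerivWithinAt)
      (fun s hs heq => by
        refine (hf' s ⟨hs.1, hs.2.le⟩).trans_lt ?_
        have hs0 : 0 < 1 + s := by linarith [hs.1]
        rw [heq]
        have h5 : 0 < 1 / (lam * (1 + s) ^ 2) * (M * Real.exp (g s)) := by positivity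
        have e1 : C / (lam * (1 + s) ^ 2) * (M * Real.exp (g s)) =
          C * (1 / (lam * (1 + s) ^ 2) * (M * Real.exp (g s))) := by ring
        have e2 : M * (Real.exp (g s) * ((C + 1) * (1 / (lam * (1 + s) ^ 2)))) =
          (C + 1) * (1 / (lam * (1 + s) ^ 2) * (M * Real.exp (g s))) := by ring
        rw [e1, e2]
        nlinarith) ht
    refine key.trans ?_
    gcongr
    have h6 : 1 / (lam * (1 + t₀)) ≤ 1 := by
      rw [mul_comm] at hlam
      exact (div_le_one (by linarith)).2 hlam
    have h7 : 0 ≤ 1 / (lam * (1 + t)) := by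
      have : 0 < 1 + t := by linarith [ht.1]
      positivity
    calc g t ≤ (C + 1) * 1 := by
          rw [hg]
          exact mul_le_mul_of_nonneg_left (by linarith) (by linarith)
      _ = C + 1 := mul_one _
  have hlim : Tendsto (fun M => M * Real.exp (C + 1)) (𝓝[>] ‖f t₀‖)
      (𝓝 (‖f t₀‖ * Real.exp (C + 1))) :=
    ((continuous_id.mul continuous_const).tendsto _).mono_left nhdsWithin_le_nhds
  rw [mul_comm]
  exact ge_of_tendsto hlim (eventually_nhdsWithin_of_forall fun M hM => main M hM)

/-- Dyadic telescoping. -/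
theorem le_of_dyadic_increments {f : ℝ → ℝ} {t₀ lam C D : ℝ} (ht₀ : 0 ≤ t₀)
    (hlam : 1 ≤ (1 + t₀) * lam) (hD : 0 ≤ D) (h0 : f t₀ ≤ C)
    (h : ∀ s t, t₀ ≤ s → s ≤ t → 1 + t ≤ 2 * (1 + s) → f t ≤ f s + D / ((1 + t) * lam))
    {t : ℝ} (ht : t₀ ≤ t) : f t ≤ C + 2 * D := by
  have hl : 0 < lam := by
    by_contra! h
    nlinarith
  have hρ : ∀ t, t₀ ≤ t → 0 ≤ D / ((1 + t) * lam) ∧ D / ((1 + t) * lam) ≤ D := by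
    intro t ht
    have h1 : 1 ≤ (1 + t) * lam := hlam.trans (by gcongr)
    exact ⟨by positivity, div_le_self hD h1⟩
  -- The subtracted term makes the induction close: halving `1 + t` doubles it, and one of the two
  -- copies absorbs the new increment.
  have main : ∀ k : ℕ, ∀ t, t₀ ≤ t → 1 + t ≤ 2 ^ k * (1 + t₀) →
      f t ≤ C + 2 * D - D / ((1 + t) * lam) := by
    intro k
    induction k with
    | zero =>
      intro t ht h1
      have : t = t₀ := le_antisymm (by linarith) ht
      subst this
      linarith [hρ t le_rfl]
    | succ k ih =>
      intro t ht h1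
      rcases le_total (1 + t) (2 * (1 + t₀)) with h2 | h2
      · linarith [h t₀ t le_rfl ht h2, hρ t ht]
      · have h3 := ih ((1 + t) / 2 - 1) (by linarith) (by rw [pow_succ] at h1; linarith)
        have h4 := h ((1 + t) / 2 - 1) t (by linarith) (by linarith) (by linarith)
        have h5 : D / ((1 + ((1 + t) / 2 - 1)) * lam) = 2 * (D / ((1 + t) * lam)) := by
          have e : 1 + ((1 + t) / 2 - 1) = (1 + t) / 2 := by ring
          rw [e]
          field_simp
        rw [h5] at h3
        linarith
  obtain ⟨k, hk⟩ := pow_unbounded_of_one_lt (1 + t) (one_lt_two (α := ℝ))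
  have h1 : 1 + t ≤ 2 ^ k * (1 + t₀) := by nlinarith [pow_pos (zero_lt_two (α := ℝ)) k]
  linarith [main k t ht h1, hρ t ht]

/-- If `u = -σ'/(2σ) + O(1 / (lam (1 + t)²))`, then `exp (∫ u)` is comparable to `σ^(-1/2)`. -/
theorem norm_sq_le_of_hasDerivWithinAt {σ σ' G u : ℝ → ℂ} {t₀ t₁ lam C : ℝ} (ht₀ : 0 ≤ t₀)
    (hlam : 1 ≤ (1 + t₀) * lam) (hC : 0 ≤ C)
    (hσ : ∀ s ∈ Icc t₀ t₁, HasDerivWithinAt σ (σ' s) (Ici 0) s)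
    (hσ0 : ∀ s ∈ Icc t₀ t₁, σ s ≠ 0)
    (hG : ∀ s ∈ Icc t₀ t₁, HasDerivWithinAt G (u s * G s) (Ici 0) s)
    (hu : ∀ s ∈ Icc t₀ t₁, ‖u s + 1 / 2 * (σ' s / σ s)‖ ≤ C / (lam * (1 + s) ^ 2)) {t : ℝ}
    (ht : t ∈ Icc t₀ t₁) : ‖G t‖ ^ 2 * ‖σ t‖ ≤ Real.exp (2 * C + 1) * (‖G t₀‖ ^ 2 * ‖σ t₀‖) := by
  -- `G² σ` has logarithmic derivative `2 (u + σ'/(2σ))`, in which the non-integrable parts cancel.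
  have := norm_le_of_norm_deriv_le_weight (f := fun s => G s ^ 2 * σ s)
    (f' := fun s => 2 * (u s + 1 / 2 * (σ' s / σ s)) * (G s ^ 2 * σ s)) (C := 2 * C) ht₀ hlam
    (by positivity) (fun s hs => by
      convert! ((hG s hs).pow 2).mul (hσ s hs) using 1
      have := hσ0 s hs
      simp only [Pi.pow_apply]
      field_simp
      ring) (fun s hs => by
      rw [norm_mul]
      gcongr
      rw [norm_mul, mul_div_assoc]
      have := hu s hs
      simpa using this) ht
  simpa [norm_mul, norm_pow] using this

/-- The two components `w_P, w_Q` are defined by `v = w_P + w_Q` and `v' = P w_P + Q w_Q`. If `P`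
and `Q` solved the Riccati equation exactly, each would satisfy `w' = P w` or `w' = Q w`; the
residuals are the only coupling. -/
theorem hasDerivWithinAt_factor_component {v v₁ P Q : ℝ → ℂ} {q rP rQ : ℂ} {s : Set ℝ} {t : ℝ}
    (hv : HasDerivWithinAt v (v₁ t) s t) (hv₁ : HasDerivWithinAt v₁ (-(q * v t)) s t)
    (hP : HasDerivWithinAt P (rP - P t ^ 2 - q) s t)
    (hQ : HasDerivWithinAt Q (rQ - Q t ^ 2 - q) s t) (hPQ : P t - Q t ≠ 0) :
    HasDerivWithinAt (fun t => (v₁ t - Q t * v t) / (P t - Q t))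
      (P t * ((v₁ t - Q t * v t) / (P t - Q t)) - (rP * ((v₁ t - Q t * v t) / (P t - Q t)) +
        rQ * ((v₁ t - P t * v t) / (Q t - P t))) / (P t - Q t)) s t := by
  have hQP : Q t - P t ≠ 0 := fun h => hPQ (by rw [← neg_sub, h, neg_zero])
  convert! (hv₁.sub (hQ.mul hv)).div (hP.sub hQ) hPQ using 1
  simp only [Pi.sub_apply, Pi.mul_apply]
  have e : Q t - P t = -(P t - Q t) := by ring
  rw [e]
  field_simp
  ring

end Auxiliary

/-! ### Approximate logarithmic derivatives and their bounds in the hyperbolic zone. -/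

section WKB

open Set

/-- `± i`. -/
noncomputable def signI (s : ℤˣ) : ℂ := ((s : ℤ) : ℂ) * Complex.I

theorem signI_sq (s : ℤˣ) : signI s ^ 2 = -1 := by
  rcases Int.units_eq_one_or s with rfl | rfl <;> simp [signI]

theorem signI_neg (s : ℤˣ) : signI (-s) = -signI s := by simp [signI]

@[simp]
theorem norm_signI (s : ℤˣ) : ‖signI s‖ = 1 := by
  rcases Int.units_eq_one_or s with rfl | rfl <;> simp [signI]

variable {n : ℕ}

/-- The lower order terms of the approximate logarithmic derivatives of solutions. -/
noncomputable def wkbCorr (a : Fin n → Fin n → ℝ → ℝ) (K : ℕ) (s : ℤˣ) :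
    ℝ → EuclideanSpace ℂ (Fin n) → ℂ :=
  riccatiCorr (complexForm a) (signI s) (K + 1)

/-- The residuals in the Riccati equation of the approximate logarithmic derivatives. -/
noncomputable def wkbRes (a : Fin n → Fin n → ℝ → ℝ) (K : ℕ) (s : ℤˣ) :
    ℝ → EuclideanSpace ℂ (Fin n) → ℂ :=
  riccatiDefect (complexForm a) (signI s) (wkbCorr a K s)

/-- The approximate logarithmic derivatives `± i a(t, z) + …` of solutions. -/
noncomputable def wkbRoot (a : Fin n → Fin n → ℝ → ℝ) (K : ℕ) (s : ℤˣ) (t : ℝ)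
    (z : EuclideanSpace ℂ (Fin n)) : ℂ :=
  signI s * slitRoot (complexForm a) t z + wkbCorr a K s t z

/-- The estimates in the hyperbolic zone `(1 + t)|ξ| ≥ N`, on complex balls of radius `ε |ξ|`. -/
structure WKBBounds (a : Fin n → Fin n → ℝ → ℝ) (K : ℕ) (ε c C N : ℝ) : Prop where
  coeff : ∀ i j, IsSymbolT 0 (a i j)
  ε_pos : 0 < ε
  ε_le : ε ≤ 1 / 2
  c_pos : 0 < c
  C_pos : 0 < C
  one_le_N : 1 ≤ N
  one_le_N_mul : 1 ≤ N * ε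
  form_le : ∀ t z, ‖complexForm a t z‖ ≤ C * ‖z‖ ^ 2
  form_sub_le : ∀ t z w,
    ‖complexForm a t z - complexForm a t w‖ ≤ C * (‖z - w‖ * (‖z‖ + ‖w‖))
  re_ge : ∀ t, 0 ≤ t → ∀ z ∈ realCone n ε, c * ‖z‖ ^ 2 ≤ (complexForm a t z).re
  root_le : ∀ t, 0 ≤ t → ∀ ξ z, ‖z - complexify n ξ‖ < ε * ‖ξ‖ →
    ‖slitRoot (complexForm a) t z‖ ≤ C * ‖ξ‖
  le_root : ∀ t, 0 ≤ t → ∀ ξ z, ‖z - complexify n ξ‖ < ε * ‖ξ‖ →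
    c * ‖ξ‖ ≤ ‖slitRoot (complexForm a) t z‖
  corr_le : ∀ s t, 0 ≤ t → ∀ ξ z, ‖z - complexify n ξ‖ < ε * ‖ξ‖ → N ≤ (1 + t) * ‖ξ‖ →
    ‖wkbCorr a K s t z + 1 / 2 * (slitRootInv (complexForm a) t z *
      timeDeriv (slitRoot (complexForm a)) t z)‖ ≤ C / (‖ξ‖ * (1 + t) ^ 2)
  res_le : ∀ s t, 0 ≤ t → ∀ ξ z, ‖z - complexify n ξ‖ < ε * ‖ξ‖ → N ≤ (1 + t) * ‖ξ‖ →
    ‖wkbRes a K s t z‖ ≤ C * ‖ξ‖ ^ 2 * (((1 + t) * ‖ξ‖)⁻¹) ^ (K + 2)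
  wkbRoot_le : ∀ s t, 0 ≤ t → ∀ ξ z, ‖z - complexify n ξ‖ < ε * ‖ξ‖ → N ≤ (1 + t) * ‖ξ‖ →
    ‖wkbRoot a K s t z‖ ≤ C * ‖ξ‖
  gap_le : ∀ s t, 0 ≤ t → ∀ ξ z, ‖z - complexify n ξ‖ < ε * ‖ξ‖ → N ≤ (1 + t) * ‖ξ‖ →
    c * ‖ξ‖ ≤ ‖wkbRoot a K s t z - wkbRoot a K (-s) t z‖

/-- Bounds in terms of `|z|` become bounds in terms of the centre `ξ`, and uniform in the sign.
Since `|z|` and `|ξ|` differ by a factor of at most 2, `(1 + t)|ξ| ≥ 2` ensures that the symbol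
bounds apply at `z`. -/
theorem exists_uniform_symbol_bound {Γ : Set (EuclideanSpace ℂ (Fin n))} {d e : ℕ}
    {g : ℤˣ → ℝ → EuclideanSpace ℂ (Fin n) → ℂ} (hg : ∀ s, HolSymbol Γ d e (g s)) :
    ∃ C : ℝ, 0 ≤ C ∧ ∀ s t, 0 ≤ t → ∀ (ξ : EuclideanSpace ℝ (Fin n)), ∀ z ∈ Γ,
      ‖ξ‖ / 2 < ‖z‖ → ‖z‖ < 2 * ‖ξ‖ → 2 ≤ (1 + t) * ‖ξ‖ →
      ‖g s t z‖ ≤ C * ‖ξ‖ ^ d * (((1 + t) * ‖ξ‖)⁻¹) ^ e := by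
  choose C hC hb using fun s => (hg s 0).base.bound
  refine ⟨(C 1 + C (-1)) * 2 ^ d * 2 ^ e, by have := hC 1; have := hC (-1); positivity,
    fun s t ht ξ z hz h1 h2 h3 => ?_⟩
  have hle : C s ≤ C 1 + C (-1) := by
    rcases Int.units_eq_one_or s with rfl | rfl
    · linarith [hC (-1)]
    · linarith [hC 1]
  have ht' : 0 < 1 + t := by linarith
  have h4 : 1 ≤ (1 + t) * ‖z‖ := by nlinarith
  have h5 : ((1 + t) * ‖z‖)⁻¹ ≤ 2 * ((1 + t) * ‖ξ‖)⁻¹ := by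
    rw [← div_eq_mul_inv, inv_le_comm₀ (by positivity) (by positivity), inv_div]
    nlinarith
  have h6 := hb s t ht z hz h4
  rw [zpow_natCast] at h6
  calc ‖g s t z‖ ≤ C s * ‖z‖ ^ d * (((1 + t) * ‖z‖)⁻¹) ^ e := h6
    _ ≤ (C 1 + C (-1)) * (2 * ‖ξ‖) ^ d * (2 * ((1 + t) * ‖ξ‖)⁻¹) ^ e := by
        have := (hC s).trans hle
        gcongr
    _ = _ := by rw [mul_pow, mul_pow]; ring

theorem slitRoot_ne_zero {E : Type*} (q : ℝ → E → ℂ) (t : ℝ) (z : E) : slitRoot q t z ≠ 0 :=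
  Complex.exp_ne_zero _

variable {a : Fin n → Fin n → ℝ → ℝ}

/-- The `K + 2` powers of decay of the residual are budgeted as follows: up to `K` for Cauchy's
estimates on balls of radius `1/(1 + t)`, one for the length of a time interval, one for the
summation over dyadic times. -/
theorem exists_wkbBounds (ha : ∀ i j, IsSymbolT 0 (a i j)) (hell : UniformlyElliptic a) (K : ℕ) :
    ∃ ε c C N, WKBBounds a K ε c C N := by
  obtain ⟨ε, c₀, hε, hε2, hc₀, hre⟩ := exists_elliptic_cone ha hell
  obtain ⟨M, hM, hM1, hM2, -⟩ := exists_bound_complexForm ha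
  have hΓ : ∀ z ∈ realCone n ε, z ≠ 0 := fun z hz => ne_zero_of_mem_realCone hε2 hz
  have hq := holSymbol_complexForm hΓ ha
  obtain ⟨C₁, hC₁, h₁⟩ := exists_uniform_symbol_bound (d := 1) (e := 2)
    (g := fun s t z => wkbCorr a K s t z + 1 / 2 * (slitRootInv (complexForm a) t z *
      timeDeriv (slitRoot (complexForm a)) t z))
    fun s => riccatiCorr_add_symbol hΓ hq hc₀ hre (signI_sq s) K
  obtain ⟨C₂, hC₂, h₂⟩ := exists_uniform_symbol_bound (d := 2) (e := K + 2) (g := wkbRes a K)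
    fun s => (riccatiCorr_symbol hΓ hq hc₀ hre (signI_sq s) (K + 1)).2
  obtain ⟨C₃, hC₃, h₃⟩ := exists_uniform_symbol_bound (d := 1) (e := 1) (g := wkbCorr a K)
    fun s => (riccatiCorr_symbol hΓ hq hc₀ hre (signI_sq s) (K + 1)).1
  have hsq : ∀ t, 0 ≤ t → ∀ z ∈ realCone n ε,
      ‖slitRoot (complexForm a) t z‖ ^ 2 = ‖complexForm a t z‖ := by
    intro t ht z hz
    rw [← norm_pow, slitRoot_sq]
    intro h0
    have h1 := hre t ht z hz
    rw [h0, Complex.zero_re] at h1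
    exact absurd h1 (not_le.2 (mul_pos hc₀ (pow_pos (norm_pos_iff.2 (hΓ z hz)) 2)))
  have hroot_le : ∀ t, 0 ≤ t → ∀ ξ z, ‖z - complexify n ξ‖ < ε * ‖ξ‖ →
      ‖slitRoot (complexForm a) t z‖ ≤ 2 * Real.sqrt M * ‖ξ‖ := by
    intro t ht ξ z hz
    obtain ⟨h1, h2, h3⟩ := norm_bounds_of_mem_ball hε2 hz
    refine (abs_le_of_sq_le_sq' ?_ (by positivity)).2
    rw [hsq t ht z ⟨ξ, hz⟩]
    refine (hM1 t z).trans ?_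
    rw [mul_pow, mul_pow, Real.sq_sqrt hM.le]
    have h4 : ‖z‖ ^ 2 ≤ 4 * ‖ξ‖ ^ 2 := by nlinarith [norm_nonneg z]
    linarith [mul_le_mul_of_nonneg_left h4 hM.le]
  have hle_root : ∀ t, 0 ≤ t → ∀ ξ z, ‖z - complexify n ξ‖ < ε * ‖ξ‖ →
      Real.sqrt c₀ / 2 * ‖ξ‖ ≤ ‖slitRoot (complexForm a) t z‖ := by
    intro t ht ξ z hz
    obtain ⟨h1, h2, h3⟩ := norm_bounds_of_mem_ball hε2 hz
    refine (abs_le_of_sq_le_sq' ?_ (norm_nonneg _)).2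
    rw [hsq t ht z ⟨ξ, hz⟩]
    refine le_trans ?_ ((hre t ht z ⟨ξ, hz⟩).trans
      ((le_abs_self _).trans (Complex.abs_re_le_norm _)))
    rw [mul_pow, div_pow, Real.sq_sqrt hc₀.le]
    have h4 : ‖ξ‖ ^ 2 / 4 ≤ ‖z‖ ^ 2 := by nlinarith [norm_nonneg z]
    linarith [mul_le_mul_of_nonneg_left h4 hc₀.le]
  have hsc : 0 < Real.sqrt c₀ := Real.sqrt_pos.2 hc₀
  -- The three summands give, in this order, the validity of the symbol bounds, `N ε ≥ 1`, and the
  -- dominance of `2 |σ| ≥ √c₀ |ξ|` over the lower order terms in the gap of the two roots.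
  set N : ℝ := 2 + 1 / ε + 4 * C₁ / Real.sqrt c₀ with hN
  have hN2 : 2 ≤ N := by
    have : 0 ≤ 1 / ε + 4 * C₁ / Real.sqrt c₀ := by positivity
    rw [hN]; linarith
  have hcorr : ∀ s t, 0 ≤ t → ∀ ξ z, ‖z - complexify n ξ‖ < ε * ‖ξ‖ → N ≤ (1 + t) * ‖ξ‖ →
    ‖wkbCorr a K s t z + 1 / 2 * (slitRootInv (complexForm a) t z *
      timeDeriv (slitRoot (complexForm a)) t z)‖ ≤ C₁ * ‖ξ‖ * (((1 + t) * ‖ξ‖)⁻¹) ^ 2 := by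
    intro s t ht ξ z hz hNt
    obtain ⟨e1, e2, e3⟩ := norm_bounds_of_mem_ball hε2 hz
    have := h₁ s t ht ξ z ⟨ξ, hz⟩ e1 e2 (hN2.trans hNt)
    rwa [pow_one] at this
  have hgap : ∀ s t, 0 ≤ t → ∀ ξ z, ‖z - complexify n ξ‖ < ε * ‖ξ‖ → N ≤ (1 + t) * ‖ξ‖ →
      Real.sqrt c₀ / 2 * ‖ξ‖ ≤ ‖wkbRoot a K s t z - wkbRoot a K (-s) t z‖ := by
    intro s t ht ξ z hz hNt
    obtain ⟨e1, e2, e3⟩ := norm_bounds_of_mem_ball hε2 hz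
    have g1 := hcorr s t ht ξ z hz hNt
    have g2 := hcorr (-s) t ht ξ z hz hNt
    have g3 := hle_root t ht ξ z hz
    set X := 1 / 2 * (slitRootInv (complexForm a) t z * timeDeriv (slitRoot (complexForm a)) t z)
    -- `X = σ'/(2σ)` is common to both signs and drops out of the difference, so only the better
    -- remainders compete with `2 |σ|`.
    have e : 2 * signI s * slitRoot (complexForm a) t z =
        (wkbRoot a K s t z - wkbRoot a K (-s) t z) - (wkbCorr a K s t z + X) +
          (wkbCorr a K (-s) t z + X) := by
      rw [wkbRoot, wkbRoot, signI_neg]; ring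
    have g4 : 2 * ‖slitRoot (complexForm a) t z‖ ≤
        ‖wkbRoot a K s t z - wkbRoot a K (-s) t z‖ + 2 * (C₁ * ‖ξ‖ * (((1 + t) * ‖ξ‖)⁻¹) ^ 2) := by
      have := congrArg norm e
      rw [norm_mul, norm_mul, norm_signI, Complex.norm_ofNat, mul_one] at this
      rw [this]
      refine (norm_add_le _ _).trans ?_
      have := norm_sub_le (wkbRoot a K s t z - wkbRoot a K (-s) t z) (wkbCorr a K s t z + X)
      linarith
    have g5 : 2 * (C₁ * ‖ξ‖ * (((1 + t) * ‖ξ‖)⁻¹) ^ 2) ≤ Real.sqrt c₀ / 2 * ‖ξ‖ := by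
      have h1 : (((1 + t) * ‖ξ‖)⁻¹) ^ 2 ≤ N⁻¹ := by
        have hx : ((1 + t) * ‖ξ‖)⁻¹ ≤ N⁻¹ := inv_anti₀ (by linarith) hNt
        have hx1 : N⁻¹ ≤ 1 := inv_le_one_of_one_le₀ (by linarith)
        have hx0 : 0 ≤ ((1 + t) * ‖ξ‖)⁻¹ := by positivity
        nlinarith
      have h2 : 4 * C₁ * N⁻¹ ≤ Real.sqrt c₀ := by
        rw [← div_eq_mul_inv, div_le_iff₀ (by linarith)]
        have h3 : 4 * C₁ / Real.sqrt c₀ ≤ N := by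
          have : 0 ≤ 2 + 1 / ε := by positivity
          rw [hN]; linarith
        rw [div_le_iff₀ hsc] at h3
        linarith
      calc 2 * (C₁ * ‖ξ‖ * (((1 + t) * ‖ξ‖)⁻¹) ^ 2) ≤ 2 * (C₁ * ‖ξ‖ * N⁻¹) := by gcongr
        _ = (4 * C₁ * N⁻¹) * ‖ξ‖ / 2 := by ring
        _ ≤ Real.sqrt c₀ * ‖ξ‖ / 2 := by gcongr
        _ = _ := by ring
    linarith
  refine ⟨ε, min c₀ (Real.sqrt c₀ / 2), M + 2 * Real.sqrt M + C₁ + C₂ + C₃, N, ha, hε, hε2,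
    by positivity, by positivity, by linarith, ?_, fun t z => ?_, fun t z w => ?_,
    fun t ht z hz => ?_, fun t ht ξ z hz => ?_, fun t ht ξ z hz => ?_, fun s t ht ξ z hz hNt => ?_,
    fun s t ht ξ z hz hNt => ?_, fun s t ht ξ z hz hNt => ?_, fun s t ht ξ z hz hNt => ?_⟩
  · have h1 : 1 / ε ≤ N := by
      have : 0 ≤ 2 + 4 * C₁ / Real.sqrt c₀ := by positivity
      rw [hN]; linarith
    rwa [div_le_iff₀ hε] at h1
  · refine (hM1 t z).trans ?_
    gcongr
    have : 0 ≤ 2 * Real.sqrt M + C₁ + C₂ + C₃ := by positivity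
    linarith
  · refine (hM2 t z w).trans ?_
    gcongr
    have : 0 ≤ 2 * Real.sqrt M + C₁ + C₂ + C₃ := by positivity
    linarith
  · refine le_trans ?_ (hre t ht z hz)
    gcongr
    exact min_le_left _ _
  · refine (hroot_le t ht ξ z hz).trans ?_
    gcongr
    linarith
  · refine le_trans ?_ (hle_root t ht ξ z hz)
    gcongr
    exact min_le_right _ _
  · obtain ⟨-, -, e3⟩ := norm_bounds_of_mem_ball hε2 hz
    refine (hcorr s t ht ξ z hz hNt).trans ?_
    have ht' : 0 < 1 + t := by linarith
    have e : C₁ * ‖ξ‖ * (((1 + t) * ‖ξ‖)⁻¹) ^ 2 = C₁ / (‖ξ‖ * (1 + t) ^ 2) := by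
      field_simp
    rw [e]
    gcongr
    have : 0 ≤ M + 2 * Real.sqrt M + C₂ + C₃ := by positivity
    linarith
  · obtain ⟨e1, e2, e3⟩ := norm_bounds_of_mem_ball hε2 hz
    refine (h₂ s t ht ξ z ⟨ξ, hz⟩ e1 e2 (hN2.trans hNt)).trans ?_
    gcongr
    have : 0 ≤ M + 2 * Real.sqrt M + C₁ + C₃ := by positivity
    linarith
  · obtain ⟨e1, e2, e3⟩ := norm_bounds_of_mem_ball hε2 hz
    have h4 := h₃ s t ht ξ z ⟨ξ, hz⟩ e1 e2 (hN2.trans hNt)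
    rw [pow_one, pow_one] at h4
    have h5 : ((1 + t) * ‖ξ‖)⁻¹ ≤ 1 := inv_le_one_of_one_le₀ (by linarith)
    have h6 : ‖wkbCorr a K s t z‖ ≤ C₃ * ‖ξ‖ :=
      h4.trans (mul_le_of_le_one_right (by positivity) h5)
    have h7 := hroot_le t ht ξ z hz
    calc ‖wkbRoot a K s t z‖ ≤ ‖slitRoot (complexForm a) t z‖ + ‖wkbCorr a K s t z‖ := by
          rw [wkbRoot]
          refine (norm_add_le _ _).trans ?_
          rw [norm_mul, norm_signI, one_mul]
      _ ≤ (2 * Real.sqrt M + C₃) * ‖ξ‖ := by linarith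
      _ ≤ _ := by gcongr; linarith
  · refine le_trans ?_ (hgap s t ht ξ z hz hNt)
    gcongr
    exact min_le_right _ _

end WKB

/-! ### A Leibniz estimate for symbols. -/

section Products

open Set

theorem norm_iteratedFDeriv_mul_le_of_isOpen {V : Type*} [NormedAddCommGroup V] [NormedSpace ℝ V]
    {U : Set V} (hU : IsOpen U) {f g : V → ℂ} {x : V} (hx : x ∈ U) {m : ℕ}
    (hf : ContDiffOn ℝ ∞ f U) (hg : ContDiffOn ℝ ∞ g U) {A B r : ℝ} (hr : 0 ≤ r)
    (hA : ∀ i ≤ m, ‖iteratedFDeriv ℝ i f x‖ ≤ A * r ^ i)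
    (hB : ∀ i ≤ m, ‖iteratedFDeriv ℝ i g x‖ ≤ B * r ^ i) :
    ‖iteratedFDeriv ℝ m (fun y => f y * g y) x‖ ≤ 2 ^ m * (A * B) * r ^ m := by
  have h1 := norm_iteratedFDerivWithin_mul_le hf hg hU.uniqueDiffOn hx
    (n := m) (by exact_mod_cast le_top)
  simp only [iteratedFDerivWithin_of_isOpen _ hU hx] at h1
  have hA0 : 0 ≤ A := by simpa using (norm_nonneg _).trans (hA 0 (Nat.zero_le _))
  refine h1.trans ?_
  calc ∑ i ∈ Finset.range (m + 1), (m.choose i : ℝ) * ‖iteratedFDeriv ℝ i f x‖ *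
        ‖iteratedFDeriv ℝ (m - i) g x‖
      ≤ ∑ i ∈ Finset.range (m + 1), (m.choose i : ℝ) * (A * B * r ^ m) := by
        refine Finset.sum_le_sum fun i hi => ?_
        have hi' : i ≤ m := Nat.lt_succ_iff.1 (Finset.mem_range.1 hi)
        rw [mul_assoc]
        refine mul_le_mul_of_nonneg_left ?_ (Nat.cast_nonneg _)
        calc _ ≤ (A * r ^ i) * (B * r ^ (m - i)) :=
              mul_le_mul (hA i hi') (hB _ (Nat.sub_le _ _)) (norm_nonneg _) (by positivity)
          _ = A * B * (r ^ i * r ^ (m - i)) := by ring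
          _ = _ := by rw [← pow_add, Nat.add_sub_cancel' hi']
    _ = _ := by
        rw [← Finset.sum_mul]
        have : ∑ i ∈ Finset.range (m + 1), (m.choose i : ℝ) = 2 ^ m := by
          exact_mod_cast Nat.sum_range_choose m
        rw [this]; ring

end Products

/-! ### Amplitudes in the hyperbolic zone: equations and bounds for the exponentials. -/

section Hyperbolic

open Set Metric

variable {n : ℕ}

/-- The complex phase `∫_0^t a(τ, z) dτ`. -/
noncomputable def phaseInt (a : Fin n → Fin n → ℝ → ℝ) (t : ℝ)
    (z : EuclideanSpace ℂ (Fin n)) : ℂ :=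
  ∫ τ in (0 : ℝ)..t, slitRoot (complexForm a) τ z

/-- The integral of the lower order terms of the approximate logarithmic derivatives. -/
noncomputable def corrInt (a : Fin n → Fin n → ℝ → ℝ) (K : ℕ) (s : ℤˣ) (t₀ t : ℝ)
    (z : EuclideanSpace ℂ (Fin n)) : ℂ :=
  ∫ τ in t₀..t, wkbCorr a K s (max τ 0) z

/-- The component of the solution with data `(α, β)` along the approximate solution of sign `s`. -/
noncomputable def wkbComp (a : Fin n → Fin n → ℝ → ℝ) (K : ℕ) (α β : ℂ) (s : ℤˣ) (t : ℝ)
    (z : EuclideanSpace ℂ (Fin n)) : ℂ :=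
  (picardVel (complexForm a) α β t z - wkbRoot a K (-s) t z * picardSol (complexForm a) α β t z) /
    (wkbRoot a K s t z - wkbRoot a K (-s) t z)

/-- The amplitude of the oscillation `exp (± i ∫ a)` in the solution with data `(α, β)`. -/
noncomputable def hypAmp (a : Fin n → Fin n → ℝ → ℝ) (K : ℕ) (α β : ℂ) (s : ℤˣ) (t : ℝ)
    (z : EuclideanSpace ℂ (Fin n)) : ℂ :=
  Complex.exp (-(signI s * phaseInt a t z)) * wkbComp a K α β s t z

/-- The amplitude normalized by the approximate solution. -/
noncomputable def normAmp (a : Fin n → Fin n → ℝ → ℝ) (K : ℕ) (α β : ℂ) (t₀ : ℝ) (s : ℤˣ) (t : ℝ)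
    (z : EuclideanSpace ℂ (Fin n)) : ℂ :=
  Complex.exp (-(signI s * phaseInt a t z + corrInt a K s t₀ t z)) * wkbComp a K α β s t z

variable {a : Fin n → Fin n → ℝ → ℝ} {K : ℕ} {ε c C N : ℝ} {α β : ℂ}

theorem slitRoot_complexForm_max (t : ℝ) (z : EuclideanSpace ℂ (Fin n)) :
    slitRoot (complexForm a) (max t 0) z = slitRoot (complexForm a) t z := by
  simp [slitRoot, complexForm]

namespace WKBBounds

theorem cone_ne_zero (h : WKBBounds a K ε c C N) : ∀ z ∈ realCone n ε, z ≠ 0 := fun _ hz =>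
  ne_zero_of_mem_realCone h.ε_le hz

theorem root_symbol (h : WKBBounds a K ε c C N) :
    HolSymbol (realCone n ε) 1 0 (slitRoot (complexForm a)) :=
  holSymbol_slitRoot h.cone_ne_zero (holSymbol_complexForm h.cone_ne_zero h.coeff) h.c_pos h.re_ge

theorem corr_symbol (h : WKBBounds a K ε c C N) (s : ℤˣ) :
    HolSymbol (realCone n ε) 1 1 (wkbCorr a K s) :=
  (riccatiCorr_symbol h.cone_ne_zero (holSymbol_complexForm h.cone_ne_zero h.coeff) h.c_pos h.re_ge
    (signI_sq s) (K + 1)).1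

theorem continuous_root (h : WKBBounds a K ε c C N) {z : EuclideanSpace ℂ (Fin n)}
    (hz : z ∈ realCone n ε) : Continuous fun t => slitRoot (complexForm a) t z := by
  have := ((h.root_symbol 0).base.cont z hz).comp_continuous
    (f := fun t : ℝ => max t 0) (by fun_prop) fun t => le_max_right t 0
  simpa [Function.comp_def, slitRoot_complexForm_max] using this

theorem continuous_corr (h : WKBBounds a K ε c C N) (s : ℤˣ) {z : EuclideanSpace ℂ (Fin n)}
    (hz : z ∈ realCone n ε) : Continuous fun t => wkbCorr a K s (max t 0) z :=
  ((h.corr_symbol s 0).base.cont z hz).comp_continuous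
    (f := fun t : ℝ => max t 0) (by fun_prop) fun t => le_max_right t 0

theorem hasDerivAt_phaseInt (h : WKBBounds a K ε c C N) {z : EuclideanSpace ℂ (Fin n)}
    (hz : z ∈ realCone n ε) (t : ℝ) :
    HasDerivAt (fun t => phaseInt a t z) (slitRoot (complexForm a) t z) t :=
  intervalIntegral.integral_hasDerivAt_right ((h.continuous_root hz).intervalIntegrable 0 t)
    ((h.continuous_root hz).stronglyMeasurableAtFilter _ _) (h.continuous_root hz).continuousAt

theorem hasDerivAt_corrInt (h : WKBBounds a K ε c C N) (s : ℤˣ) {z : EuclideanSpace ℂ (Fin n)}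
    (hz : z ∈ realCone n ε) (t₀ : ℝ) {t : ℝ} (ht : 0 ≤ t) :
    HasDerivAt (fun t => corrInt a K s t₀ t z) (wkbCorr a K s t z) t := by
  have := intervalIntegral.integral_hasDerivAt_right
    ((h.continuous_corr s hz).intervalIntegrable t₀ t)
    ((h.continuous_corr s hz).stronglyMeasurableAtFilter _ _) (h.continuous_corr s hz).continuousAt
  rwa [max_eq_left ht] at this

theorem picard_bound (h : WKBBounds a K ε c C N) (z : EuclideanSpace ℂ (Fin n)) :
    ∀ t, ‖complexForm a t z‖ ≤ C * ‖z‖ ^ 2 := fun t => h.form_le t z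

theorem hasDerivWithinAt_wkbComp (h : WKBBounds a K ε c C N) (s : ℤˣ)
    {z : EuclideanSpace ℂ (Fin n)} (hz : z ∈ realCone n ε) {t : ℝ} (ht : 0 ≤ t)
    (hgap : wkbRoot a K s t z - wkbRoot a K (-s) t z ≠ 0) :
    HasDerivWithinAt (fun t => wkbComp a K α β s t z)
      (wkbRoot a K s t z * wkbComp a K α β s t z -
        (wkbRes a K s t z * wkbComp a K α β s t z +
          wkbRes a K (-s) t z * wkbComp a K α β (-s) t z) /
            (wkbRoot a K s t z - wkbRoot a K (-s) t z)) (Ici 0) t := by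
  have hq := continuous_complexForm h.coeff z
  have hP : ∀ s, HasDerivWithinAt (fun t => wkbRoot a K s t z)
      (wkbRes a K s t z - wkbRoot a K s t z ^ 2 - complexForm a t z) (Ici 0) t := fun s =>
    hasDerivWithinAt_riccati h.cone_ne_zero (holSymbol_complexForm h.cone_ne_zero h.coeff) h.c_pos
      h.re_ge (signI_sq s) (K + 1) hz ht
  have := hasDerivWithinAt_factor_component (v := fun t => picardSol (complexForm a) α β t z)
    (v₁ := fun t => picardVel (complexForm a) α β t z) (P := fun t => wkbRoot a K s t z)
    (Q := fun t => wkbRoot a K (-s) t z)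
    (hasDerivAt_picardSol (α := α) (β := β) hq (h.picard_bound z) t).hasDerivWithinAt
    (hasDerivAt_picardVel (α := α) (β := β) hq (h.picard_bound z) t).hasDerivWithinAt (hP s) (hP (-s)) hgap
  simpa only [wkbComp, neg_neg] using this

/-- The normalization removes the diagonal term, so the derivative contains only residuals. The
coupling to the opposite sign carries the quotient of the two approximate solutions, written as a
product of exponentials that are bounded separately. -/
theorem hasDerivWithinAt_normAmp (h : WKBBounds a K ε c C N) (t₀ : ℝ) (s : ℤˣ)
    {z : EuclideanSpace ℂ (Fin n)} (hz : z ∈ realCone n ε) {t : ℝ} (ht : 0 ≤ t)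
    (hgap : wkbRoot a K s t z - wkbRoot a K (-s) t z ≠ 0) :
    HasDerivWithinAt (fun t => normAmp a K α β t₀ s t z)
      (-(wkbRes a K s t z * normAmp a K α β t₀ s t z +
        wkbRes a K (-s) t z * (Complex.exp (-(signI s * phaseInt a t z)) ^ 2 *
          Complex.exp (corrInt a K (-s) t₀ t z) * Complex.exp (-corrInt a K s t₀ t z)) *
          normAmp a K α β t₀ (-s) t z) / (wkbRoot a K s t z - wkbRoot a K (-s) t z)) (Ici 0) t := by
  have h1 := ((((h.hasDerivAt_phaseInt hz t).const_mul (signI s)).add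
    (h.hasDerivAt_corrInt s hz t₀ ht)).fun_neg.cexp).hasDerivWithinAt (s := Ici 0)
  refine (h1.mul (h.hasDerivWithinAt_wkbComp (α := α) (β := β) s hz ht hgap)).congr_deriv ?_
  have e1 : Complex.exp (-(signI s * phaseInt a t z)) ^ 2 *
      Complex.exp (corrInt a K (-s) t₀ t z) * Complex.exp (-corrInt a K s t₀ t z) *
      normAmp a K α β t₀ (-s) t z =
      Complex.exp (-(signI s * phaseInt a t z + corrInt a K s t₀ t z)) *
        wkbComp a K α β (-s) t z := by
    rw [normAmp, ← mul_assoc, ← Complex.exp_nat_mul, ← Complex.exp_add, ← Complex.exp_add,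
      ← Complex.exp_add, signI_neg]
    congr 2
    push_cast
    ring
  rw [mul_assoc (wkbRes a K (-s) t z), e1, normAmp, wkbRoot]
  simp only [Pi.add_apply]
  ring

/-- Bounds for the exponentials of the integrated lower order terms. -/
theorem exists_norm_exp_corrInt_le (h : WKBBounds a K ε c C N) :
    ∃ H : ℝ, 1 ≤ H ∧ ∀ (ξ : EuclideanSpace ℝ (Fin n)) (t₀ : ℝ), 0 ≤ t₀ → N ≤ (1 + t₀) * ‖ξ‖ →
      ∀ z, ‖z - complexify n ξ‖ < ε * ‖ξ‖ → ∀ s t, t₀ ≤ t →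
      ‖Complex.exp (corrInt a K s t₀ t z)‖ ≤ H ∧ ‖Complex.exp (-corrInt a K s t₀ t z)‖ ≤ H := by
  have hc := h.c_pos
  have hC := h.C_pos
  set Q : ℝ := Real.exp (2 * C + 1) * (C / c) with hQ
  refine ⟨1 + Q, by have : 0 ≤ Q := by positivity
                    linarith, fun ξ t₀ ht₀ hN z hz s t ht => ?_⟩
  obtain ⟨-, -, hξ⟩ := norm_bounds_of_mem_ball h.ε_le hz
  have hzΓ : z ∈ realCone n ε := ⟨ξ, hz⟩
  have hNt : ∀ τ ∈ Icc t₀ t, N ≤ (1 + τ) * ‖ξ‖ := fun τ hτ => hN.trans (by gcongr; exact hτ.1)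
  have h0 : ∀ τ ∈ Icc t₀ t, 0 ≤ τ := fun τ hτ => ht₀.trans hτ.1
  have hσd : ∀ τ ∈ Icc t₀ t, HasDerivWithinAt (fun t => slitRoot (complexForm a) t z)
      (timeDeriv (slitRoot (complexForm a)) τ z) (Ici 0) τ := fun τ hτ =>
    h.root_symbol.hasDerivWithinAt hzΓ (h0 τ hτ)
  have hdiv : ∀ τ, slitRootInv (complexForm a) τ z * timeDeriv (slitRoot (complexForm a)) τ z =
      timeDeriv (slitRoot (complexForm a)) τ z / slitRoot (complexForm a) τ z := fun τ => by
    rw [eq_div_iff (slitRoot_ne_zero _ _ _), mul_right_comm, mul_comm (slitRootInv _ _ _),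
      slitRoot_mul_slitRootInv, one_mul]
  have hcorr : ∀ τ ∈ Icc t₀ t, ‖wkbCorr a K s τ z + 1 / 2 *
      (timeDeriv (slitRoot (complexForm a)) τ z / slitRoot (complexForm a) τ z)‖ ≤
        C / (‖ξ‖ * (1 + τ) ^ 2) := fun τ hτ => by
    rw [← hdiv]; exact h.corr_le s τ (h0 τ hτ) ξ z hz (hNt τ hτ)
  have hexp : ∀ τ ∈ Icc t₀ t, HasDerivWithinAt (fun t => Complex.exp (corrInt a K s t₀ t z))
      (wkbCorr a K s τ z * Complex.exp (corrInt a K s t₀ τ z)) (Ici 0) τ := fun τ hτ =>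
    ((h.hasDerivAt_corrInt s hzΓ t₀ (h0 τ hτ)).cexp.congr_deriv (mul_comm _ _)).hasDerivWithinAt
  have hexp' : ∀ τ ∈ Icc t₀ t, HasDerivWithinAt (fun t => Complex.exp (-corrInt a K s t₀ t z))
      (-wkbCorr a K s τ z * Complex.exp (-corrInt a K s t₀ τ z)) (Ici 0) τ := fun τ hτ =>
    ((h.hasDerivAt_corrInt s hzΓ t₀ (h0 τ hτ)).fun_neg.cexp.congr_deriv
      (mul_comm _ _)).hasDerivWithinAt
  have htt : t ∈ Icc t₀ t := right_mem_Icc.2 ht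
  have hone : 1 ≤ (1 + t₀) * ‖ξ‖ := h.one_le_N.trans hN
  -- The comparison is used for `exp ∫ u` with `σ` and for `exp (-∫ u)` with `1/σ`. As `|σ|` lies
  -- between `c |ξ|` and `C |ξ|`, only the ratio `C / c` remains.
  have g1 := norm_sq_le_of_hasDerivWithinAt ht₀ hone hC.le hσd
    (fun τ _ => slitRoot_ne_zero _ _ _) hexp hcorr htt
  have g2 := norm_sq_le_of_hasDerivWithinAt (σ := fun t => (slitRoot (complexForm a) t z)⁻¹)
    ht₀ hone hC.le (fun τ hτ => (hσd τ hτ).inv (slitRoot_ne_zero _ _ _))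
    (fun τ _ => inv_ne_zero (slitRoot_ne_zero _ _ _)) hexp' (fun τ hτ => by
      refine le_of_eq_of_le ?_ (hcorr τ hτ)
      rw [← norm_neg]
      congr 1
      have := slitRoot_ne_zero (complexForm a) τ z
      field_simp
      ring) htt
  have e0 : corrInt a K s t₀ t₀ z = 0 := intervalIntegral.integral_same
  simp only [e0, neg_zero, Complex.exp_zero, norm_one, one_pow, one_mul, norm_inv] at g1 g2
  have b1 := h.root_le t₀ ht₀ ξ z hz
  have b2 := h.le_root t (ht₀.trans ht) ξ z hz
  have b3 := h.root_le t (ht₀.trans ht) ξ z hz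
  have b4 := h.le_root t₀ ht₀ ξ z hz
  have hpos : ∀ t, 0 < ‖slitRoot (complexForm a) t z‖ := fun t => norm_pos_iff.2 (slitRoot_ne_zero _ _ _)
  -- `X ≤ 1 + X²` replaces a square root.
  have fin : ∀ X : ℝ, 0 ≤ X → X ^ 2 ≤ Q → X ≤ 1 + Q := fun X hX hXQ => by nlinarith [sq_nonneg (X - 1)]
  have ratio : ∀ x y : ℝ, 0 < y → x ≤ C * ‖ξ‖ → c * ‖ξ‖ ≤ y → x / y ≤ C / c := by
    intro x y hy h1 h2
    rw [div_le_div_iff₀ hy hc]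
    calc x * c ≤ (C * ‖ξ‖) * c := by gcongr
      _ = C * (c * ‖ξ‖) := by ring
      _ ≤ C * y := by gcongr
  refine ⟨fin _ (norm_nonneg _) ?_, fin _ (norm_nonneg _) ?_⟩
  · rw [← le_div_iff₀ (hpos t)] at g1
    refine g1.trans ?_
    rw [mul_div_assoc, hQ]
    exact mul_le_mul_of_nonneg_left (ratio _ _ (hpos t) b1 b2) (Real.exp_pos _).le
  · rw [← div_eq_mul_inv, div_le_iff₀ (hpos t)] at g2
    refine g2.trans ?_
    rw [mul_assoc, inv_mul_eq_div, hQ]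
    exact mul_le_mul_of_nonneg_left (ratio _ _ (hpos t₀) b3 b4) (Real.exp_pos _).le

theorem norm_phaseInt_le (h : WKBBounds a K ε c C N) {ξ : EuclideanSpace ℝ (Fin n)}
    {z : EuclideanSpace ℂ (Fin n)} (hz : ‖z - complexify n ξ‖ < ε * ‖ξ‖) {t : ℝ} (ht : 0 ≤ t) :
    ‖phaseInt a t z‖ ≤ C * (t * ‖ξ‖) := by
  have := intervalIntegral.norm_integral_le_of_norm_le_const (a := 0) (b := t)
    (f := fun τ => slitRoot (complexForm a) τ z) (C := C * ‖ξ‖) fun τ hτ => by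
      rw [uIoc_of_le ht] at hτ
      exact h.root_le τ hτ.1.le ξ z hz
  rw [sub_zero, abs_of_nonneg ht] at this
  exact this.trans (le_of_eq (by ring))

/-- `q` is real at `ξ`, whence `Im q = O(|z - ξ| |ξ|)`. Since `Im q = 2 Re σ Im σ` and `(Re σ)² ≥ Re
q ≳ |ξ|²`, division by `Re σ` gives the claim. Integrated in time it bounds the oscillating
exponentials on balls of radius `1/(1 + t)`. -/
theorem abs_im_root_le (h : WKBBounds a K ε c C N) {ξ : EuclideanSpace ℝ (Fin n)}
    {z : EuclideanSpace ℂ (Fin n)} (hz : ‖z - complexify n ξ‖ < ε * ‖ξ‖) {t : ℝ} (ht : 0 ≤ t) :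
    |(slitRoot (complexForm a) t z).im| ≤ 6 * C ^ 2 / c * ‖z - complexify n ξ‖ := by
  obtain ⟨h1, h2, hξ⟩ := norm_bounds_of_mem_ball h.ε_le hz
  have hc := h.c_pos
  have hC := h.C_pos
  set σ := slitRoot (complexForm a) t z with hσ
  have hre := h.re_ge t ht z ⟨ξ, hz⟩
  have hq0 : complexForm a t z ≠ 0 := by
    intro h0
    rw [h0, Complex.zero_re] at hre
    exact absurd hre (not_le.2 (mul_pos hc (pow_pos (by linarith) 2)))
  have hsq : σ ^ 2 = complexForm a t z := slitRoot_sq hq0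
  have e1 : σ.re ^ 2 - σ.im ^ 2 = (complexForm a t z).re := by
    rw [← hsq, sq σ, Complex.mul_re]; ring
  have e2 : 2 * (σ.re * σ.im) = (complexForm a t z).im := by
    rw [← hsq, sq σ, Complex.mul_im]; ring
  have e3 : |(complexForm a t z).im| ≤ 3 * C * ‖z - complexify n ξ‖ * ‖ξ‖ := by
    have i1 : (complexForm a t z - complexForm a t (complexify n ξ)).im = (complexForm a t z).im := by
      rw [Complex.sub_im, complexForm_complexify ht, Complex.ofReal_im, sub_zero]
    rw [← i1]
    refine (Complex.abs_im_le_norm _).trans ((h.form_sub_le t z _).trans ?_)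
    rw [norm_complexify]
    calc C * (‖z - complexify n ξ‖ * (‖z‖ + ‖ξ‖)) ≤ C * (‖z - complexify n ξ‖ * (3 * ‖ξ‖)) := by
          gcongr; linarith
      _ = _ := by ring
  have e4 : |σ.re| ≤ C * ‖ξ‖ := (Complex.abs_re_le_norm _).trans (h.root_le t ht ξ z hz)
  have e5 : c * ‖ξ‖ ^ 2 / 4 ≤ |σ.re| ^ 2 := by
    rw [sq_abs]
    have h4 : ‖ξ‖ ^ 2 / 4 ≤ ‖z‖ ^ 2 := by nlinarith [norm_nonneg z]
    nlinarith [sq_nonneg σ.im]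
  have e6 : c * ‖ξ‖ / (4 * C) ≤ |σ.re| := by
    rw [div_le_iff₀ (by positivity)]
    have : c * ‖ξ‖ * ‖ξ‖ ≤ |σ.re| * (4 * C) * ‖ξ‖ := by nlinarith [abs_nonneg σ.re]
    exact le_of_mul_le_mul_right this hξ
  have e7 : 2 * (|σ.re| * |σ.im|) ≤ 3 * C * ‖z - complexify n ξ‖ * ‖ξ‖ := by
    rw [← abs_mul]
    have : 2 * |σ.re * σ.im| = |(complexForm a t z).im| := by
      rw [← e2, abs_mul 2, abs_two]
    rw [this]; exact e3
  have e8 : 2 * (c * ‖ξ‖ / (4 * C) * |σ.im|) ≤ 3 * C * ‖z - complexify n ξ‖ * ‖ξ‖ := by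
    refine le_trans ?_ e7
    gcongr
  rw [div_mul_eq_mul_div, le_div_iff₀ hc]
  have e9 : 2 * (c * ‖ξ‖ / (4 * C) * |σ.im|) = (|σ.im| * c) * (‖ξ‖ / (2 * C)) := by
    field_simp; norm_num
  rw [e9] at e8
  have e10 : 3 * C * ‖z - complexify n ξ‖ * ‖ξ‖ =
      (6 * C ^ 2 * ‖z - complexify n ξ‖) * (‖ξ‖ / (2 * C)) := by field_simp; ring
  rw [e10] at e8
  exact le_of_mul_le_mul_right e8 (by positivity)

theorem abs_im_phaseInt_le (h : WKBBounds a K ε c C N) {ξ : EuclideanSpace ℝ (Fin n)}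
    {z : EuclideanSpace ℂ (Fin n)} (hz : ‖z - complexify n ξ‖ < ε * ‖ξ‖) {t : ℝ} (ht : 0 ≤ t) :
    |(phaseInt a t z).im| ≤ 6 * C ^ 2 / c * ‖z - complexify n ξ‖ * t := by
  have hcont := h.continuous_root (z := z) ⟨ξ, hz⟩
  have e : (phaseInt a t z).im = ∫ τ in (0 : ℝ)..t, (slitRoot (complexForm a) τ z).im := by
    have := Complex.imCLM.intervalIntegral_comp_comm (hcont.intervalIntegrable (μ := MeasureTheory.volume) 0 t)
    exact this.symm
  rw [e]
  have := intervalIntegral.norm_integral_le_of_norm_le_const (a := 0) (b := t)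
    (f := fun τ => (slitRoot (complexForm a) τ z).im)
    (C := 6 * C ^ 2 / c * ‖z - complexify n ξ‖) fun τ hτ => by
      rw [uIoc_of_le ht] at hτ
      exact h.abs_im_root_le hz hτ.1.le
  rwa [sub_zero, abs_of_nonneg ht] at this

end WKBBounds

theorem norm_exp_signI_mul_le (s : ℤˣ) (w : ℂ) : ‖Complex.exp (signI s * w)‖ ≤ Real.exp |w.im| := by
  rw [Complex.norm_exp]
  refine Real.exp_le_exp.2 ?_
  rcases Int.units_eq_one_or s with rfl | rfl
  · simpa [signI] using neg_le_abs w.im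
  · simpa [signI] using le_abs_self w.im

end Hyperbolic

/-! ### Symbol estimates for the amplitudes. -/

section HyperbolicEstimates

open Set Metric

variable {n : ℕ} {a : Fin n → Fin n → ℝ → ℝ} {K : ℕ} {ε c C N : ℝ}

/-- Bounds for the solution with data `(α, β)` at the time `t₀` of entrance into the hyperbolic
zone. -/
structure EntranceBound (a : Fin n → Fin n → ℝ → ℝ) (ε N : ℝ) (α β : ℂ)
    (ξ : EuclideanSpace ℝ (Fin n)) (t₀ B : ℝ) : Prop where
  nonneg : 0 ≤ t₀
  le_mul : N ≤ (1 + t₀) * ‖ξ‖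
  mul_le : t₀ * ‖ξ‖ ≤ N
  bound_nonneg : 0 ≤ B
  sol_le : ∀ z, ‖z - complexify n ξ‖ < ε * ‖ξ‖ → ‖picardSol (complexForm a) α β t₀ z‖ ≤ B / ‖ξ‖
  vel_le : ∀ z, ‖z - complexify n ξ‖ < ε * ‖ξ‖ → ‖picardVel (complexForm a) α β t₀ z‖ ≤ B

namespace WKBBounds

variable {α β : ℂ} {ξ : EuclideanSpace ℝ (Fin n)} {t₀ B : ℝ}

/-- In the hyperbolic zone the small balls of radius `1/(1 + t)` lie inside the balls of radius `ε
|ξ|`; this is the purpose of `N ε ≥ 1`. -/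
theorem lt_of_lt_inv (h : WKBBounds a K ε c C N) {t : ℝ} (ht : 0 ≤ t) (hN : N ≤ (1 + t) * ‖ξ‖)
    {x : ℝ} (hx : x < 1 / (1 + t)) : x < ε * ‖ξ‖ := by
  refine hx.trans_le ?_
  rw [div_le_iff₀ (by linarith)]
  have := h.one_le_N_mul
  have := mul_le_mul_of_nonneg_right hN h.ε_pos.le
  linarith

theorem norm_pos (h : WKBBounds a K ε c C N) {t : ℝ} (ht : 0 ≤ t) (hN : N ≤ (1 + t) * ‖ξ‖) :
    0 < ‖ξ‖ := by
  have := h.one_le_N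
  by_contra! h0
  nlinarith

theorem gap_ne_zero (h : WKBBounds a K ε c C N) (s : ℤˣ) {t : ℝ} (ht : 0 ≤ t)
    (hN : N ≤ (1 + t) * ‖ξ‖) {z : EuclideanSpace ℂ (Fin n)}
    (hz : ‖z - complexify n ξ‖ < ε * ‖ξ‖) :
    wkbRoot a K s t z - wkbRoot a K (-s) t z ≠ 0 :=
  norm_pos_iff.1 ((mul_pos h.c_pos (h.norm_pos ht hN)).trans_le (h.gap_le s t ht ξ z hz hN))

theorem differentiableOn_phaseInt (h : WKBBounds a K ε c C N) {t : ℝ} (ht : 0 ≤ t) :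
    DifferentiableOn ℂ (phaseInt a t) (ball (complexify n ξ) (ε * ‖ξ‖)) := by
  have hmem : ∀ z ∈ ball (complexify n ξ) (ε * ‖ξ‖), z ∈ realCone n ε := fun z hz =>
    ⟨ξ, mem_ball_iff_norm.1 hz⟩
  have h0 : ∀ τ ∈ uIcc 0 t, 0 ≤ τ := fun τ hτ => by
    rw [uIcc_of_le ht] at hτ; exact hτ.1
  refine differentiableOn_intervalIntegral
    (fun τ hτ => ((h.root_symbol 0).base.hol τ (h0 τ hτ)).mono hmem)
    (fun z hz => (h.continuous_root (hmem z hz)).continuousOn) fun z hz => ?_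
  obtain ⟨r, hr, hr'⟩ := Metric.isOpen_iff.1 isOpen_ball z hz
  exact ⟨r, hr, C * ‖ξ‖, hr', fun τ hτ w hw =>
    h.root_le τ (h0 τ hτ) ξ w (mem_ball_iff_norm.1 (hr' hw))⟩

theorem norm_corr_le (h : WKBBounds a K ε c C N) (s : ℤˣ) {t : ℝ} (ht : 0 ≤ t)
    (hN : N ≤ (1 + t) * ‖ξ‖) {z : EuclideanSpace ℂ (Fin n)}
    (hz : ‖z - complexify n ξ‖ < ε * ‖ξ‖) : ‖wkbCorr a K s t z‖ ≤ 2 * C * ‖ξ‖ := by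
  have e : wkbCorr a K s t z = wkbRoot a K s t z - signI s * slitRoot (complexForm a) t z := by
    rw [wkbRoot]; ring
  rw [e]
  refine (norm_sub_le _ _).trans ?_
  rw [norm_mul, norm_signI, one_mul]
  linarith [h.wkbRoot_le s t ht ξ z hz hN, h.root_le t ht ξ z hz]

theorem differentiableOn_corrInt (h : WKBBounds a K ε c C N) (s : ℤˣ) (ht₀ : 0 ≤ t₀)
    (hN : N ≤ (1 + t₀) * ‖ξ‖) {t : ℝ} (ht : t₀ ≤ t) :
    DifferentiableOn ℂ (corrInt a K s t₀ t) (ball (complexify n ξ) (ε * ‖ξ‖)) := by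
  have hmem : ∀ z ∈ ball (complexify n ξ) (ε * ‖ξ‖), z ∈ realCone n ε := fun z hz =>
    ⟨ξ, mem_ball_iff_norm.1 hz⟩
  refine differentiableOn_intervalIntegral
    (fun τ _ => ((h.corr_symbol s 0).base.hol _ (le_max_right _ _)).mono hmem)
    (fun z hz => (h.continuous_corr s (hmem z hz)).continuousOn) fun z hz => ?_
  obtain ⟨r, hr, hr'⟩ := Metric.isOpen_iff.1 isOpen_ball z hz
  refine ⟨r, hr, 2 * C * ‖ξ‖, hr', fun τ hτ w hw => ?_⟩
  rw [uIcc_of_le ht] at hτ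
  have hτ0 := ht₀.trans hτ.1
  rw [max_eq_left hτ0]
  exact h.norm_corr_le s hτ0 (hN.trans (by gcongr; exact hτ.1)) (mem_ball_iff_norm.1 (hr' hw))

theorem differentiable_picard (h : WKBBounds a K ε c C N) (α β : ℂ) (t : ℝ) :
    Differentiable ℂ (picardSol (complexForm a) α β t) ∧
      Differentiable ℂ (picardVel (complexForm a) α β t) :=
  ⟨differentiable_picardSol differentiable_complexForm (continuous_complexForm h.coeff) h.form_le t,
    differentiable_picardVel differentiable_complexForm (continuous_complexForm h.coeff) h.form_le t⟩

theorem differentiableOn_wkbComp (h : WKBBounds a K ε c C N) (α β : ℂ) (s : ℤˣ) {t : ℝ} (ht : 0 ≤ t)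
    (hN : N ≤ (1 + t) * ‖ξ‖) :
    DifferentiableOn ℂ (wkbComp a K α β s t) (ball (complexify n ξ) (ε * ‖ξ‖)) := by
  have hmem : ∀ z ∈ ball (complexify n ξ) (ε * ‖ξ‖), z ∈ realCone n ε := fun z hz =>
    ⟨ξ, mem_ball_iff_norm.1 hz⟩
  have hroot : ∀ s, DifferentiableOn ℂ (wkbRoot a K s t) (ball (complexify n ξ) (ε * ‖ξ‖)) :=
    fun s => ((((h.root_symbol 0).base.hol t ht).mono hmem).const_mul (signI s)).add
      (((h.corr_symbol s 0).base.hol t ht).mono hmem)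
  obtain ⟨h1, h2⟩ := h.differentiable_picard α β t
  have hinv := ((hroot s).fun_sub (hroot (-s))).fun_inv fun z hz =>
    h.gap_ne_zero s ht hN (mem_ball_iff_norm.1 hz)
  refine ((h2.differentiableOn.fun_sub ((hroot (-s)).fun_mul h1.differentiableOn)).fun_mul
    hinv).congr fun z _ => ?_
  rw [wkbComp, div_eq_mul_inv]

theorem differentiableOn_hypAmp (h : WKBBounds a K ε c C N) (α β : ℂ) (s : ℤˣ) {t : ℝ} (ht : 0 ≤ t)
    (hN : N ≤ (1 + t) * ‖ξ‖) :
    DifferentiableOn ℂ (hypAmp a K α β s t) (ball (complexify n ξ) (ε * ‖ξ‖)) :=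
  (((h.differentiableOn_phaseInt ht).const_mul (signI s)).fun_neg.cexp).mul
    (h.differentiableOn_wkbComp α β s ht hN)

theorem differentiableOn_normAmp (h : WKBBounds a K ε c C N) (α β : ℂ) (s : ℤˣ) (ht₀ : 0 ≤ t₀)
    (hN : N ≤ (1 + t₀) * ‖ξ‖) {t : ℝ} (ht : t₀ ≤ t) :
    DifferentiableOn ℂ (normAmp a K α β t₀ s t) (ball (complexify n ξ) (ε * ‖ξ‖)) :=
  ((((h.differentiableOn_phaseInt (ht₀.trans ht)).const_mul (signI s)).add
    (h.differentiableOn_corrInt s ht₀ hN ht)).fun_neg.cexp).mul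
    (h.differentiableOn_wkbComp α β s (ht₀.trans ht) (hN.trans (by gcongr)))

theorem norm_wkbComp_le (h : WKBBounds a K ε c C N) (s : ℤˣ) (e : EntranceBound a ε N α β ξ t₀ B)
    {z : EuclideanSpace ℂ (Fin n)} (hz : ‖z - complexify n ξ‖ < ε * ‖ξ‖) :
    ‖wkbComp a K α β s t₀ z‖ ≤ (1 + C) / c * (B / ‖ξ‖) := by
  have hξ := h.norm_pos e.nonneg e.le_mul
  have hc := h.c_pos
  have hC := h.C_pos
  have hB := e.bound_nonneg
  rw [wkbComp, norm_div]
  have h1 := h.gap_le s t₀ e.nonneg ξ z hz e.le_mul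
  have h2 := h.wkbRoot_le (-s) t₀ e.nonneg ξ z hz e.le_mul
  have h3 : ‖picardVel (complexForm a) α β t₀ z - wkbRoot a K (-s) t₀ z *
      picardSol (complexForm a) α β t₀ z‖ ≤ (1 + C) * B := by
    refine (norm_sub_le _ _).trans ?_
    rw [norm_mul]
    calc _ ≤ B + (C * ‖ξ‖) * (B / ‖ξ‖) := by
          gcongr
          · exact e.vel_le z hz
          · exact e.sol_le z hz
      _ = (1 + C) * B := by field_simp
  calc _ ≤ (1 + C) * B / (c * ‖ξ‖) := by gcongr
    _ = _ := by rw [mul_div_mul_comm]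

/-- At the entrance time `t₀ |ξ| ≤ N`, so even the complex phase is bounded on the whole ball of
radius `ε |ξ|`. Cauchy's estimate for the starting value therefore loses only powers of `|ξ|⁻¹`. -/
theorem norm_normAmp_entrance_le (h : WKBBounds a K ε c C N) (s : ℤˣ)
    (e : EntranceBound a ε N α β ξ t₀ B) {z : EuclideanSpace ℂ (Fin n)}
    (hz : ‖z - complexify n ξ‖ < ε * ‖ξ‖) :
    ‖normAmp a K α β t₀ s t₀ z‖ ≤ Real.exp (C * N) * ((1 + C) / c) * (B / ‖ξ‖) := by
  have e0 : corrInt a K s t₀ t₀ z = 0 := intervalIntegral.integral_same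
  rw [normAmp, e0, add_zero, norm_mul, mul_assoc]
  gcongr
  · refine (Complex.norm_exp_le_exp_norm _).trans (Real.exp_le_exp.2 ?_)
    rw [norm_neg, norm_mul, norm_signI, one_mul]
    refine (h.norm_phaseInt_le hz e.nonneg).trans ?_
    have := h.C_pos
    gcongr
    exact e.mul_le
  · exact h.norm_wkbComp_le s e hz

theorem norm_phaseInt_exp_le (h : WKBBounds a K ε c C N) (s : ℤˣ) {z : EuclideanSpace ℂ (Fin n)}
    {t τ : ℝ} (hτ : 0 ≤ τ) (hτt : τ ≤ t) (hz : ‖z - complexify n ξ‖ < ε * ‖ξ‖)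
    (hzt : ‖z - complexify n ξ‖ < 1 / (1 + t)) :
    ‖Complex.exp (signI s * phaseInt a τ z)‖ ≤ Real.exp (6 * C ^ 2 / c) := by
  refine (norm_exp_signI_mul_le s _).trans (Real.exp_le_exp.2 ?_)
  refine (h.abs_im_phaseInt_le hz hτ).trans ?_
  rw [lt_div_iff₀ (by linarith)] at hzt
  have hc := h.c_pos
  have hC := h.C_pos
  rw [mul_assoc]
  refine mul_le_of_le_one_right (by positivity) ?_
  nlinarith [norm_nonneg (z - complexify n ξ)]

/-- The normalized amplitudes are nearly constant in time on balls of radius `1 / (1 + t)`. -/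
theorem exists_norm_normAmp_le (h : WKBBounds a K ε c C N) :
    ∃ D : ℝ, 0 < D ∧ ∀ (α β : ℂ) (ξ : EuclideanSpace ℝ (Fin n)) (t₀ B : ℝ),
      EntranceBound a ε N α β ξ t₀ B → ∀ t, t₀ ≤ t → ∀ z, ‖z - complexify n ξ‖ < 1 / (1 + t) →
      ∀ s τ, t₀ ≤ τ → τ ≤ t → ‖normAmp a K α β t₀ s τ z‖ ≤ D * (B / ‖ξ‖) ∧
      ‖normAmp a K α β t₀ s t z - normAmp a K α β t₀ s τ z‖ ≤
        D * B * (((1 + τ) * ‖ξ‖)⁻¹) ^ (K + 2) * (t - τ) := by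
  obtain ⟨H, hH1, hH⟩ := h.exists_norm_exp_corrInt_le
  have hc := h.c_pos
  have hC := h.C_pos
  set E : ℝ := Real.exp (6 * C ^ 2 / c) with hE
  -- Residual over gap contributes `C / c`; the bracket collects the diagonal term and the coupling,
  -- with `E` for the phase and one `H` for each of the two lower order exponentials.
  set Λ : ℝ := C / c * (1 + E ^ 2 * H * H) with hΛ
  have hΛ0 : 0 < Λ := by positivity
  set D₁ : ℝ := Real.exp (Λ + 1) * (Real.exp (C * N) * ((1 + C) / c)) with hD₁
  have hD₁0 : 0 < D₁ := by positivity
  refine ⟨D₁ + Λ * D₁, by positivity, fun α β ξ t₀ B e t ht z hzt => ?_⟩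
  have hξ := h.norm_pos e.nonneg e.le_mul
  have hB := e.bound_nonneg
  have hNt : ∀ τ, t₀ ≤ τ → N ≤ (1 + τ) * ‖ξ‖ := fun τ hτ => e.le_mul.trans (by gcongr)
  have hz := h.lt_of_lt_inv (e.nonneg.trans ht) (hNt t ht) hzt
  have hzΓ : z ∈ realCone n ε := ⟨ξ, hz⟩
  set y : ℝ → ℤˣ → ℂ := fun τ s => normAmp a K α β t₀ s τ z with hy
  set y' : ℝ → ℤˣ → ℂ := fun t s =>
      (-(wkbRes a K s t z * normAmp a K α β t₀ s t z +
        wkbRes a K (-s) t z * (Complex.exp (-(signI s * phaseInt a t z)) ^ 2 *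
          Complex.exp (corrInt a K (-s) t₀ t z) * Complex.exp (-corrInt a K s t₀ t z)) *
          normAmp a K α β t₀ (-s) t z) / (wkbRoot a K s t z - wkbRoot a K (-s) t z)) with hy'
  have hd : ∀ τ ∈ Icc t₀ t, HasDerivWithinAt y (y' τ) (Ici 0) τ := fun τ hτ =>
    hasDerivWithinAt_pi.2 fun s => h.hasDerivWithinAt_normAmp t₀ s hzΓ (e.nonneg.trans hτ.1)
      (h.gap_ne_zero s (e.nonneg.trans hτ.1) (hNt τ hτ.1) hz)
  have hd' : ∀ τ ∈ Icc t₀ t, ‖y' τ‖ ≤ Λ * ‖ξ‖ * (((1 + τ) * ‖ξ‖)⁻¹) ^ (K + 2) * ‖y τ‖ := by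
    intro τ hτ
    have hτ0 := e.nonneg.trans hτ.1
    have hτN := hNt τ hτ.1
    have hτp : 0 < 1 + τ := by linarith
    refine (pi_norm_le_iff_of_nonneg (by positivity)).2 fun s => ?_
    have r1 := h.res_le s τ hτ0 ξ z hz hτN
    have r2 := h.res_le (-s) τ hτ0 ξ z hz hτN
    have g := h.gap_le s τ hτ0 ξ z hz hτN
    have y1 : ‖normAmp a K α β t₀ s τ z‖ ≤ ‖y τ‖ := norm_le_pi_norm (y τ) s
    have y2 : ‖normAmp a K α β t₀ (-s) τ z‖ ≤ ‖y τ‖ := norm_le_pi_norm (y τ) (-s)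
    have c1 := (hH ξ t₀ e.nonneg e.le_mul z hz (-s) τ hτ.1).1
    have c2 := (hH ξ t₀ e.nonneg e.le_mul z hz s τ hτ.1).2
    have p1 : ‖Complex.exp (-(signI s * phaseInt a τ z))‖ ≤ E := by
      have := h.norm_phaseInt_exp_le (-s) hτ0 hτ.2 hz hzt
      rwa [signI_neg, neg_mul] at this
    set X : ℝ := C * ‖ξ‖ ^ 2 * (((1 + τ) * ‖ξ‖)⁻¹) ^ (K + 2) with hX
    have hX0 : 0 ≤ X := by positivity
    have num : ‖wkbRes a K s τ z * normAmp a K α β t₀ s τ z +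
        wkbRes a K (-s) τ z * (Complex.exp (-(signI s * phaseInt a τ z)) ^ 2 *
          Complex.exp (corrInt a K (-s) t₀ τ z) * Complex.exp (-corrInt a K s t₀ τ z)) *
          normAmp a K α β t₀ (-s) τ z‖ ≤ X * (1 + E ^ 2 * H * H) * ‖y τ‖ := by
      refine (norm_add_le _ _).trans ?_
      simp only [norm_mul, norm_pow]
      calc _ ≤ X * ‖y τ‖ + X * (E ^ 2 * H * H) * ‖y τ‖ := by gcongr
        _ = _ := by ring
    simp only [hy', norm_div, norm_neg]
    calc _ ≤ X * (1 + E ^ 2 * H * H) * ‖y τ‖ / (c * ‖ξ‖) := by gcongr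
      _ = _ := by
        rw [hX, hΛ]
        field_simp
  have hinv : ∀ τ, t₀ ≤ τ → 0 ≤ ((1 + τ) * ‖ξ‖)⁻¹ ∧ ((1 + τ) * ‖ξ‖)⁻¹ ≤ 1 := fun τ hτ => by
    have h1 : 1 ≤ (1 + τ) * ‖ξ‖ := h.one_le_N.trans (hNt τ hτ)
    exact ⟨by positivity, inv_le_one_of_one_le₀ h1⟩
  have hy0 : ‖y t₀‖ ≤ Real.exp (C * N) * ((1 + C) / c) * (B / ‖ξ‖) :=
    (pi_norm_le_iff_of_nonneg (by positivity)).2 fun s => h.norm_normAmp_entrance_le s e hz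
  have bnd : ∀ τ ∈ Icc t₀ t, ‖y τ‖ ≤ D₁ * (B / ‖ξ‖) := by
    intro τ hτ
    -- For boundedness two of the `K + 2` powers suffice: `|ξ| ((1 + σ)|ξ|)^(-2) = 1/(|ξ| (1 + σ)²)`
    -- is the integrable weight.
    have := norm_le_of_norm_deriv_le_weight (lam := ‖ξ‖) (C := Λ) e.nonneg
      (h.one_le_N.trans e.le_mul) hΛ0.le hd (fun σ hσ => by
        refine (hd' σ hσ).trans ?_
        gcongr
        have hσp : 0 < 1 + σ := by linarith [e.nonneg, hσ.1]
        calc Λ * ‖ξ‖ * (((1 + σ) * ‖ξ‖)⁻¹) ^ (K + 2) ≤ Λ * ‖ξ‖ * (((1 + σ) * ‖ξ‖)⁻¹) ^ 2 := by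
              refine mul_le_mul_of_nonneg_left ?_ (by positivity)
              exact pow_le_pow_of_le_one (hinv σ hσ.1).1 (hinv σ hσ.1).2 (by omega)
          _ = _ := by field_simp) hτ
    refine this.trans ?_
    rw [hD₁, mul_assoc]
    gcongr
  intro s τ hτ hτt
  refine ⟨((norm_le_pi_norm (y τ) s).trans (bnd τ ⟨hτ, hτt⟩)).trans ?_, ?_⟩
  · have : 0 ≤ Λ * D₁ := by positivity
    gcongr
    linarith
  · have key := (convex_Icc τ t).norm_image_sub_le_of_norm_hasDerivWithin_le
      (f := y) (f' := y') (C := (D₁ + Λ * D₁) * B * (((1 + τ) * ‖ξ‖)⁻¹) ^ (K + 2))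
      (fun σ hσ => (hd σ ⟨hτ.trans hσ.1, hσ.2⟩).mono
        fun x hx => (e.nonneg.trans hτ).trans hx.1) (fun σ hσ => by
        have hσp : 0 < 1 + σ := by linarith [e.nonneg, hσ.1]
        have hτp : 0 < 1 + τ := by linarith [e.nonneg]
        calc ‖y' σ‖ ≤ Λ * ‖ξ‖ * (((1 + σ) * ‖ξ‖)⁻¹) ^ (K + 2) * ‖y σ‖ :=
              hd' σ ⟨hτ.trans hσ.1, hσ.2⟩
          _ ≤ Λ * ‖ξ‖ * (((1 + τ) * ‖ξ‖)⁻¹) ^ (K + 2) * (D₁ * (B / ‖ξ‖)) := by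
              gcongr
              · exact hσ.1
              · exact bnd σ ⟨hτ.trans hσ.1, hσ.2⟩
          _ = Λ * D₁ * B * (((1 + τ) * ‖ξ‖)⁻¹) ^ (K + 2) := by field_simp
          _ ≤ _ := by gcongr; linarith)
      (left_mem_Icc.2 hτt) (right_mem_Icc.2 hτt)
    rw [Real.norm_of_nonneg (sub_nonneg.2 hτt)] at key
    exact (norm_le_pi_norm (y t - y τ) s).trans key

theorem hypAmp_eq (s : ℤˣ) (t₀ t : ℝ) (z : EuclideanSpace ℂ (Fin n)) :
    hypAmp a K α β s t z = Complex.exp (corrInt a K s t₀ t z) * normAmp a K α β t₀ s t z := by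
  rw [hypAmp, normAmp, ← mul_assoc, ← Complex.exp_add]
  congr 2
  ring

theorem picardSol_eq_add_hypAmp (h : WKBBounds a K ε c C N) {t : ℝ} (ht : 0 ≤ t)
    (hN : N ≤ (1 + t) * ‖ξ‖) {z : EuclideanSpace ℂ (Fin n)}
    (hz : ‖z - complexify n ξ‖ < ε * ‖ξ‖) :
    picardSol (complexForm a) α β t z =
      ∑ s : ℤˣ, Complex.exp (signI s * phaseInt a t z) * hypAmp a K α β s t z := by
  have h1 : ∀ s, Complex.exp (signI s * phaseInt a t z) * hypAmp a K α β s t z =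
      wkbComp a K α β s t z := fun s => by
    rw [hypAmp, ← mul_assoc, ← Complex.exp_add, add_neg_cancel, Complex.exp_zero, one_mul]
  simp only [h1]
  have hu : (Finset.univ : Finset ℤˣ) = {1, -1} := by decide
  rw [hu, Finset.sum_pair (by decide), wkbComp, wkbComp, neg_neg]
  have g := h.gap_ne_zero 1 ht hN hz
  have g' : wkbRoot a K (-1) t z - wkbRoot a K 1 t z = -(wkbRoot a K 1 t z - wkbRoot a K (-1) t z) :=
    by ring
  rw [g']
  field_simp
  ring

/-- On balls of radius `1/(1 + t)` both the phase factors and the amplitudes are bounded, so the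
decomposition bounds the solution itself off the real space. This feeds the temperate growth of the
multiplier. -/
theorem exists_norm_picardSol_le (h : WKBBounds a K ε c C N) :
    ∃ D : ℝ, 0 < D ∧ ∀ (α β : ℂ) (ξ : EuclideanSpace ℝ (Fin n)) (t₀ B : ℝ),
      EntranceBound a ε N α β ξ t₀ B → ∀ t, t₀ ≤ t → ∀ z, ‖z - complexify n ξ‖ < 1 / (1 + t) →
      ‖picardSol (complexForm a) α β t z‖ ≤ D * (B / ‖ξ‖) := by
  obtain ⟨H, hH1, hH⟩ := h.exists_norm_exp_corrInt_le
  obtain ⟨D, hD, hb⟩ := h.exists_norm_normAmp_le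
  set E : ℝ := Real.exp (6 * C ^ 2 / c) with hE
  refine ⟨2 * (E * (H * D)), by positivity, fun α β ξ t₀ B e t ht z hzt => ?_⟩
  have hB := e.bound_nonneg
  have hN : N ≤ (1 + t) * ‖ξ‖ := e.le_mul.trans (by gcongr)
  have hz := h.lt_of_lt_inv (e.nonneg.trans ht) hN hzt
  rw [h.picardSol_eq_add_hypAmp (e.nonneg.trans ht) hN hz]
  refine (norm_sum_le_of_le _ (fun s _ => ?_ : ∀ s ∈ Finset.univ, _ ≤ E * (H * (D * (B / ‖ξ‖))))).trans
    (le_of_eq ?_)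
  · rw [norm_mul, hypAmp_eq s t₀ t z, norm_mul]
    gcongr
    · exact h.norm_phaseInt_exp_le s (e.nonneg.trans ht) le_rfl hz hzt
    · exact (hH ξ t₀ e.nonneg e.le_mul z hz s t ht).1
    · exact (hb α β ξ t₀ B e t ht z hzt s t ht le_rfl).1
  · simp
    ring

end WKBBounds

theorem exists_uniform_cauchy_const {E V : Type*} [NormedAddCommGroup E] [NormedSpace ℂ E]
    [FiniteDimensional ℂ E] [NormedAddCommGroup V] [NormedSpace ℝ V] (L : V →L[ℝ] E)
    (hL : ∀ y, ‖L y‖ ≤ ‖y‖) (m : ℕ) :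
    ∃ C > 0, ∀ i ≤ m, ∀ (f : E → ℂ) (x : V) (r M : ℝ), 0 < r → DifferentiableOn ℂ f (ball (L x) r) →
      (∀ z ∈ ball (L x) r, ‖f z‖ ≤ M) →
      ‖iteratedFDeriv ℝ i (fun v => f (L v)) x‖ ≤ C * M * (r⁻¹) ^ i := by
  choose C hC hb using norm_iteratedFDeriv_comp_le_of_forall_mem_ball L hL
  refine ⟨∑ i ∈ Finset.range (m + 1), C i, Finset.sum_pos (fun i _ => hC i) (by simp),
    fun i hi f x r M hr hf hM => (hb i f x r M hr hf hM).trans ?_⟩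
  have hM0 : 0 ≤ M := (norm_nonneg _).trans (hM _ (mem_ball_self hr))
  rw [div_eq_mul_inv, ← inv_pow]
  gcongr
  exact Finset.single_le_sum (f := C) (fun i _ => (hC i).le) (by simp; omega)

namespace WKBBounds

set_option maxHeartbeats 1000000 in
/-- Symbol estimates for the amplitudes in the hyperbolic zone. -/
theorem exists_norm_iteratedFDeriv_hypAmp_le (h : WKBBounds a K ε c C N) :
    ∃ D : ℝ, 0 < D ∧ ∀ (α β : ℂ) (ξ : EuclideanSpace ℝ (Fin n)) (t₀ B : ℝ),
      EntranceBound a ε N α β ξ t₀ B → ∀ t, t₀ ≤ t → ∀ s, ∀ m ≤ K,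
      ‖iteratedFDeriv ℝ m (fun v => hypAmp a K α β s t (complexify n v)) ξ‖ ≤
        D * (B / ‖ξ‖) * (‖ξ‖⁻¹) ^ m := by
  obtain ⟨H, hH1, hH⟩ := h.exists_norm_exp_corrInt_le
  obtain ⟨D, hD, hb⟩ := h.exists_norm_normAmp_le
  obtain ⟨A, hA, hcau⟩ := exists_uniform_cauchy_const (complexify n) (fun y => (norm_complexify y).le) K
  have hc := h.c_pos
  have hC := h.C_pos
  have hε := h.ε_pos
  have hε1 : 1 ≤ ε⁻¹ := (one_le_inv₀ hε).2 (h.ε_le.trans (by norm_num))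
  set D₁ : ℝ := A * (Real.exp (C * N) * ((1 + C) / c)) * (ε⁻¹) ^ K with hD₁
  set D₂ : ℝ := A * D * 2 ^ (K + 2) with hD₂
  set D₃ : ℝ := A * H * (ε⁻¹) ^ K with hD₃
  refine ⟨2 ^ K * (D₃ * (D₁ + 2 * D₂)), by positivity, fun α β ξ t₀ B e t ht s m hm => ?_⟩
  have hξ := h.norm_pos e.nonneg e.le_mul
  have hB := e.bound_nonneg
  have hR : 0 < ε * ‖ξ‖ := by positivity
  have hNt : ∀ τ, t₀ ≤ τ → N ≤ (1 + τ) * ‖ξ‖ := fun τ hτ => e.le_mul.trans (by gcongr)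
  set U : Set (EuclideanSpace ℝ (Fin n)) := complexify n ⁻¹' ball (complexify n ξ) (ε * ‖ξ‖) with hU
  have hUo : IsOpen U := isOpen_ball.preimage (complexify n).continuous
  have hξU : ξ ∈ U := mem_ball_self hR
  have smooth : ∀ f : EuclideanSpace ℂ (Fin n) → ℂ,
      DifferentiableOn ℂ f (ball (complexify n ξ) (ε * ‖ξ‖)) →
      ContDiffOn ℝ ∞ (fun v => f (complexify n v)) U := fun f hf =>
    ((hf.contDiffOn_complex isOpen_ball).restrict_scalars ℝ).comp
      (complexify n).contDiff.contDiffOn fun v hv => hv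
  have hinvpow : ∀ i ≤ K, ((ε * ‖ξ‖)⁻¹) ^ i ≤ (ε⁻¹) ^ K * (‖ξ‖⁻¹) ^ i := fun i hi => by
    rw [mul_inv, mul_pow]
    gcongr
  -- This factor has no oscillation and is bounded on the full ball of radius `ε |ξ|`.
  have hcorr : ∀ i ≤ m,
      ‖iteratedFDeriv ℝ i (fun v => Complex.exp (corrInt a K s t₀ t (complexify n v))) ξ‖ ≤
        D₃ * (‖ξ‖⁻¹) ^ i := fun i hi => by
    refine (hcau i (hi.trans hm) (fun z => Complex.exp (corrInt a K s t₀ t z)) ξ _ H hR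
      (h.differentiableOn_corrInt s e.nonneg e.le_mul ht).cexp fun z hz =>
      (hH ξ t₀ e.nonneg e.le_mul z (mem_ball_iff_norm.1 hz) s t ht).1).trans ?_
    rw [hD₃, mul_assoc (A * H)]
    gcongr
    exact hinvpow i (hi.trans hm)
  have hamp : ∀ i ≤ m,
      ‖iteratedFDeriv ℝ i (fun v => normAmp a K α β t₀ s t (complexify n v)) ξ‖ ≤
        (D₁ + 2 * D₂) * (B / ‖ξ‖) * (‖ξ‖⁻¹) ^ i := fun i hi => by
    have hiK := hi.trans hm
    -- The normalized amplitude at time `t` is bounded only on a ball of radius `1/(1 + t)`. Its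
    -- starting value is estimated on the large ball and its dyadic increments on the small ones.
    have step := le_of_dyadic_increments (lam := ‖ξ‖)
      (f := fun t => ‖iteratedFDeriv ℝ i (fun v => normAmp a K α β t₀ s t (complexify n v)) ξ‖)
      (C := D₁ * (B / ‖ξ‖) * (‖ξ‖⁻¹) ^ i) (D := D₂ * (B / ‖ξ‖) * (‖ξ‖⁻¹) ^ i) e.nonneg
      (h.one_le_N.trans e.le_mul) (by positivity) (by
        refine (hcau i hiK (normAmp a K α β t₀ s t₀) ξ _ _ hR
          (h.differentiableOn_normAmp α β s e.nonneg e.le_mul le_rfl) fun z hz =>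
          h.norm_normAmp_entrance_le s e (mem_ball_iff_norm.1 hz)).trans ?_
        calc _ ≤ A * (Real.exp (C * N) * ((1 + C) / c) * (B / ‖ξ‖)) *
              ((ε⁻¹) ^ K * (‖ξ‖⁻¹) ^ i) := by
              gcongr
              exact hinvpow i hiK
          _ = _ := by rw [hD₁]; ring) (fun σ τ hσ hστ hτ => by
        have hσ0 : 0 < 1 + σ := by linarith [e.nonneg]
        have hτ0 : 0 < 1 + τ := by linarith
        have hball : ball (complexify n ξ) (1 / (1 + τ)) ⊆ ball (complexify n ξ) (ε * ‖ξ‖) :=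
          fun z hz => mem_ball_iff_norm.2 (h.lt_of_lt_inv (by linarith [e.nonneg]) (hNt τ (hσ.trans hστ))
            (mem_ball_iff_norm.1 hz))
        have dσ := h.differentiableOn_normAmp α β s e.nonneg e.le_mul hσ
        have dτ := h.differentiableOn_normAmp α β s e.nonneg e.le_mul (hσ.trans hστ)
        have diff := hcau i hiK (fun z => normAmp a K α β t₀ s τ z - normAmp a K α β t₀ s σ z) ξ
          (1 / (1 + τ)) _ (by positivity) ((dτ.sub dσ).mono hball) fun z hz =>
          (hb α β ξ t₀ B e τ (hσ.trans hστ) z (mem_ball_iff_norm.1 hz) s σ hσ hστ).2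
        have cd : ∀ ρ, t₀ ≤ ρ → ContDiffAt ℝ i (fun v => normAmp a K α β t₀ s ρ (complexify n v)) ξ :=
          fun ρ hρ => ((smooth _ (h.differentiableOn_normAmp α β s e.nonneg e.le_mul hρ)).contDiffAt
            (hUo.mem_nhds hξU)).of_le (by exact_mod_cast le_top)
        have sub := iteratedFDeriv_sub_apply (cd τ (hσ.trans hστ)) (cd σ hσ)
        have sub' : iteratedFDeriv ℝ i (fun v => normAmp a K α β t₀ s τ (complexify n v) -
            normAmp a K α β t₀ s σ (complexify n v)) ξ = _ := sub
        rw [sub'] at diff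
        have tri := norm_sub_norm_le
          (iteratedFDeriv ℝ i (fun v => normAmp a K α β t₀ s τ (complexify n v)) ξ)
          (iteratedFDeriv ℝ i (fun v => normAmp a K α β t₀ s σ (complexify n v)) ξ)
        -- For `1 + τ ≤ 2 (1 + σ)` the balance is `(1 + τ)^(i + 1) ((1 + τ)|ξ|)^(-(i + 2)) = |ξ|^(-i
        -- - 1) ((1 + τ)|ξ|)^(-1)`; the surplus `K - i` of powers is discarded.
        suffices hs : A * (D * B * (((1 + σ) * ‖ξ‖)⁻¹) ^ (K + 2) * (τ - σ)) *
            ((1 / (1 + τ))⁻¹) ^ i ≤ D₂ * (B / ‖ξ‖) * (‖ξ‖⁻¹) ^ i / ((1 + τ) * ‖ξ‖) by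
          linarith
        have x1 : 1 ≤ (1 + τ) * ‖ξ‖ := h.one_le_N.trans (hNt τ (hσ.trans hστ))
        have x2 : ((1 + σ) * ‖ξ‖)⁻¹ ≤ 2 * ((1 + τ) * ‖ξ‖)⁻¹ := by
          rw [← div_eq_mul_inv, inv_le_comm₀ (by positivity) (by positivity), inv_div,
            div_le_iff₀ two_pos]
          nlinarith
        have x3 : (((1 + τ) * ‖ξ‖)⁻¹) ^ (K + 2) ≤ (((1 + τ) * ‖ξ‖)⁻¹) ^ (i + 2) :=
          pow_le_pow_of_le_one (by positivity) (inv_le_one_of_one_le₀ x1) (by omega)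
        calc A * (D * B * (((1 + σ) * ‖ξ‖)⁻¹) ^ (K + 2) * (τ - σ)) * ((1 / (1 + τ))⁻¹) ^ i
            ≤ A * (D * B * (2 * ((1 + τ) * ‖ξ‖)⁻¹) ^ (K + 2) * (1 + τ)) * (1 + τ) ^ i := by
              rw [one_div, inv_inv]
              gcongr
              linarith
          _ ≤ A * (D * B * (2 ^ (K + 2) * (((1 + τ) * ‖ξ‖)⁻¹) ^ (i + 2)) * (1 + τ)) * (1 + τ) ^ i := by
              rw [mul_pow]
              gcongr
          _ = _ := by
              rw [hD₂, mul_inv, mul_pow, pow_add _ i 2, pow_add _ i 2, inv_pow (1 + τ) i]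
              field_simp) ht
    refine step.trans (le_of_eq (by ring))
  have prod := norm_iteratedFDeriv_mul_le_of_isOpen hUo hξU (m := m)
    (smooth _ (h.differentiableOn_corrInt s e.nonneg e.le_mul ht).cexp)
    (smooth _ (h.differentiableOn_normAmp α β s e.nonneg e.le_mul ht)) (by positivity) hcorr hamp
  simp only [← hypAmp_eq] at prod
  refine prod.trans ?_
  rw [← mul_assoc D₃, ← mul_assoc (2 ^ m)]
  have : (2 : ℝ) ^ m ≤ 2 ^ K := pow_le_pow_right₀ (by norm_num) hm
  gcongr

end WKBBounds

end HyperbolicEstimates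

/-! ### The fundamental solutions in both zones. -/

section FundamentalSolutions

open Set Metric Topology

variable {n : ℕ}

/-- The solution of `y'' + q y = 0` with `y^(i)(0) = δ_ij`, `i = 0, 1`. -/
noncomputable def fundSol (a : Fin n → Fin n → ℝ → ℝ) (j : Fin 2) (t : ℝ)
    (z : EuclideanSpace ℂ (Fin n)) : ℂ :=
  picardSol (complexForm a) (![1, 0] j) (![0, 1] j) t z

/-- The time derivative of `fundSol`. -/
noncomputable def fundVel (a : Fin n → Fin n → ℝ → ℝ) (j : Fin 2) (t : ℝ)
    (z : EuclideanSpace ℂ (Fin n)) : ℂ :=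
  picardVel (complexForm a) (![1, 0] j) (![0, 1] j) t z

variable {a : Fin n → Fin n → ℝ → ℝ} {K : ℕ} {ε c C N : ℝ}

/-- The scaling `μ^(-j)` comes from `1 ≤ exp (μ|t|)` for `j = 0` and `|t| ≤ μ⁻¹ exp (μ|t|)` for `j =
1`. The choice `μ ~ |ξ|` serves the entrance data, `μ ~ 1/(1 + t)` the pseudo-differential zone. -/
theorem norm_fund_le {z : EuclideanSpace ℂ (Fin n)} {Q μ : ℝ} (hQ : ∀ t, ‖complexForm a t z‖ ≤ Q)
    (hμ : 0 < μ) (hQμ : 2 * Q ≤ μ ^ 2) (j : Fin 2) (t : ℝ) :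
    ‖fundSol a j t z‖ ≤ 2 * (μ⁻¹) ^ (j : ℕ) * Real.exp (μ * |t|) ∧
      ‖fundVel a j t z‖ ≤ 4 * μ * (μ⁻¹) ^ (j : ℕ) * Real.exp (μ * |t|) := by
  have h1 : ∀ t, 1 ≤ Real.exp (μ * |t|) := fun t => Real.one_le_exp (by positivity)
  fin_cases j
  · have hG : ∀ t : ℝ, ‖(![1, 0] (0 : Fin 2) : ℂ) + ![0, 1] (0 : Fin 2) * t‖ ≤
        1 * Real.exp (μ * |t|) := fun t => by simpa using h1 t
    refine ⟨(norm_picardSol_le hQ hμ hQμ hG t).trans (by simp),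
      (norm_picardVel_le hQ hμ hQμ hG t).trans ?_⟩
    have : 0 < μ * Real.exp (μ * |t|) := by positivity
    simp
    linarith
  · have hG : ∀ t : ℝ, ‖(![1, 0] (1 : Fin 2) : ℂ) + ![0, 1] (1 : Fin 2) * t‖ ≤
        μ⁻¹ * Real.exp (μ * |t|) := fun t => by
      rw [inv_mul_eq_div, le_div_iff₀ hμ]
      have := Real.add_one_le_exp (μ * |t|)
      simp
      linarith
    refine ⟨(norm_picardSol_le hQ hμ hQμ hG t).trans (le_of_eq (by simp; ring)),
      (norm_picardVel_le hQ hμ hQμ hG t).trans ?_⟩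
    have e : μ * μ⁻¹ = 1 := mul_inv_cancel₀ hμ.ne'
    simp only [e, one_mul, mul_assoc]
    simp
    rw [← mul_assoc μ, e, one_mul]
    linarith [h1 t]

namespace WKBBounds

/-- The entrance time is the first nonnegative time with `(1 + t)|ξ| ≥ N`. Up to it the Picard bound
with `μ = M |ξ|` costs only the constant `exp (M N)`. -/
theorem exists_entranceBound (h : WKBBounds a K ε c C N) :
    ∃ D : ℝ, 0 < D ∧ ∀ (j : Fin 2) (ξ : EuclideanSpace ℝ (Fin n)), ξ ≠ 0 →
      EntranceBound a ε N (![1, 0] j) (![0, 1] j) ξ (max 0 (N / ‖ξ‖ - 1))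
        (D * (‖ξ‖ * (‖ξ‖⁻¹) ^ (j : ℕ))) := by
  have hC := h.C_pos
  have hN := h.one_le_N
  -- On the complex ball `|q| ≤ C (2|ξ|)²`, and `8 C ≤ M²` is the smallness condition for `μ = M
  -- |ξ|`.
  set M : ℝ := 1 + 8 * C with hM
  have hM1 : 1 ≤ M := by linarith
  refine ⟨4 * M * Real.exp (M * N), by positivity, fun j ξ hξ => ?_⟩
  have hξ' : 0 < ‖ξ‖ := norm_pos_iff.2 hξ
  have hmul : max 0 (N / ‖ξ‖ - 1) * ‖ξ‖ ≤ N := by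
    rcases le_total (N / ‖ξ‖ - 1) 0 with h0 | h0
    · rw [max_eq_left h0, zero_mul]; linarith
    · rw [max_eq_right h0, sub_mul, div_mul_cancel₀ _ hξ'.ne']; linarith
  have hle : N ≤ (1 + max 0 (N / ‖ξ‖ - 1)) * ‖ξ‖ := by
    rw [← div_le_iff₀ hξ']
    linarith [le_max_right 0 (N / ‖ξ‖ - 1)]
  have h0 := le_max_left 0 (N / ‖ξ‖ - 1)
  set t₀ := max 0 (N / ‖ξ‖ - 1)
  have hb : ∀ z, ‖z - complexify n ξ‖ < ε * ‖ξ‖ →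
      ‖fundSol a j t₀ z‖ ≤ 2 * ((M * ‖ξ‖)⁻¹) ^ (j : ℕ) * Real.exp (M * N) ∧
      ‖fundVel a j t₀ z‖ ≤ 4 * (M * ‖ξ‖) * ((M * ‖ξ‖)⁻¹) ^ (j : ℕ) * Real.exp (M * N) := by
    intro z hz
    obtain ⟨-, h2, -⟩ := norm_bounds_of_mem_ball h.ε_le hz
    have hQμ : 2 * (C * (2 * ‖ξ‖) ^ 2) ≤ (M * ‖ξ‖) ^ 2 := by
      have : 8 * C ≤ M ^ 2 := by nlinarith
      nlinarith [sq_nonneg ‖ξ‖]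
    have hx : Real.exp (M * ‖ξ‖ * |t₀|) ≤ Real.exp (M * N) := by
      rw [abs_of_nonneg h0, mul_assoc, mul_comm ‖ξ‖]
      gcongr
    obtain ⟨b1, b2⟩ := norm_fund_le (a := a) (fun t => (h.form_le t z).trans (by gcongr))
      (by positivity) hQμ j t₀
    exact ⟨b1.trans (by gcongr), b2.trans (by gcongr)⟩
  have hMj : ((M * ‖ξ‖)⁻¹) ^ (j : ℕ) ≤ (‖ξ‖⁻¹) ^ (j : ℕ) := by
    gcongr
    exact le_mul_of_one_le_left hξ'.le hM1
  refine ⟨h0, hle, hmul, by positivity, fun z hz => (hb z hz).1.trans ?_,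
    fun z hz => (hb z hz).2.trans ?_⟩
  · calc 2 * ((M * ‖ξ‖)⁻¹) ^ (j : ℕ) * Real.exp (M * N)
        ≤ 4 * M * (‖ξ‖⁻¹) ^ (j : ℕ) * Real.exp (M * N) := by gcongr; linarith
      _ = _ := by field_simp
  · calc _ ≤ 4 * (M * ‖ξ‖) * (‖ξ‖⁻¹) ^ (j : ℕ) * Real.exp (M * N) := by gcongr
      _ = _ := by ring

theorem entrance_le (h : WKBBounds a K ε c C N) {ξ : EuclideanSpace ℝ (Fin n)} {t : ℝ} (ht : 0 ≤ t)
    (hN : N ≤ (1 + t) * ‖ξ‖) : max 0 (N / ‖ξ‖ - 1) ≤ t := by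
  have := (div_le_iff₀ (h.norm_pos ht hN)).2 hN
  exact max_le ht (by linarith)

/-- The solutions on complex balls of radius `1 / (1 + t)`. -/
theorem exists_norm_fundSol_le (h : WKBBounds a K ε c C N) :
    ∃ D : ℝ, 0 < D ∧ ∀ (j : Fin 2) (ξ : EuclideanSpace ℝ (Fin n)) (t : ℝ), 0 ≤ t → ∀ z,
      ‖z - complexify n ξ‖ < 1 / (1 + t) → ‖fundSol a j t z‖ ≤ D * (1 + t) ^ (j : ℕ) := by
  obtain ⟨D₁, hD₁, h₁⟩ := h.exists_norm_picardSol_le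
  obtain ⟨D₂, hD₂, h₂⟩ := h.exists_entranceBound
  have hC := h.C_pos
  have hN1 := h.one_le_N
  -- For `(1 + t)|ξ| ≤ N` the ball lies in `|z| ≤ (N + 1)/(1 + t)`. With `μ = M/(1 + t)` the
  -- smallness condition is `2 C (N + 1)² ≤ M²`, and the exponential at time `t` stays below `exp
  -- M`.
  set M : ℝ := 1 + 2 * C * (N + 1) ^ 2 with hM
  have hM0 : 0 ≤ 2 * C * (N + 1) ^ 2 := by positivity
  have hM1 : 1 ≤ M := by linarith
  refine ⟨D₁ * D₂ + 2 * Real.exp M, by positivity, fun j ξ t ht z hz => ?_⟩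
  have ht' : 0 < 1 + t := by linarith
  rcases le_total N ((1 + t) * ‖ξ‖) with hN | hN
  · have hξ := h.norm_pos ht hN
    have := h₁ _ _ ξ _ _ (h₂ j ξ (norm_pos_iff.1 hξ)) t (h.entrance_le ht hN) z hz
    have h3 : ‖ξ‖⁻¹ ≤ 1 + t := by
      rw [inv_le_iff_one_le_mul₀ hξ]
      exact hN1.trans hN
    calc ‖fundSol a j t z‖ ≤ D₁ * (D₂ * (‖ξ‖ * (‖ξ‖⁻¹) ^ (j : ℕ)) / ‖ξ‖) := this
      _ = D₁ * D₂ * (‖ξ‖⁻¹) ^ (j : ℕ) := by field_simp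
      _ ≤ D₁ * D₂ * (1 + t) ^ (j : ℕ) := by gcongr
      _ ≤ _ := by
        gcongr
        linarith [Real.exp_pos M]
  · have hz' : ‖z‖ ≤ (N + 1) / (1 + t) := by
      have e1 : ‖z‖ ≤ ‖z - complexify n ξ‖ + ‖ξ‖ := by
        have := norm_add_le (z - complexify n ξ) (complexify n ξ)
        rwa [sub_add_cancel, norm_complexify] at this
      have e2 : ‖ξ‖ ≤ N / (1 + t) := by rw [le_div_iff₀ ht']; linarith
      rw [add_div]
      linarith
    have hQμ : 2 * (C * ((N + 1) / (1 + t)) ^ 2) ≤ (M / (1 + t)) ^ 2 := by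
      rw [div_pow, div_pow, ← mul_div_assoc, ← mul_div_assoc]
      gcongr
      nlinarith
    obtain ⟨b1, -⟩ := norm_fund_le (a := a) (fun t => (h.form_le t z).trans (by gcongr))
      (by positivity) hQμ j t
    have hx : Real.exp (M / (1 + t) * |t|) ≤ Real.exp M := by
      rw [abs_of_nonneg ht, div_mul_eq_mul_div]
      gcongr
      rw [div_le_iff₀ ht']
      nlinarith
    calc ‖fundSol a j t z‖ ≤ 2 * ((M / (1 + t))⁻¹) ^ (j : ℕ) * Real.exp (M / (1 + t) * |t|) := b1
      _ ≤ 2 * (1 + t) ^ (j : ℕ) * Real.exp M := by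
        gcongr
        rw [inv_div]
        exact div_le_self ht'.le hM1
      _ = 2 * Real.exp M * (1 + t) ^ (j : ℕ) := by ring
      _ ≤ _ := by
        gcongr
        have : 0 < D₁ * D₂ := by positivity
        linarith

theorem slitRoot_complexify (h : WKBBounds a K ε c C N) {ξ : EuclideanSpace ℝ (Fin n)} (hξ : ξ ≠ 0)
    {t : ℝ} (ht : 0 ≤ t) : slitRoot (complexForm a) t (complexify n ξ) = (symbolRoot a t ξ : ℂ) := by
  have hpos : 0 < symbolForm a t ξ := by
    have hξ' := norm_pos_iff.2 hξ
    have hmem : complexify n ξ ∈ realCone n ε := ⟨ξ, by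
      have := h.ε_pos
      simp only [sub_self, norm_zero]; positivity⟩
    have := h.re_ge t ht _ hmem
    rw [complexForm_complexify ht, Complex.ofReal_re, norm_complexify] at this
    exact (mul_pos h.c_pos (pow_pos hξ' 2)).trans_le this
  rw [slitRoot, complexForm_complexify ht, ← Complex.ofReal_log hpos.le, symbolRoot]
  have e : Real.sqrt (symbolForm a t ξ) = Real.exp (Real.log (symbolForm a t ξ) / 2) := by
    rw [Real.sqrt_eq_iff_mul_self_eq_of_pos (Real.exp_pos _), ← Real.exp_add, add_halves, Real.exp_log hpos]
  rw [e]
  push_cast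
  rfl

theorem phaseInt_complexify (h : WKBBounds a K ε c C N) {ξ : EuclideanSpace ℝ (Fin n)} (hξ : ξ ≠ 0)
    {t : ℝ} (ht : 0 ≤ t) : phaseInt a t (complexify n ξ) = (t : ℂ) * (phase a t ξ : ℂ) := by
  have e : phaseInt a t (complexify n ξ) = ((∫ τ in (0 : ℝ)..t, symbolRoot a τ ξ : ℝ) : ℂ) := by
    rw [phaseInt, ← intervalIntegral.integral_ofReal]
    refine intervalIntegral.integral_congr fun τ hτ => ?_
    rw [uIcc_of_le ht] at hτ
    exact h.slitRoot_complexify hξ hτ.1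
  rw [e, phase]
  -- At `t = 0` both sides vanish, whatever value the phase is given there.
  rcases ht.eq_or_lt with rfl | ht
  · simp
  · rw [← Complex.ofReal_mul, ← mul_assoc, mul_one_div_cancel ht.ne', one_mul]

end WKBBounds

/-- The cutoff function at `|x| = c` and `|x| = 2c`. -/
noncomputable def zoneBump (n : ℕ) {c : ℝ} (hc : 0 < c) :
    ContDiffBump (0 : EuclideanSpace ℝ (Fin n)) := ⟨c, 2 * c, hc, by linarith⟩

/-- The cutoff to the pseudo-differential zone. -/
noncomputable def pdCut (n : ℕ) {c : ℝ} (hc : 0 < c) (t : ℝ) (ξ : EuclideanSpace ℝ (Fin n)) : ℂ :=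
  ((zoneBump n hc ((1 + t) • ξ) : ℝ) : ℂ)

/-- The amplitudes in the hyperbolic zone. -/
noncomputable def hypSymbol (a : Fin n → Fin n → ℝ → ℝ) (K : ℕ) {c : ℝ} (hc : 0 < c) (j : Fin 2)
    (s : ℤˣ) (t : ℝ) (ξ : EuclideanSpace ℝ (Fin n)) : ℂ :=
  (1 - pdCut n hc t ξ) * hypAmp a K (![1, 0] j) (![0, 1] j) s t (complexify n ξ)

/-- The amplitudes in the pseudo-differential zone. -/
noncomputable def pdSymbol (a : Fin n → Fin n → ℝ → ℝ) {c : ℝ} (hc : 0 < c) (j : Fin 2) (t : ℝ)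
    (ξ : EuclideanSpace ℝ (Fin n)) : ℂ :=
  pdCut n hc t ξ * fundSol a j t (complexify n ξ)

/-! ### Splitting the fundamental solutions between the zones. -/

section Cutoff

variable {c₀ : ℝ} (hc₀ : 0 < c₀)

theorem contDiff_pdCut (t : ℝ) : ContDiff ℝ ∞ (pdCut n hc₀ t) :=
  Complex.ofRealCLM.contDiff.comp ((zoneBump n hc₀).contDiff.comp (contDiff_const_smul _))

theorem pdCut_eq_one {t : ℝ} (ht : 0 ≤ t) {ξ : EuclideanSpace ℝ (Fin n)}
    (h : (1 + t) * ‖ξ‖ ≤ c₀) : pdCut n hc₀ t ξ = 1 := by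
  rw [pdCut, (zoneBump n hc₀).one_of_mem_closedBall, Complex.ofReal_one]
  rw [mem_closedBall_zero_iff, norm_smul, Real.norm_of_nonneg (by linarith)]
  exact h

theorem pdCut_eq_zero {t : ℝ} (ht : 0 ≤ t) {ξ : EuclideanSpace ℝ (Fin n)}
    (h : 2 * c₀ ≤ (1 + t) * ‖ξ‖) : pdCut n hc₀ t ξ = 0 := by
  rw [pdCut, (zoneBump n hc₀).zero_of_le_dist, Complex.ofReal_zero]
  rw [dist_zero_right, norm_smul, Real.norm_of_nonneg (by linarith)]
  exact h

theorem norm_pdCut_le (t : ℝ) (ξ : EuclideanSpace ℝ (Fin n)) : ‖pdCut n hc₀ t ξ‖ ≤ 1 := by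
  rw [pdCut, Complex.norm_real, Real.norm_of_nonneg (zoneBump n hc₀).nonneg]
  exact (zoneBump n hc₀).le_one

/-- The cutoff is a fixed function `χ` of `(1 + t) ξ`. Compact support bounds `|x|^i |D^i χ(x)|`,
and this quantity is invariant under dilation, which gives constants independent of `t`. -/
theorem exists_norm_iteratedFDeriv_pdCut_le (m : ℕ) :
    ∃ A : ℝ, 0 < A ∧ ∀ i ≤ m, ∀ t, 0 ≤ t → ∀ ξ : EuclideanSpace ℝ (Fin n), ξ ≠ 0 →
      ‖iteratedFDeriv ℝ i (pdCut n hc₀ t) ξ‖ ≤ A * (‖ξ‖⁻¹) ^ i := by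
  set χ : EuclideanSpace ℝ (Fin n) → ℂ := fun x => ((zoneBump n hc₀ x : ℝ) : ℂ) with hχ
  have hχc : ContDiff ℝ ∞ χ := Complex.ofRealCLM.contDiff.comp (zoneBump n hc₀).contDiff
  have hχs : HasCompactSupport χ := (zoneBump n hc₀).hasCompactSupport.comp_left Complex.ofReal_zero
  have key : ∀ i : ℕ, ∃ A : ℝ, ∀ x, ‖x‖ ^ i * ‖iteratedFDeriv ℝ i χ x‖ ≤ A := fun i => by
    obtain ⟨A, hA⟩ := (((continuous_norm.pow i).mul
      (hχc.continuous_iteratedFDeriv (m := i) (by exact_mod_cast le_top)).norm).bounded_above_of_compact_support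
        ((hχs.iteratedFDeriv i).norm.mul_left))
    exact ⟨A, fun x => (Real.le_norm_self _).trans (hA x)⟩
  choose A hA using key
  refine ⟨1 + ∑ i ∈ Finset.range (m + 1), |A i|, by positivity, fun i hi t ht ξ hξ => ?_⟩
  have hξ' := norm_pos_iff.2 hξ
  have ht' : 0 < 1 + t := by linarith
  have e := congrFun (iteratedFDeriv_comp_const_smul (𝕜 := ℝ) (i := i) (1 + t)
    (hχc.of_le (by exact_mod_cast le_top))) ξ
  have e' : iteratedFDeriv ℝ i (pdCut n hc₀ t) ξ =
      (1 + t) ^ i • iteratedFDeriv ℝ i χ ((1 + t) • ξ) := e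
  rw [e', norm_smul, norm_pow, Real.norm_of_nonneg ht'.le, inv_pow, ← div_eq_mul_inv,
    le_div_iff₀ (by positivity)]
  have := hA i ((1 + t) • ξ)
  rw [norm_smul, Real.norm_of_nonneg ht'.le, mul_pow] at this
  calc _ = (1 + t) ^ i * ‖ξ‖ ^ i * ‖iteratedFDeriv ℝ i χ ((1 + t) • ξ)‖ := by ring
    _ ≤ |A i| := this.trans (le_abs_self _)
    _ ≤ ∑ i ∈ Finset.range (m + 1), |A i| :=
      Finset.single_le_sum (f := fun i => |A i|) (fun i _ => abs_nonneg _) (by simp; omega)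
    _ ≤ _ := by linarith

theorem hypSymbol_eq_zero (K : ℕ) (j : Fin 2) (s : ℤˣ) {t : ℝ} (ht : 0 ≤ t)
    {ξ : EuclideanSpace ℝ (Fin n)} (h : (1 + t) * ‖ξ‖ ≤ c₀) : hypSymbol a K hc₀ j s t ξ = 0 := by
  rw [hypSymbol, pdCut_eq_one hc₀ ht h, sub_self, zero_mul]

theorem pdSymbol_eq_zero (j : Fin 2) {t : ℝ} (ht : 0 ≤ t)
    {ξ : EuclideanSpace ℝ (Fin n)} (h : 2 * c₀ ≤ (1 + t) * ‖ξ‖) : pdSymbol a hc₀ j t ξ = 0 := by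
  rw [pdSymbol, pdCut_eq_zero hc₀ ht h, zero_mul]

theorem hypSymbol_eventuallyEq_zero (K : ℕ) (j : Fin 2) (s : ℤˣ) {t : ℝ} (ht : 0 ≤ t)
    {ξ : EuclideanSpace ℝ (Fin n)} (h : (1 + t) * ‖ξ‖ < c₀) :
    hypSymbol a K hc₀ j s t =ᶠ[𝓝 ξ] fun _ => 0 := by
  have : ∀ᶠ v in 𝓝 ξ, (1 + t) * ‖v‖ < c₀ :=
    (Continuous.tendsto (by fun_prop) ξ).eventually_lt_const h
  filter_upwards [this] with v hv using hypSymbol_eq_zero hc₀ K j s ht hv.le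

namespace WKBBounds

variable {hc₀}

theorem contDiffAt_hypAmp (h : WKBBounds a K ε c C N) (α β : ℂ) (s : ℤˣ) {t : ℝ} (ht : 0 ≤ t)
    {ξ : EuclideanSpace ℝ (Fin n)} (hN : N ≤ (1 + t) * ‖ξ‖) :
    ContDiffAt ℝ ∞ (fun v => hypAmp a K α β s t (complexify n v)) ξ := by
  have hmem : ball (complexify n ξ) (ε * ‖ξ‖) ∈ 𝓝 (complexify n ξ) :=
    ball_mem_nhds _ (mul_pos h.ε_pos (h.norm_pos ht hN))
  exact ContDiffAt.comp ξ ((((h.differentiableOn_hypAmp α β s ht hN).contDiffOn_complex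
    isOpen_ball).contDiffAt hmem).restrict_scalars ℝ) (complexify n).contDiff.contDiffAt

/-- The amplitude is controlled only where `(1 + t)|ξ| ≥ N`. The factor `1 - pdCut` vanishes below
the larger threshold `c₀`, so the product extends smoothly by zero, also across `ξ = 0`. -/
theorem contDiff_hypSymbol (h : WKBBounds a K ε c C N) (hN : N < c₀) (j : Fin 2) (s : ℤˣ) {t : ℝ}
    (ht : 0 ≤ t) : ContDiff ℝ ∞ (hypSymbol a K hc₀ j s t) := by
  refine contDiff_iff_contDiffAt.2 fun ξ => ?_
  rcases lt_or_ge ((1 + t) * ‖ξ‖) c₀ with hξ | hξ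
  · exact contDiffAt_const.congr_of_eventuallyEq (hypSymbol_eventuallyEq_zero hc₀ K j s ht hξ)
  · exact (contDiffAt_const.sub (contDiff_pdCut hc₀ t).contDiffAt).mul
      (h.contDiffAt_hypAmp _ _ s ht (hN.le.trans hξ))

theorem contDiff_fundSol (h : WKBBounds a K ε c C N) (j : Fin 2) (t : ℝ) :
    ContDiff ℝ ∞ fun v => fundSol a j t (complexify n v) := by
  have hd : Differentiable ℂ (fundSol a j t) := (h.differentiable_picard _ _ t).1
  exact ((contDiffOn_univ.1 (hd.differentiableOn.contDiffOn_complex isOpen_univ)).restrict_scalars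
    ℝ).comp (complexify n).contDiff

theorem contDiff_pdSymbol (h : WKBBounds a K ε c C N) (j : Fin 2) (t : ℝ) :
    ContDiff ℝ ∞ (pdSymbol a hc₀ j t) :=
  (contDiff_pdCut hc₀ t).mul (h.contDiff_fundSol j t)

theorem exists_norm_pdSymbol_le (h : WKBBounds a K ε c C N) (j : Fin 2) :
    ∃ D : ℝ, ∀ t ξ, 0 ≤ t → ‖pdSymbol a hc₀ j t ξ‖ ≤ D * (1 + t) ^ (j : ℕ) := by
  obtain ⟨D, hD, hb⟩ := h.exists_norm_fundSol_le
  refine ⟨D, fun t ξ ht => ?_⟩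
  have := hb j ξ t ht (complexify n ξ) (by rw [sub_self, norm_zero]; positivity)
  rw [pdSymbol, norm_mul]
  exact (mul_le_of_le_one_left (norm_nonneg _) (norm_pdCut_le hc₀ t ξ)).trans this

theorem exists_norm_iteratedFDeriv_hypSymbol_le (h : WKBBounds a K ε c C N) (hN : N < c₀)
    (j : Fin 2) (s : ℤˣ) {m : ℕ} (hm : m ≤ K) :
    ∃ D : ℝ, ∀ t ξ, 0 ≤ t → ξ ≠ 0 → ‖iteratedFDeriv ℝ m (hypSymbol a K hc₀ j s t) ξ‖ ≤
      D * ‖ξ‖ ^ (-(m : ℤ) - ((j : ℕ) : ℤ)) := by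
  obtain ⟨A, hA, hcut⟩ := exists_norm_iteratedFDeriv_pdCut_le (n := n) hc₀ m
  obtain ⟨D₁, hD₁, h₁⟩ := h.exists_norm_iteratedFDeriv_hypAmp_le
  obtain ⟨D₂, hD₂, h₂⟩ := h.exists_entranceBound
  refine ⟨D₁ * D₂ + 2 ^ m * (A * (D₁ * D₂)), fun t ξ ht hξ => ?_⟩
  have hξ' := norm_pos_iff.2 hξ
  rcases lt_or_ge ((1 + t) * ‖ξ‖) c₀ with hlt | hge
  · have e := (hypSymbol_eventuallyEq_zero (a := a) hc₀ K j s ht hlt).iteratedFDeriv ℝ m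
    rw [e.eq_of_nhds]
    have : iteratedFDeriv ℝ m (fun _ : EuclideanSpace ℝ (Fin n) => (0 : ℂ)) ξ = 0 := by
      simp
    rw [this, norm_zero]
    positivity
  · set G : EuclideanSpace ℝ (Fin n) → ℂ :=
      fun v => hypAmp a K (![1, 0] j) (![0, 1] j) s t (complexify n v) with hG
    set U : Set (EuclideanSpace ℝ (Fin n)) := {v | N < (1 + t) * ‖v‖} with hU
    have hUo : IsOpen U := isOpen_lt continuous_const (by fun_prop)
    have hξU : ξ ∈ U := hN.trans_le hge
    have hGU : ContDiffOn ℝ ∞ G U := fun v hv =>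
      (h.contDiffAt_hypAmp _ _ s ht (le_of_lt hv)).contDiffWithinAt
    have hGb : ∀ i ≤ m, ‖iteratedFDeriv ℝ i G ξ‖ ≤
        D₁ * D₂ * (‖ξ‖⁻¹) ^ (j : ℕ) * (‖ξ‖⁻¹) ^ i := fun i hi => by
      refine (h₁ _ _ ξ _ _ (h₂ j ξ hξ) t (h.entrance_le ht (hN.le.trans hge)) s i
        (hi.trans hm)).trans (le_of_eq ?_)
      field_simp
    have hprod := norm_iteratedFDeriv_mul_le_of_isOpen hUo hξU (m := m)
      (contDiff_pdCut hc₀ t).contDiffOn hGU (by positivity) (fun i hi => hcut i hi t ht ξ hξ) hGb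
    have e : hypSymbol a K hc₀ j s t = G - fun v => pdCut n hc₀ t v * G v := by
      ext v
      simp only [hypSymbol, hG, Pi.sub_apply]
      ring
    have hmt : ((m : ℕ∞) : WithTop ℕ∞) ≤ ∞ := by exact_mod_cast le_top
    have cG : ContDiffAt ℝ m G ξ := (hGU.contDiffAt (hUo.mem_nhds hξU)).of_le hmt
    have cP : ContDiffAt ℝ m (fun v => pdCut n hc₀ t v * G v) ξ :=
      ((contDiff_pdCut hc₀ t).contDiffAt.of_le hmt).mul cG
    rw [e, iteratedFDeriv_sub_apply cG cP]
    refine (norm_sub_le _ _).trans ((add_le_add (hGb m le_rfl) hprod).trans (le_of_eq ?_))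
    rw [sub_eq_add_neg, zpow_add₀ hξ'.ne', zpow_neg, zpow_neg, zpow_natCast, zpow_natCast, inv_pow,
      inv_pow]
    ring

/-- The multiplier built from the amplitudes is the fundamental solution. -/
theorem reprMultiplier_eq (h : WKBBounds a K ε c C N) (hN : N < c₀) (j : Fin 2) {t : ℝ}
    (ht : 0 ≤ t) : reprMultiplier a (hypSymbol a K hc₀ j) (pdSymbol a hc₀ j) t =
      fun ξ => fundSol a j t (complexify n ξ) := by
  ext ξ
  rw [reprMultiplier]
  rcases le_or_gt ((1 + t) * ‖ξ‖) c₀ with hle | hgt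
  · simp [hypSymbol_eq_zero hc₀ K j _ ht hle, pdSymbol, pdCut_eq_one hc₀ ht hle]
  · have hNt := hN.le.trans hgt.le
    have hξ := h.norm_pos ht hNt
    have hz : ‖complexify n ξ - complexify n ξ‖ < ε * ‖ξ‖ := by
      rw [sub_self, norm_zero]
      exact mul_pos h.ε_pos hξ
    have e := h.picardSol_eq_add_hypAmp (α := ![1, 0] j) (β := ![0, 1] j) ht hNt hz
    have e1 : ∀ s : ℤˣ, Complex.exp (((s : ℤ) : ℂ) * Complex.I * (t : ℂ) * (phase a t ξ : ℂ)) *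
        hypSymbol a K hc₀ j s t ξ = (1 - pdCut n hc₀ t ξ) *
        (Complex.exp (signI s * phaseInt a t (complexify n ξ)) *
          hypAmp a K (![1, 0] j) (![0, 1] j) s t (complexify n ξ)) := fun s => by
      rw [h.phaseInt_complexify (norm_pos_iff.1 hξ) ht, signI, hypSymbol, mul_assoc (_ * Complex.I)]
      ring
    simp only [e1]
    rw [← Finset.mul_sum, ← e, pdSymbol, fundSol]
    ring

/-- For fixed `t` the solution is bounded on complex balls of the same radius `1/(1 + t)` around all
real points, so every derivative is even bounded. -/
theorem hasTemperateGrowth_fundSol (h : WKBBounds a K ε c C N) (j : Fin 2) {t : ℝ} (ht : 0 ≤ t) :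
    Function.HasTemperateGrowth fun ξ => fundSol a j t (complexify n ξ) := by
  obtain ⟨D, hD, hb⟩ := h.exists_norm_fundSol_le
  have hd : Differentiable ℂ (fundSol a j t) := (h.differentiable_picard _ _ t).1
  refine ⟨h.contDiff_fundSol j t, fun m => ?_⟩
  obtain ⟨A, hA, hcau⟩ := norm_iteratedFDeriv_comp_le_of_forall_mem_ball (complexify n)
    (fun y => (norm_complexify y).le) m
  refine ⟨0, A * (D * (1 + t) ^ (j : ℕ)) / (1 / (1 + t)) ^ m, fun ξ => ?_⟩
  rw [pow_zero, mul_one]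
  exact hcau _ ξ _ _ (by positivity) hd.differentiableOn fun z hz =>
    hb j ξ t ht z (mem_ball_iff_norm.1 hz)

end WKBBounds

end Cutoff

end FundamentalSolutions

/-! ### Completeness of the Schwartz space and uniform boundedness. -/

section SchwartzComplete

open Filter Topology Uniformity

variable {E F : Type*} [NormedAddCommGroup E] [NormedSpace ℝ E] [NormedAddCommGroup F]
  [NormedSpace ℝ F]

namespace SchwartzMap

/-- Summability of all seminorms allows termwise differentiation. The bound on the sum, applied to
tails, yields convergence in the Schwartz topology. -/
theorem exists_tsum_of_summable_seminorm [CompleteSpace F] (f : ℕ → 𝓢(E, F))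
    (hf : ∀ k i, Summable fun n => SchwartzMap.seminorm ℝ k i (f n)) :
    ∃ g : 𝓢(E, F), (∀ x, HasSum (fun n => f n x) (g x)) ∧
      ∀ k i, SchwartzMap.seminorm ℝ k i g ≤ ∑' n, SchwartzMap.seminorm ℝ k i (f n) := by
  have hb : ∀ (i n : ℕ) (x : E), ((i : ℕ∞) : WithTop ℕ∞) ≤ ∞ →
      ‖iteratedFDeriv ℝ i (f n) x‖ ≤ SchwartzMap.seminorm ℝ 0 i (f n) := fun i n x _ =>
    norm_iteratedFDeriv_le_seminorm ℝ (f n) i x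
  have hcd : ∀ n, ContDiff ℝ ((⊤ : ℕ∞) : WithTop ℕ∞) fun x => f n x := fun n => (f n).smooth'
  have hd : ∀ k i x, ‖x‖ ^ k * ‖iteratedFDeriv ℝ i (fun y => ∑' n, f n y) x‖ ≤
      ∑' n, SchwartzMap.seminorm ℝ k i (f n) := fun k i x => by
    rw [iteratedFDeriv_tsum_apply (N := ⊤) hcd (fun i _ => hf 0 i)
      (fun i n x _ => hb i n x (by exact_mod_cast le_top)) le_top]
    have hs : Summable fun n => ‖iteratedFDeriv ℝ i (f n) x‖ :=
      (hf 0 i).of_nonneg_of_le (fun _ => norm_nonneg _) fun n => hb i n x (by exact_mod_cast le_top)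
    calc _ ≤ ‖x‖ ^ k * ∑' n, ‖iteratedFDeriv ℝ i (f n) x‖ := by
          gcongr
          exact norm_tsum_le_tsum_norm hs
      _ = ∑' n, ‖x‖ ^ k * ‖iteratedFDeriv ℝ i (f n) x‖ := (tsum_mul_left).symm
      _ ≤ _ := (hs.mul_left _).tsum_le_tsum (fun n => le_seminorm ℝ k i (f n) x) (hf k i)
  refine ⟨⟨fun y => ∑' n, f n y, contDiff_tsum (N := ⊤) hcd
    (fun i _ => hf 0 i) fun i n x _ => hb i n x (by exact_mod_cast le_top),
    fun k i => ⟨_, hd k i⟩⟩, fun x => ?_, fun k i => ?_⟩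
  · refine Summable.hasSum (Summable.of_norm_bounded (hf 0 0) fun n => ?_)
    exact norm_le_seminorm ℝ (f n) x
  · exact seminorm_le_bound ℝ k i _ (tsum_nonneg fun n => apply_nonneg _ _) (hd k i)

/-- The uniformity is countably generated, so sequences with prescribed speed of convergence
suffice, and such a sequence is a telescoping series. -/
instance instCompleteSpace [CompleteSpace F] : CompleteSpace 𝓢(E, F) := by
  have hsub : ∀ k i, Tendsto (fun p : 𝓢(E, F) × 𝓢(E, F) => SchwartzMap.seminorm ℝ k i (p.1 - p.2))
      (𝓤 _) (𝓝 0) := fun k i => by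
    have h1 : Continuous (SchwartzMap.seminorm ℝ k i : 𝓢(E, F) → ℝ) :=
      (schwartz_withSeminorms ℝ E F).continuous_seminorm (k, i)
    have h2 : Tendsto (fun p : 𝓢(E, F) × 𝓢(E, F) => p.2 - p.1) (𝓤 _) (𝓝 0) := by
      rw [uniformity_eq_comap_nhds_zero]
      exact tendsto_comap
    have h3 := (h1.tendsto 0).comp h2
    rw [map_zero] at h3
    exact h3.congr fun p => map_sub_rev _ _ _
  have hcg : (𝓤 𝓢(E, F)).IsCountablyGenerated := IsUniformAddGroup.uniformity_countably_generated
  -- The `N`-th entourage controls the seminorms with both indices at most `N` by `2^(-N)`. For each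
  -- fixed pair of indices the increments are then eventually dominated by a geometric series.
  refine UniformSpace.complete_of_convergent_controlled_sequences
    (fun N => {p | ∀ k ∈ Finset.range (N + 1), ∀ i ∈ Finset.range (N + 1),
      SchwartzMap.seminorm ℝ k i (p.1 - p.2) < (1 / 2) ^ N}) (fun N => ?_) fun u hu => ?_
  · refine (Filter.eventually_all_finset _).2 fun k _ => (Filter.eventually_all_finset _).2
      fun i _ => (hsub k i).eventually_lt_const (by positivity)
  · have hsum : ∀ k i, Summable fun n => SchwartzMap.seminorm ℝ k i (u (n + 1) - u n) := by
      intro k i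
      refine Summable.of_norm_bounded_eventually_nat (g := fun n => (1 / 2 : ℝ) ^ n)
        summable_geometric_two ?_
      filter_upwards [eventually_ge_atTop (max k i)] with n hn
      rw [Real.norm_of_nonneg (apply_nonneg _ _)]
      exact (hu n (n + 1) n (Nat.le_succ n) le_rfl k
        (Finset.mem_range.2 (by omega)) i (Finset.mem_range.2 (by omega))).le
    obtain ⟨g, hg, -⟩ := exists_tsum_of_summable_seminorm _ hsum
    refine ⟨u 0 + g, ((schwartz_withSeminorms ℝ E F).tendsto_nhds u _).2 fun ki ε hε => ?_⟩
    obtain ⟨k, i⟩ := ki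
    have hlim := tendsto_sum_nat_add fun n => SchwartzMap.seminorm ℝ k i (u (n + 1) - u n)
    filter_upwards [hlim.eventually_lt_const hε] with N hN
    obtain ⟨gN, hgN, hgN'⟩ := exists_tsum_of_summable_seminorm
      (fun n => u (n + N + 1) - u (n + N)) fun k i => (summable_nat_add_iff N).2 (hsum k i)
    have e : u 0 + g - u N = gN := by
      ext x
      refine HasSum.unique ?_ (hgN x)
      have h1 := (hasSum_nat_add_iff' N).2 (hg x)
      have h2 : ∑ n ∈ Finset.range N, (u (n + 1) - u n) x = u N x - u 0 x := by
        simpa using Finset.sum_range_sub (fun n => u n x) N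
      rw [h2] at h1
      convert! h1 using 1
      simp
      abel
    change SchwartzMap.seminorm ℝ k i (u N - (u 0 + g)) < ε
    rw [map_sub_rev, e]
    exact (hgN' k i).trans_lt hN

instance instBaireSpace [CompleteSpace F] : BaireSpace 𝓢(E, F) := by
  have hcg : (𝓤 𝓢(E, F)).IsCountablyGenerated := IsUniformAddGroup.uniformity_countably_generated
  let := UniformSpace.pseudoMetricSpace 𝓢(E, F)
  infer_instance

/-- The uniform boundedness principle for continuous functionals on the Schwartz space. -/
theorem exists_seminorm_bound_of_pointwise {ι : Type*} (B : ι → 𝓢(E, ℂ) →L[ℂ] ℂ)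
    (hB : ∀ φ, ∃ M : ℝ, ∀ i, ‖B i φ‖ ≤ M) :
    ∃ (s : Finset (ℕ × ℕ)) (C : ℝ), 0 ≤ C ∧
      ∀ i φ, ‖B i φ‖ ≤ C * s.sup (schwartzSeminormFamily ℂ E ℂ) φ := by
  set p : ι → Seminorm ℂ 𝓢(E, ℂ) := fun i => (normSeminorm ℂ ℂ).comp (B i).toLinearMap with hp
  have hbdd : BddAbove (Set.range p) := by
    rw [Seminorm.bddAbove_range_iff]
    intro φ
    obtain ⟨M, hM⟩ := hB φ
    exact ⟨M, Set.forall_mem_range.2 hM⟩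
  have hcont := Seminorm.continuous_iSup p (fun i => (B i).continuous.norm) hbdd
  have hcont' : Continuous (⨆ i, p i : Seminorm ℂ 𝓢(E, ℂ)) := by
    rw [Seminorm.coe_iSup_eq hbdd]
    exact hcont
  obtain ⟨s, C, -, hC⟩ := Seminorm.bound_of_continuous (schwartz_withSeminorms ℂ E ℂ) _ hcont'
  refine ⟨s, C, C.2, fun i φ => ?_⟩
  obtain ⟨M, hM⟩ := hB φ
  have h1 : p i φ ≤ (⨆ i, p i : Seminorm ℂ 𝓢(E, ℂ)) φ := by
    rw [Seminorm.iSup_apply hbdd]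
    exact le_ciSup (f := fun i => p i φ) ⟨M, Set.forall_mem_range.2 hM⟩ i
  exact h1.trans (hC φ)

end SchwartzMap

end SchwartzComplete

/-! ### Differentiation of pairings and a Taylor estimate. -/

section Pairing

open Filter Topology Asymptotics

/-- The derivative of `s ↦ ⟨B s, ψ s⟩` for an equicontinuous family `B` of functionals. -/
theorem hasDerivWithinAt_pairing {X : Type*} [AddCommGroup X] [Module ℂ X] {p : Seminorm ℂ X}
    {B : ℝ → X →ₗ[ℂ] ℂ} {ψ : ℝ → X} {ψ' : X} {b' : ℂ} {S : Set ℝ} {t C : ℝ}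
    (hB : ∀ s ∈ S, ∀ x, ‖B s x‖ ≤ C * p x)
    (hb : HasDerivWithinAt (fun s => B s (ψ t)) b' S t)
    (hc : ContinuousWithinAt (fun s => B s ψ') S t)
    (hψ : (fun s => p (ψ s - ψ t - ((s - t : ℝ) : ℂ) • ψ')) =o[𝓝[S] t] fun s => s - t) :
    HasDerivWithinAt (fun s => B s (ψ s)) (b' + B t ψ') S t := by
  -- The pairing splits as `B s (ψ t) + (s - t) B s ψ' + B s (remainder)`. Pointwise continuity of
  -- `B` suffices for the second summand; the third needs the equicontinuity bound.
  have h1 : HasDerivWithinAt (fun s => ((s - t : ℝ) : ℂ) * B s ψ') (B t ψ') S t := by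
    rw [hasDerivWithinAt_iff_isLittleO]
    have h2 : (fun s => B s ψ' - B t ψ') =o[𝓝[S] t] fun _ => (1 : ℝ) := by
      rw [isLittleO_one_iff]
      have := Filter.Tendsto.sub_const hc (B t ψ')
      simpa using this
    have h3 := (isBigO_refl (fun s : ℝ => s - t) (𝓝[S] t)).smul_isLittleO h2
    refine (h3.congr_left fun s => ?_).trans_isBigO ?_
    · simp
      ring
    · simpa using isBigO_refl (fun s : ℝ => s - t) (𝓝[S] t)
  have h2 : HasDerivWithinAt (fun s => B s (ψ s - ψ t - ((s - t : ℝ) : ℂ) • ψ')) 0 S t := by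
    rw [hasDerivWithinAt_iff_isLittleO]
    refine IsBigO.trans_isLittleO (IsBigO.of_bound C ?_) hψ
    filter_upwards [self_mem_nhdsWithin] with s hs
    simpa [abs_of_nonneg (apply_nonneg p _)] using hB s hs (ψ s - ψ t - ((s - t : ℝ) : ℂ) • ψ')
  refine ((hb.fun_add h1).fun_add h2).congr_deriv (add_zero _) |>.congr_of_eventuallyEq ?_ ?_
  · refine Eventually.of_forall fun s => ?_
    simp only [map_sub, map_smul, smul_eq_mul]
    ring
  · simp

/-- A Taylor estimate for functions with a Lipschitz derivative. -/
theorem norm_taylor_le {f f' : ℝ → ℂ} {S : Set ℝ} (hS : Convex ℝ S) {L : ℝ} (hL : 0 ≤ L)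
    (hf : ∀ s ∈ S, HasDerivWithinAt f (f' s) S s) {t : ℝ} (ht : t ∈ S)
    (hf' : ∀ s ∈ S, ‖f' s - f' t‖ ≤ L * |s - t|) {s : ℝ} (hs : s ∈ S) :
    ‖f s - f t - ((s - t : ℝ) : ℂ) * f' t‖ ≤ L * |s - t| ^ 2 := by
  have hsub : Set.uIcc t s ⊆ S := by
    rw [← segment_eq_uIcc]
    exact hS.segment_subset ht hs
  have hd : ∀ σ ∈ Set.uIcc t s, HasDerivWithinAt (fun σ => f σ - ((σ - t : ℝ) : ℂ) * f' t)
      (f' σ - f' t) (Set.uIcc t s) σ := fun σ hσ => by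
    have h1 : HasDerivWithinAt (fun σ : ℝ => ((σ - t : ℝ) : ℂ)) 1 (Set.uIcc t s) σ := by
      simpa using! (((hasDerivAt_id σ).sub_const t).ofReal_comp).hasDerivWithinAt
    simpa using ((hf σ (hsub hσ)).mono hsub).fun_sub (h1.mul_const (f' t))
  have := (convex_uIcc t s).norm_image_sub_le_of_norm_hasDerivWithin_le (C := L * |s - t|) hd
    (fun σ hσ => (hf' σ (hsub hσ)).trans (by
      gcongr L * ?_
      exact Set.abs_sub_left_of_mem_uIcc hσ)) Set.left_mem_uIcc Set.right_mem_uIcc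
  simp only [sub_self, Complex.ofReal_zero, zero_mul, sub_zero, Real.norm_eq_abs] at this
  rw [sub_right_comm, sq, ← mul_assoc]
  exact this

end Pairing

/-! ### Multipliers that are entire and of polynomial growth in a strip. -/

section StripMultipliers

open Set Metric

variable {n : ℕ}

/-- Entire functions of growth `κ (1 + |ξ|)^N` in the complex strip of width `r`. -/
structure StripBound (n : ℕ) (r κ : ℝ) (N : ℕ) (g : EuclideanSpace ℂ (Fin n) → ℂ) : Prop where
  differentiable : Differentiable ℂ g
  bound : ∀ (ξ : EuclideanSpace ℝ (Fin n)) z, ‖z - complexify n ξ‖ < r →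
    ‖g z‖ ≤ κ * (1 + ‖ξ‖) ^ N

/-- Multiplication of Schwartz functions by an entire function. -/
noncomputable def stripMul (g : EuclideanSpace ℂ (Fin n) → ℂ)
    (φ : 𝓢(EuclideanSpace ℝ (Fin n), ℂ)) : 𝓢(EuclideanSpace ℝ (Fin n), ℂ) :=
  SchwartzMap.smulLeftCLM ℂ (fun ξ => g (complexify n ξ)) φ

namespace StripBound

variable {r κ : ℝ} {N : ℕ} {g : EuclideanSpace ℂ (Fin n) → ℂ}

theorem nonneg (hr : 0 < r) (hg : StripBound n r κ N g) : 0 ≤ κ := by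
  have := (norm_nonneg _).trans (hg.bound 0 (complexify n 0) (by simpa using hr))
  simpa using this

theorem contDiff (hg : StripBound n r κ N g) : ContDiff ℝ ∞ fun ξ => g (complexify n ξ) :=
  ((contDiffOn_univ.1 (hg.differentiable.differentiableOn.contDiffOn_complex
    isOpen_univ)).restrict_scalars ℝ).comp (complexify n).contDiff

theorem exists_norm_iteratedFDeriv_le (hr : 0 < r) (N m : ℕ) :
    ∃ A : ℝ, 0 < A ∧ ∀ i ≤ m, ∀ g κ, StripBound n r κ N g → ∀ ξ,
      ‖iteratedFDeriv ℝ i (fun ξ => g (complexify n ξ)) ξ‖ ≤ A * κ * (1 + ‖ξ‖) ^ N := by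
  obtain ⟨A, hA, hcau⟩ := exists_uniform_cauchy_const (complexify n)
    (fun y => (norm_complexify y).le) m
  refine ⟨A * (1 + r⁻¹) ^ m, by positivity, fun i hi g κ hg ξ => ?_⟩
  have hκ := hg.nonneg hr
  refine (hcau i hi g ξ r _ hr hg.differentiable.differentiableOn fun z hz =>
    hg.bound ξ z (mem_ball_iff_norm.1 hz)).trans ?_
  have hr' : 0 < r⁻¹ := inv_pos.2 hr
  calc A * (κ * (1 + ‖ξ‖) ^ N) * r⁻¹ ^ i ≤ A * (κ * (1 + ‖ξ‖) ^ N) * (1 + r⁻¹) ^ m := by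
        gcongr
        calc r⁻¹ ^ i ≤ (1 + r⁻¹) ^ i := by gcongr; linarith
          _ ≤ _ := pow_le_pow_right₀ (by linarith) hi
    _ = _ := by ring

theorem hasTemperateGrowth (hr : 0 < r) (hg : StripBound n r κ N g) :
    Function.HasTemperateGrowth fun ξ => g (complexify n ξ) := by
  refine ⟨hg.contDiff, fun m => ?_⟩
  obtain ⟨A, -, hA⟩ := exists_norm_iteratedFDeriv_le (n := n) hr N m
  exact ⟨N, A * κ, hA m le_rfl g κ hg⟩

theorem stripMul_apply (hr : 0 < r) (hg : StripBound n r κ N g)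
    (φ : 𝓢(EuclideanSpace ℝ (Fin n), ℂ)) (ξ : EuclideanSpace ℝ (Fin n)) :
    stripMul g φ ξ = g (complexify n ξ) * φ ξ := by
  rw [stripMul, SchwartzMap.smulLeftCLM_apply_apply (hg.hasTemperateGrowth hr), smul_eq_mul]

/-- The constant may depend on `φ` but not on `g`, and the bound is linear in `κ`. A pointwise
Taylor remainder of size `|s - t|²` in the strip therefore becomes a remainder of the same order in
every Schwartz seminorm. -/
theorem exists_seminorm_stripMul_le (hr : 0 < r) (N : ℕ) (φ : 𝓢(EuclideanSpace ℝ (Fin n), ℂ))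
    (k l : ℕ) :
    ∃ A : ℝ, 0 ≤ A ∧ ∀ g κ, StripBound n r κ N g →
      SchwartzMap.seminorm ℂ k l (stripMul g φ) ≤ A * κ := by
  obtain ⟨A, hA, hb⟩ := exists_norm_iteratedFDeriv_le (n := n) hr N l
  set P : ℝ := 2 ^ (N + k) * (Finset.Iic (N + k, l)).sup
    (fun m => SchwartzMap.seminorm ℂ m.1 m.2) φ with hP
  have hP0 : 0 ≤ P := mul_nonneg (by positivity) (apply_nonneg _ _)
  refine ⟨2 ^ l * (A * P), by positivity, fun g κ hg => ?_⟩
  have hκ := hg.nonneg hr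
  refine SchwartzMap.seminorm_le_bound ℂ k l _ (by positivity) fun ξ => ?_
  have e : (stripMul g φ : EuclideanSpace ℝ (Fin n) → ℂ) = fun ξ => g (complexify n ξ) * φ ξ :=
    funext (hg.stripMul_apply hr φ)
  rw [e]
  have h1 := norm_iteratedFDeriv_mul_le hg.contDiff (φ.smooth ⊤) ξ (n := l)
    (by exact_mod_cast le_top)
  have hφ : ∀ i ≤ l, (1 + ‖ξ‖) ^ (N + k) * ‖iteratedFDeriv ℝ i φ ξ‖ ≤ P := fun i hi =>
    SchwartzMap.one_add_le_sup_seminorm_apply (𝕜 := ℂ) (m := (N + k, l)) le_rfl hi φ ξ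
  calc ‖ξ‖ ^ k * ‖iteratedFDeriv ℝ l (fun ξ => g (complexify n ξ) * φ ξ) ξ‖
      ≤ (1 + ‖ξ‖) ^ k * ∑ i ∈ Finset.range (l + 1), (l.choose i : ℝ) *
        ‖iteratedFDeriv ℝ i (fun ξ => g (complexify n ξ)) ξ‖ * ‖iteratedFDeriv ℝ (l - i) φ ξ‖ := by
        gcongr
        linarith
    _ = ∑ i ∈ Finset.range (l + 1), (l.choose i : ℝ) * ((1 + ‖ξ‖) ^ k *
        (‖iteratedFDeriv ℝ i (fun ξ => g (complexify n ξ)) ξ‖ *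
          ‖iteratedFDeriv ℝ (l - i) φ ξ‖)) := by
        rw [Finset.mul_sum]
        exact Finset.sum_congr rfl fun i _ => by ring
    _ ≤ ∑ i ∈ Finset.range (l + 1), (l.choose i : ℝ) * (A * κ * P) := by
        refine Finset.sum_le_sum fun i hi => ?_
        have hi' : i ≤ l := Nat.lt_succ_iff.1 (Finset.mem_range.1 hi)
        refine mul_le_mul_of_nonneg_left ?_ (Nat.cast_nonneg _)
        calc _ ≤ (1 + ‖ξ‖) ^ k * ((A * κ * (1 + ‖ξ‖) ^ N) * ‖iteratedFDeriv ℝ (l - i) φ ξ‖) := by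
              gcongr
              exact hb i hi' g κ hg ξ
          _ = A * κ * ((1 + ‖ξ‖) ^ (N + k) * ‖iteratedFDeriv ℝ (l - i) φ ξ‖) := by
              rw [pow_add]; ring
          _ ≤ _ := by
              gcongr
              exact hφ _ (Nat.sub_le _ _)
    _ = _ := by
        rw [← Finset.sum_mul]
        have : ∑ i ∈ Finset.range (l + 1), (l.choose i : ℝ) = 2 ^ l := by
          exact_mod_cast Nat.sum_range_choose l
        rw [this]; ring

theorem exists_sup_seminorm_stripMul_le (hr : 0 < r) (N : ℕ)
    (φ : 𝓢(EuclideanSpace ℝ (Fin n), ℂ)) (s : Finset (ℕ × ℕ)) :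
    ∃ A : ℝ, 0 ≤ A ∧ ∀ g κ, StripBound n r κ N g →
      s.sup (schwartzSeminormFamily ℂ (EuclideanSpace ℝ (Fin n)) ℂ) (stripMul g φ) ≤ A * κ := by
  choose A hA hb using fun p : ℕ × ℕ => exists_seminorm_stripMul_le hr N φ p.1 p.2
  refine ⟨∑ p ∈ s, A p, Finset.sum_nonneg fun p _ => hA p, fun g κ hg => ?_⟩
  have hκ := hg.nonneg hr
  refine Seminorm.finset_sup_apply_le (mul_nonneg (Finset.sum_nonneg fun p _ => hA p) hκ)
    fun p hp => (hb p g κ hg).trans ?_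
  gcongr
  exact Finset.single_le_sum (f := A) (fun p _ => hA p) hp

end StripBound

end StripMultipliers

/-! ### The fundamental solutions as differentiable families of strip multipliers. -/

section FundamentalStrip

open Set Metric

variable {n : ℕ} {a : Fin n → Fin n → ℝ → ℝ} {K : ℕ} {ε c C N : ℝ}

namespace WKBBounds

theorem hasDerivAt_fundSol (h : WKBBounds a K ε c C N) (j : Fin 2) (t : ℝ)
    (z : EuclideanSpace ℂ (Fin n)) : HasDerivAt (fun t => fundSol a j t z) (fundVel a j t z) t :=
  hasDerivAt_picardSol (continuous_complexForm h.coeff z) (h.picard_bound z) t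

theorem hasDerivAt_fundVel (h : WKBBounds a K ε c C N) (j : Fin 2) (t : ℝ)
    (z : EuclideanSpace ℂ (Fin n)) :
    HasDerivAt (fun t => fundVel a j t z) (-(complexForm a t z * fundSol a j t z)) t :=
  hasDerivAt_picardVel (continuous_complexForm h.coeff z) (h.picard_bound z) t

/-- The width `1/(1 + T)` is admissible for all times up to `T`. There the solutions are bounded,
`q` and the velocities grow like `(1 + |ξ|)²`, and the Lipschitz bound for `q v` contains `q` times
an increment of `v`, hence the common exponent 4. -/
theorem exists_stripBound (h : WKBBounds a K ε c C N) {T : ℝ} (hT : 0 ≤ T) :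
    ∃ M : ℝ, 0 < M ∧ (∀ s, StripBound n (1 / (1 + T)) M 4 (complexForm a s)) ∧
      ∀ j, ∀ s ∈ Icc 0 T, StripBound n (1 / (1 + T)) M 4 (fundSol a j s) ∧
      StripBound n (1 / (1 + T)) M 4 (fundVel a j s) ∧ ∀ t ∈ Icc 0 T,
      StripBound n (1 / (1 + T)) (M * |s - t| ^ 2) 4
        (fun z => fundSol a j s z - fundSol a j t z - ((s - t : ℝ) : ℂ) * fundVel a j t z) ∧
      StripBound n (1 / (1 + T)) (M * |s - t| ^ 2) 4
        (fun z => fundVel a j s z - fundVel a j t z -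
          ((s - t : ℝ) : ℂ) * -(complexForm a t z * fundSol a j t z)) := by
  obtain ⟨D, hD, hsol⟩ := h.exists_norm_fundSol_le
  obtain ⟨A, hA, -, -, hlip⟩ := exists_bound_complexForm h.coeff
  have hC := h.C_pos
  set M : ℝ := D * (1 + T) + C + A with hM
  have hM0 : 0 < M := by positivity
  set M₁ : ℝ := 1 + M ^ 2 * T with hM₁
  have hM₁0 : 0 < M₁ := by positivity
  have hz1 : ∀ (ξ : EuclideanSpace ℝ (Fin n)) z, ‖z - complexify n ξ‖ < 1 / (1 + T) →
      ‖z‖ ≤ 1 + ‖ξ‖ := fun ξ z hz => by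
    have e1 : ‖z‖ ≤ ‖z - complexify n ξ‖ + ‖ξ‖ := by
      have := norm_add_le (z - complexify n ξ) (complexify n ξ)
      rwa [sub_add_cancel, norm_complexify] at this
    have : 1 / (1 + T) ≤ 1 := (div_le_one (by linarith)).2 (by linarith)
    linarith
  have hX : ∀ ξ : EuclideanSpace ℝ (Fin n), 1 ≤ (1 + ‖ξ‖) ^ 2 := fun ξ =>
    one_le_pow₀ (by linarith [norm_nonneg ξ])
  have hX4 : ∀ ξ : EuclideanSpace ℝ (Fin n), (1 + ‖ξ‖) ^ 2 ≤ (1 + ‖ξ‖) ^ 4 := fun ξ =>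
    pow_le_pow_right₀ (by linarith [norm_nonneg ξ]) (by norm_num)
  have bq : ∀ s ξ z, ‖z - complexify n ξ‖ < 1 / (1 + T) →
      ‖complexForm a s z‖ ≤ M * (1 + ‖ξ‖) ^ 2 := fun s ξ z hz => by
    refine (h.form_le s z).trans ?_
    have : C ≤ M := by rw [hM]; linarith [mul_nonneg hD.le (by linarith : 0 ≤ 1 + T)]
    gcongr
    exact hz1 ξ z hz
  have bql : ∀ s ∈ Icc 0 T, ∀ t ∈ Icc 0 T, ∀ ξ z, ‖z - complexify n ξ‖ < 1 / (1 + T) →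
      ‖complexForm a s z - complexForm a t z‖ ≤ M * |s - t| * (1 + ‖ξ‖) ^ 2 :=
    fun s hs t ht ξ z hz => by
    refine (hlip s t hs.1 ht.1 z).trans ?_
    have : A ≤ M := by rw [hM]; linarith [mul_nonneg hD.le (by linarith : 0 ≤ 1 + T)]
    gcongr
    exact hz1 ξ z hz
  have bv : ∀ j, ∀ s ∈ Icc 0 T, ∀ ξ z, ‖z - complexify n ξ‖ < 1 / (1 + T) →
      ‖fundSol a j s z‖ ≤ M := fun j s hs ξ z hz => by
    have hs0 := hs.1
    refine (hsol j ξ s hs.1 z (hz.trans_le ?_)).trans ?_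
    · exact one_div_le_one_div_of_le (by linarith) (by linarith [hs.2])
    · have h1 : (1 + s) ^ (j : ℕ) ≤ 1 + T := by
        fin_cases j
        · simpa using hT
        · simpa using hs.2
      calc D * (1 + s) ^ (j : ℕ) ≤ D * (1 + T) := by gcongr
        _ ≤ M := by rw [hM]; linarith
  have bw' : ∀ j, ∀ s ∈ Icc 0 T, ∀ t ∈ Icc 0 T, ∀ ξ z, ‖z - complexify n ξ‖ < 1 / (1 + T) →
      ‖fundVel a j s z - fundVel a j t z‖ ≤ M ^ 2 * (1 + ‖ξ‖) ^ 2 * |s - t| :=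
    fun j s hs t ht ξ z hz =>
    (convex_Icc 0 T).norm_image_sub_le_of_norm_hasDerivWithin_le
      (fun σ _ => (h.hasDerivAt_fundVel j σ z).hasDerivWithinAt) (fun σ hσ => by
        rw [norm_neg, norm_mul]
        calc _ ≤ (M * (1 + ‖ξ‖) ^ 2) * M := by
              gcongr
              exacts [bq σ ξ z hz, bv j σ hσ ξ z hz]
          _ = _ := by ring) ht hs
  have bw : ∀ j, ∀ s ∈ Icc 0 T, ∀ ξ z, ‖z - complexify n ξ‖ < 1 / (1 + T) →
      ‖fundVel a j s z‖ ≤ M₁ * (1 + ‖ξ‖) ^ 2 := fun j s hs ξ z hz => by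
    have h1 := bw' j s hs 0 ⟨le_rfl, hT⟩ ξ z hz
    have h2 : ‖fundVel a j 0 z‖ ≤ 1 := by
      rw [fundVel, picardVel_zero]
      fin_cases j <;> simp
    rw [sub_zero, abs_of_nonneg hs.1] at h1
    have h3 : M ^ 2 * (1 + ‖ξ‖) ^ 2 * s ≤ M ^ 2 * (1 + ‖ξ‖) ^ 2 * T := by
      gcongr
      exact hs.2
    have h4 := norm_le_norm_add_norm_sub' (fundVel a j s z) (fundVel a j 0 z)
    rw [hM₁, add_mul, one_mul]
    linarith [hX ξ]
  have bv' : ∀ j, ∀ s ∈ Icc 0 T, ∀ t ∈ Icc 0 T, ∀ ξ z, ‖z - complexify n ξ‖ < 1 / (1 + T) →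
      ‖fundSol a j s z - fundSol a j t z‖ ≤ M₁ * (1 + ‖ξ‖) ^ 2 * |s - t| :=
    fun j s hs t ht ξ z hz =>
    (convex_Icc 0 T).norm_image_sub_le_of_norm_hasDerivWithin_le
      (fun σ _ => (h.hasDerivAt_fundSol j σ z).hasDerivWithinAt)
      (fun σ hσ => bw j σ hσ ξ z hz) ht hs
  have dq := differentiable_complexForm (a := a)
  have dv : ∀ j s, Differentiable ℂ (fundSol a j s) := fun j s => (h.differentiable_picard _ _ s).1
  have dw : ∀ j s, Differentiable ℂ (fundVel a j s) := fun j s => (h.differentiable_picard _ _ s).2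
  set M₂ : ℝ := M ^ 2 + M * M₁ with hM₂
  have hM₂0 : 0 < M₂ := by positivity
  have up : ∀ x y : ℝ, 0 ≤ x → x ≤ M + M₁ + M₂ → ∀ ξ : EuclideanSpace ℝ (Fin n), 0 ≤ y →
      x * (1 + ‖ξ‖) ^ 2 * y ≤ (M + M₁ + M₂) * y * (1 + ‖ξ‖) ^ 4 := fun x y hx hxM ξ hy => by
    calc x * (1 + ‖ξ‖) ^ 2 * y ≤ (M + M₁ + M₂) * (1 + ‖ξ‖) ^ 4 * y := by
          gcongr
          · linarith [norm_nonneg ξ]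
          · norm_num
      _ = _ := by ring
  refine ⟨M + M₁ + M₂, by positivity, fun s => ⟨dq s, fun ξ z hz => ?_⟩, fun j s hs =>
    ⟨⟨dv j s, fun ξ z hz => ?_⟩, ⟨dw j s, fun ξ z hz => ?_⟩, fun t ht => ⟨⟨?_, fun ξ z hz => ?_⟩,
      ⟨?_, fun ξ z hz => ?_⟩⟩⟩⟩
  · simpa using (bq s ξ z hz).trans (by simpa using up M 1 hM0.le (by linarith) ξ zero_le_one)
  · refine (bv j s hs ξ z hz).trans ((le_mul_of_one_le_right hM0.le (hX ξ)).trans ?_)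
    simpa using up M 1 hM0.le (by linarith) ξ zero_le_one
  · refine (bw j s hs ξ z hz).trans ?_
    simpa using up M₁ 1 hM₁0.le (by linarith) ξ zero_le_one
  · exact ((dv j s).sub (dv j t)).sub ((dw j t).const_mul _)
  · refine (norm_taylor_le (convex_Icc 0 T) (L := M ^ 2 * (1 + ‖ξ‖) ^ 2) (by positivity)
      (fun σ _ => (h.hasDerivAt_fundSol j σ z).hasDerivWithinAt) ht
      (fun σ hσ => bw' j σ hσ t ht ξ z hz) hs).trans ?_
    exact up _ _ (by positivity) (by
      have : 0 < M * M₁ := by positivity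
      rw [hM₂]; linarith) ξ (by positivity)
  · exact ((dw j s).sub (dw j t)).sub (((dq t).mul (dv j t)).neg.const_mul _)
  · have key : ∀ σ ∈ Icc 0 T, ‖-(complexForm a σ z * fundSol a j σ z) -
        -(complexForm a t z * fundSol a j t z)‖ ≤ M₂ * (1 + ‖ξ‖) ^ 4 * |σ - t| := fun σ hσ => by
      have e : -(complexForm a σ z * fundSol a j σ z) - -(complexForm a t z * fundSol a j t z) =
          -((complexForm a σ z - complexForm a t z) * fundSol a j σ z +
            complexForm a t z * (fundSol a j σ z - fundSol a j t z)) := by ring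
      rw [e, norm_neg]
      refine (norm_add_le _ _).trans ?_
      rw [norm_mul, norm_mul]
      calc _ ≤ (M * |σ - t| * (1 + ‖ξ‖) ^ 2) * M +
            (M * (1 + ‖ξ‖) ^ 2) * (M₁ * (1 + ‖ξ‖) ^ 2 * |σ - t|) := by
            gcongr
            exacts [bql σ hσ t ht ξ z hz, bv j σ hσ ξ z hz, bq t ξ z hz, bv' j σ hσ t ht ξ z hz]
        _ = M ^ 2 * |σ - t| * (1 + ‖ξ‖) ^ 2 + M * M₁ * |σ - t| * (1 + ‖ξ‖) ^ 4 := by ring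
        _ ≤ M ^ 2 * |σ - t| * (1 + ‖ξ‖) ^ 4 + M * M₁ * |σ - t| * (1 + ‖ξ‖) ^ 4 := by
            exact add_le_add_left (mul_le_mul_of_nonneg_left (hX4 ξ) (by positivity)) _
        _ = _ := by rw [hM₂]; ring
    refine (norm_taylor_le (convex_Icc 0 T) (by positivity)
      (fun σ _ => (h.hasDerivAt_fundVel j σ z).hasDerivWithinAt) ht key hs).trans ?_
    calc M₂ * (1 + ‖ξ‖) ^ 4 * |s - t| ^ 2 = M₂ * |s - t| ^ 2 * (1 + ‖ξ‖) ^ 4 := by ring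
      _ ≤ _ := by gcongr; linarith

end WKBBounds

end FundamentalStrip

/-! ### Duality argument for distributional solutions. -/

section Distributions

open Set Filter Topology Asymptotics

variable {n : ℕ} {a : Fin n → Fin n → ℝ → ℝ}

/-- Families of tempered distributions that solve `U'' + q U = 0`, `q` acting by multiplication. -/
structure IsFourierSolution (a : Fin n → Fin n → ℝ → ℝ)
    (U : ℝ → 𝓢(EuclideanSpace ℝ (Fin n), ℂ) →L[ℂ] ℂ) : Prop where
  contDiffOn : ∀ φ, ContDiffOn ℝ 2 (fun t => U t φ) (Ici 0)
  equation : ∀ φ t, 0 ≤ t → iteratedDerivWithin 2 (fun t => U t φ) (Ici 0) t =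
    -U t (stripMul (complexForm a t) φ)

namespace IsFourierSolution

variable {U : ℝ → 𝓢(EuclideanSpace ℝ (Fin n), ℂ) →L[ℂ] ℂ}

theorem hasDerivWithinAt (hU : IsFourierSolution a U) (φ : 𝓢(EuclideanSpace ℝ (Fin n), ℂ)) {t : ℝ}
    (ht : 0 ≤ t) : HasDerivWithinAt (fun t => U t φ)
      (derivWithin (fun t => U t φ) (Ici 0) t) (Ici 0) t :=
  ((hU.contDiffOn φ).differentiableOn (by norm_num) t ht).hasDerivWithinAt

/-- The velocities are continuous functionals. -/
theorem exists_velocity (hU : IsFourierSolution a U) :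
    ∃ D : ℝ → 𝓢(EuclideanSpace ℝ (Fin n), ℂ) →L[ℂ] ℂ, ∀ t, 0 ≤ t → ∀ φ,
      HasDerivWithinAt (fun t => U t φ) (D t φ) (Ici 0) t ∧
      HasDerivWithinAt (fun t => D t φ) (-U t (stripMul (complexForm a t) φ)) (Ici 0) t := by
  have h1 : ∀ t, 0 ≤ t → ∃ D : 𝓢(EuclideanSpace ℝ (Fin n), ℂ) →L[ℂ] ℂ, ∀ φ,
      D φ = derivWithin (fun t => U t φ) (Ici 0) t := fun t ht => by
    -- The velocity is a pointwise limit of difference quotients, which are continuous functionals;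
    -- Banach–Steinhaus on the Schwartz space makes the limit continuous.
    have hlim : Tendsto (fun s φ => ((((s - t : ℝ) : ℂ)⁻¹ • (U s - U t) :
        𝓢(EuclideanSpace ℝ (Fin n), ℂ) →L[ℂ] ℂ)) φ) (𝓝[>] t)
        (𝓝 fun φ => derivWithin (fun t => U t φ) (Ici 0) t) := by
      refine tendsto_pi_nhds.2 fun φ => ?_
      have := hasDerivWithinAt_iff_tendsto_slope.1 (hU.hasDerivWithinAt φ ht)
      refine (this.mono_left (nhdsWithin_mono t fun s hs => ⟨ht.trans (le_of_lt hs),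
        ne_of_gt hs⟩)).congr fun s => ?_
      simp [slope_def_module]
    exact ⟨continuousLinearMapOfTendsto _ hlim, fun φ => rfl⟩
  choose! D hD using h1
  refine ⟨D, fun t ht φ => ⟨?_, ?_⟩⟩
  · rw [hD t ht φ]
    exact hU.hasDerivWithinAt φ ht
  · have h2 : HasDerivWithinAt (derivWithin (fun t => U t φ) (Ici 0))
        (derivWithin (derivWithin (fun t => U t φ) (Ici 0)) (Ici 0) t) (Ici 0) t :=
      (((hU.contDiffOn φ).derivWithin (uniqueDiffOn_Ici 0) (m := 1) (by norm_num)).differentiableOn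
        (by norm_num) t ht).hasDerivWithinAt
    have h3 := hU.equation φ t ht
    rw [iteratedDerivWithin_succ] at h3
    have h4 : derivWithin (iteratedDerivWithin 1 (fun t => U t φ) (Ici 0)) (Ici 0) t =
        derivWithin (derivWithin (fun t => U t φ) (Ici 0)) (Ici 0) t := by
      rw [iteratedDerivWithin_one]
    rw [h4] at h3
    rw [← h3]
    exact h2.congr (fun s hs => hD s hs φ) (hD t ht φ)

variable {K : ℕ} {ε c C N : ℝ}

theorem exists_equicontinuity_bound {B : ℝ → 𝓢(EuclideanSpace ℝ (Fin n), ℂ) →L[ℂ] ℂ} {T : ℝ}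
    (hB : ∀ φ, ContinuousOn (fun t => B t φ) (Icc 0 T)) :
    ∃ (s : Finset (ℕ × ℕ)) (A : ℝ), 0 ≤ A ∧ ∀ t ∈ Icc 0 T, ∀ φ,
      ‖B t φ‖ ≤ A * s.sup (schwartzSeminormFamily ℂ (EuclideanSpace ℝ (Fin n)) ℂ) φ := by
  obtain ⟨s, A, hA, hb⟩ := SchwartzMap.exists_seminorm_bound_of_pointwise
    (fun t : Icc 0 T => B t) fun φ => by
      obtain ⟨M, hM⟩ := isCompact_Icc.exists_bound_of_continuousOn (hB φ)
      exact ⟨M, fun t => hM t t.2⟩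
  exact ⟨s, A, hA, fun t ht φ => hb ⟨t, ht⟩ φ⟩

theorem isLittleO_sup_seminorm {r M : ℝ} (hr : 0 < r) {N : ℕ}
    (φ : 𝓢(EuclideanSpace ℝ (Fin n), ℂ)) (s : Finset (ℕ × ℕ)) {S : Set ℝ} {t : ℝ}
    {g : ℝ → EuclideanSpace ℂ (Fin n) → ℂ}
    (hg : ∀ σ ∈ S, StripBound n r (M * |σ - t| ^ 2) N (g σ)) :
    (fun σ => s.sup (schwartzSeminormFamily ℂ (EuclideanSpace ℝ (Fin n)) ℂ)
      (stripMul (g σ) φ)) =o[𝓝[S] t] fun σ => σ - t := by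
  obtain ⟨A, hA, hb⟩ := StripBound.exists_sup_seminorm_stripMul_le hr N φ s
  have h1 : (fun σ : ℝ => ‖σ - t‖ ^ 2) =o[𝓝[S] t] fun σ => σ - t :=
    (isLittleO_pow_sub_sub t one_lt_two).mono nhdsWithin_le_nhds
  refine IsBigO.trans_isLittleO (IsBigO.of_bound (A * M) ?_) h1
  filter_upwards [self_mem_nhdsWithin] with σ hσ
  rw [Real.norm_of_nonneg (apply_nonneg _ _), norm_pow, norm_norm, Real.norm_eq_abs, mul_assoc]
  exact hb _ _ (hg σ hσ)

/-- Formally the derivative is `-⟨U, q v φ⟩ + ⟨U', v' φ⟩ - ⟨U', v' φ⟩ + ⟨U, q v φ⟩ = 0`. The product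
rule is legitimate because on the compact interval the functionals are equicontinuous and the
multipliers have quadratic Taylor remainders. -/
theorem wronskian_const (h : WKBBounds a K ε c C N)
    {D : ℝ → 𝓢(EuclideanSpace ℝ (Fin n), ℂ) →L[ℂ] ℂ}
    (hD : ∀ t, 0 ≤ t → ∀ φ, HasDerivWithinAt (fun t => U t φ) (D t φ) (Ici 0) t ∧
      HasDerivWithinAt (fun t => D t φ) (-U t (stripMul (complexForm a t) φ)) (Ici 0) t)
    (j : Fin 2) {T : ℝ} (hT : 0 ≤ T) (φ : 𝓢(EuclideanSpace ℝ (Fin n), ℂ)) :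
    D T (stripMul (fundSol a j T) φ) - U T (stripMul (fundVel a j T) φ) =
      D 0 (stripMul (fundSol a j 0) φ) - U 0 (stripMul (fundVel a j 0) φ) := by
  obtain ⟨M, hM, hq, hs⟩ := h.exists_stripBound hT
  have hr : 0 < 1 / (1 + T) := by positivity
  have hsub : Icc 0 T ⊆ Ici 0 := fun x hx => hx.1
  have cU : ∀ φ, ContinuousOn (fun t => U t φ) (Icc 0 T) := fun φ t ht =>
    (hD t ht.1 φ).1.continuousWithinAt.mono hsub
  have cD : ∀ φ, ContinuousOn (fun t => D t φ) (Icc 0 T) := fun φ t ht =>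
    (hD t ht.1 φ).2.continuousWithinAt.mono hsub
  obtain ⟨sU, AU, -, bU⟩ := exists_equicontinuity_bound cU
  obtain ⟨sD, AD, -, bD⟩ := exists_equicontinuity_bound cD
  have hd : ∀ t ∈ Icc 0 T, HasDerivWithinAt
      (fun s => D s (stripMul (fundSol a j s) φ) - U s (stripMul (fundVel a j s) φ)) 0
      (Icc 0 T) t := fun t ht => by
    have b1 := fun s hs' => ((hs j s hs').2.2 t ht).1
    have b2 := fun s hs' => ((hs j s hs').2.2 t ht).2
    have sol := fun s hs' => (hs j s hs').1
    have vel := fun s hs' => (hs j s hs').2.1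
    have acc : StripBound n (1 / (1 + T)) (M * M) (4 + 4)
        fun z => -(complexForm a t z * fundSol a j t z) :=
      ⟨((hq t).differentiable.mul (sol t ht).differentiable).neg, fun ξ z hz => by
        rw [norm_neg, norm_mul, pow_add, mul_mul_mul_comm]
        gcongr
        exacts [(hq t).bound ξ z hz, (sol t ht).bound ξ z hz]⟩
    have d1 := hasDerivWithinAt_pairing (B := fun s => (D s).toLinearMap)
      (ψ := fun s => stripMul (fundSol a j s) φ) (ψ' := stripMul (fundVel a j t) φ) bD
      ((hD t ht.1 _).2.mono hsub) (cD _ t ht) (by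
        refine (isLittleO_sup_seminorm hr φ sD (fun σ hσ => b1 σ hσ)).congr' ?_ .rfl
        filter_upwards [self_mem_nhdsWithin] with σ hσ
        congr 1
        ext ξ
        simp only [sub_apply, smul_apply, smul_eq_mul]
        rw [(b1 σ hσ).stripMul_apply hr, (sol σ hσ).stripMul_apply hr,
          (sol t ht).stripMul_apply hr, (vel t ht).stripMul_apply hr]
        ring)
    have d2 := hasDerivWithinAt_pairing (B := fun s => (U s).toLinearMap)
      (ψ := fun s => stripMul (fundVel a j s) φ)
      (ψ' := stripMul (fun z => -(complexForm a t z * fundSol a j t z)) φ) bU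
      ((hD t ht.1 _).1.mono hsub) (cU _ t ht) (by
        refine (isLittleO_sup_seminorm hr φ sU (fun σ hσ => b2 σ hσ)).congr' ?_ .rfl
        filter_upwards [self_mem_nhdsWithin] with σ hσ
        congr 1
        ext ξ
        simp only [sub_apply, smul_apply, smul_eq_mul]
        rw [(b2 σ hσ).stripMul_apply hr, (vel σ hσ).stripMul_apply hr,
          (vel t ht).stripMul_apply hr, acc.stripMul_apply hr]
        ring)
    refine (d1.sub d2).congr_deriv ?_
    have e : stripMul (fun z => -(complexForm a t z * fundSol a j t z)) φ =
        -stripMul (complexForm a t) (stripMul (fundSol a j t) φ) := by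
      ext ξ
      rw [neg_apply, acc.stripMul_apply hr, (hq t).stripMul_apply hr,
        (sol t ht).stripMul_apply hr]
      ring
    simp only [e, map_neg, ContinuousLinearMap.coe_coe]
    ring
  exact constant_of_derivWithin_zero (fun t ht => (hd t ht).differentiableWithinAt)
    (fun t ht => (hd t ⟨ht.1, ht.2.le⟩).derivWithin
      (uniqueDiffOn_Icc (ht.1.trans_lt ht.2) t ⟨ht.1, ht.2.le⟩)) T ⟨hT, le_rfl⟩

/-- The solutions are given by the fundamental solutions as multipliers. -/
theorem eq_fundSol (hU : IsFourierSolution a U) (h : WKBBounds a K ε c C N)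
    {U₁ : 𝓢(EuclideanSpace ℝ (Fin n), ℂ) → ℂ}
    (h₁ : ∀ φ, derivWithin (fun t => U t φ) (Ici 0) 0 = U₁ φ) {T : ℝ} (hT : 0 ≤ T)
    (φ : 𝓢(EuclideanSpace ℝ (Fin n), ℂ)) :
    U T φ = U 0 (stripMul (fundSol a 0 T) φ) + U₁ (stripMul (fundSol a 1 T) φ) := by
  obtain ⟨D, hD⟩ := hU.exists_velocity
  obtain ⟨M, hM, -, hs⟩ := h.exists_stripBound hT
  have hr : 0 < 1 / (1 + T) := by positivity
  have hT0 : (0 : ℝ) ∈ Icc 0 T := ⟨le_rfl, hT⟩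
  have hTT : T ∈ Icc 0 T := ⟨hT, le_rfl⟩
  have hD0 : ∀ φ, D 0 φ = U₁ φ := fun φ => by
    rw [← h₁]
    exact ((hD 0 le_rfl φ).1.derivWithin (uniqueDiffOn_Ici 0 0 self_mem_Ici)).symm
  have s0 : ∀ j ψ, stripMul (fundSol a j 0) ψ = ((![1, 0] j : ℂ)) • ψ := fun j ψ => by
    ext ξ
    rw [((hs j 0 hT0).1).stripMul_apply hr, fundSol, picardSol_zero, smul_apply,
      smul_eq_mul]
  have v0 : ∀ j ψ, stripMul (fundVel a j 0) ψ = ((![0, 1] j : ℂ)) • ψ := fun j ψ => by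
    ext ξ
    rw [((hs j 0 hT0).2.1).stripMul_apply hr, fundVel, picardVel_zero, smul_apply,
      smul_eq_mul]
  -- The test functions are crossed: `v_1(T) φ` for `j = 0` and `v_0(T) φ` for `j = 1`. In the
  -- difference the unknown velocity at `T` cancels, since multiplications commute, and the
  -- remaining multiplier is the scalar Wronskian, equal to 1.
  have e0 := wronskian_const h hD 0 hT (stripMul (fundSol a 1 T) φ)
  have e1 := wronskian_const h hD 1 hT (stripMul (fundSol a 0 T) φ)
  simp only [s0, v0] at e0 e1
  simp only [Matrix.cons_val_zero, Matrix.cons_val_one, one_smul, zero_smul, map_zero, sub_zero,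
    zero_sub] at e0 e1
  have comm : stripMul (fundSol a 1 T) (stripMul (fundSol a 0 T) φ) =
      stripMul (fundSol a 0 T) (stripMul (fundSol a 1 T) φ) := by
    ext ξ
    rw [(hs 1 T hTT).1.stripMul_apply hr, (hs 0 T hTT).1.stripMul_apply hr,
      (hs 0 T hTT).1.stripMul_apply hr, (hs 1 T hTT).1.stripMul_apply hr]
    ring
  have wr : φ = stripMul (fundVel a 1 T) (stripMul (fundSol a 0 T) φ) -
      stripMul (fundVel a 0 T) (stripMul (fundSol a 1 T) φ) := by
    ext ξ
    rw [sub_apply, (hs 1 T hTT).2.1.stripMul_apply hr,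
      (hs 0 T hTT).1.stripMul_apply hr, (hs 0 T hTT).2.1.stripMul_apply hr,
      (hs 1 T hTT).1.stripMul_apply hr, ← mul_assoc, ← mul_assoc, ← sub_mul]
    have := picard_wronskian (continuous_complexForm h.coeff (complexify n ξ))
      (h.picard_bound (complexify n ξ)) T
    have w : fundVel a 1 T (complexify n ξ) * fundSol a 0 T (complexify n ξ) -
        fundVel a 0 T (complexify n ξ) * fundSol a 1 T (complexify n ξ) = 1 := by
      rw [← this]
      simp only [fundSol, fundVel, Matrix.cons_val_zero, Matrix.cons_val_one]
      ring
    rw [w, one_mul]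
  rw [comm] at e1
  have wr' := congrArg (U T) wr
  rw [map_sub] at wr'
  rw [← hD0, wr']
  linear_combination e0 - e1

end IsFourierSolution

/-! ### The equation on the Fourier side. -/

section Fourier

/-- The factor `(2π)⁻¹` from the dilation cancels the `2π` in the differentiation rule of the
unitary Fourier transform. -/
theorem lineDerivOp_schwartzFourier (φ : 𝓢(EuclideanSpace ℝ (Fin n), ℂ))
    (m : EuclideanSpace ℝ (Fin n)) :
    ∂_{m} (schwartzFourier n φ) =
      schwartzFourier n (-Complex.I • SchwartzMap.smulLeftCLM ℂ (fun ξ => inner ℝ ξ m) φ) := by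
  have e : dilation n m = (2 * Real.pi)⁻¹ • m := rfl
  have e1 : ∀ ψ, schwartzFourier n ψ = SchwartzMap.compCLMOfContinuousLinearEquiv ℂ (dilation n)
      (𝓕 ψ : 𝓢(EuclideanSpace ℝ (Fin n), ℂ)) := fun ψ => rfl
  rw [e1, e1, SchwartzMap.lineDerivOp_compCLMOfContinuousLinearEquiv, e, LineDeriv.lineDerivOp_left_smul,
    SchwartzMap.lineDerivOp_fourier_eq]
  congr 1
  rw [FourierTransform.fourier_smul, FourierTransform.fourier_smul, ← Complex.coe_smul, smul_smul]
  congr 1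
  push_cast
  have : (Real.pi : ℂ) ≠ 0 := by exact_mod_cast Real.pi_ne_zero
  field_simp

/-- The derivatives stand in reversed order because that is how they appear on the test function
after transposition from the distribution; the two minus signs of the transposition cancel, and the
sign here is that of `(-i)²`. -/
theorem stripMul_complexForm_eq {r κ : ℝ} (hr : 0 < r) {N : ℕ} {t : ℝ} (ht : 0 ≤ t)
    (hq : StripBound n r κ N (complexForm a t)) (φ : 𝓢(EuclideanSpace ℝ (Fin n), ℂ)) :
    schwartzFourier n (stripMul (complexForm a t) φ) = -∑ i, ∑ j, (a i j t : ℂ) •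
      ∂_{EuclideanSpace.single j (1 : ℝ)} (∂_{EuclideanSpace.single i (1 : ℝ)}
        (schwartzFourier n φ)) := by
  simp only [lineDerivOp_schwartzFourier, ← map_smul, ← map_sum, ← map_neg]
  congr 1
  have hm : ∀ m : EuclideanSpace ℝ (Fin n), (fun ξ => inner ℝ ξ m : _ → ℝ).HasTemperateGrowth :=
    fun m => ((innerSL ℝ).flip m).hasTemperateGrowth
  have hs : ∀ (ξ : EuclideanSpace ℝ (Fin n)) (i : Fin n),
      inner ℝ ξ (EuclideanSpace.single i (1 : ℝ)) = ξ i := fun ξ i => by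
    simp [EuclideanSpace.inner_single_right]
  ext ξ
  rw [hq.stripMul_apply hr, complexForm_complexify ht]
  simp only [neg_apply, sum_apply, smul_apply, SchwartzMap.smulLeftCLM_apply_apply (hm _)]
  simp only [symbolForm, hs, smul_eq_mul, Complex.real_smul,
    Complex.ofReal_sum, Complex.ofReal_mul, Finset.sum_mul, ← Finset.sum_neg_distrib]
  refine Finset.sum_congr rfl fun i _ => Finset.sum_congr rfl fun j _ => ?_
  linear_combination ((a i j t : ℂ) * ξ i * ξ j * φ ξ) * Complex.I_mul_I

theorem IsSolution.isFourierSolution {K : ℕ} {ε c C N : ℝ} (h : WKBBounds a K ε c C N)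
    {u₀ u₁ : 𝓢'(EuclideanSpace ℝ (Fin n), ℂ)} {u : ℝ → 𝓢'(EuclideanSpace ℝ (Fin n), ℂ)}
    (hu : IsSolution a u₀ u₁ u) :
    IsFourierSolution a fun t => (distFourier (u t) : 𝓢(EuclideanSpace ℝ (Fin n), ℂ) →L[ℂ] ℂ) := by
  refine ⟨fun φ => hu.contDiffOn (schwartzFourier n φ), fun φ t ht => ?_⟩
  obtain ⟨M, hM, hq, -⟩ := h.exists_stripBound le_rfl
  refine (hu.equation (schwartzFourier n φ) t ht).trans ?_
  change _ = -(u t (schwartzFourier n (stripMul (complexForm a t) φ)))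
  rw [stripMul_complexForm_eq (by norm_num) ht (hq t)]
  simp [-Complex.coe_smul]

end Fourier

end Distributions

/-! ### The representation theorem. -/

theorem mainTheorem5 (n : ℕ) (a : Fin n → Fin n → ℝ → ℝ)
    (ha : ∀ i j, IsSymbolT 0 (a i j)) (hell : UniformlyElliptic a) (k : ℕ) (hk : 1 ≤ k) :
    ∃ c : ℝ, 0 < c ∧
      ∃ (bhyp : Fin 2 → ℤˣ → ℝ → EuclideanSpace ℝ (Fin n) → ℂ)
        (bpd : Fin 2 → ℝ → EuclideanSpace ℝ (Fin n) → ℂ),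
        -- smoothness in `ξ`
        (∀ j s t, 0 ≤ t → ContDiff ℝ ∞ (bhyp j s t)) ∧
        (∀ j t, 0 ≤ t → ContDiff ℝ ∞ (bpd j t)) ∧
        -- supports
        (∀ j s t ξ, 0 ≤ t → bhyp j s t ξ ≠ 0 → (t, ξ) ∈ hypZone n c) ∧
        (∀ j t ξ, 0 ≤ t → bpd j t ξ ≠ 0 → (t, ξ) ∈ pdZone n (2 * c)) ∧
        -- symbol estimates for `|α| ≤ (k - 1) / 2`
        (∀ j s, ∀ m : ℕ, 2 * m + 1 ≤ k → ∃ C : ℝ, ∀ t ξ, 0 ≤ t → ξ ≠ 0 →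
          ‖iteratedFDeriv ℝ m (bhyp j s t) ξ‖ ≤ C * ‖ξ‖ ^ (-(m : ℤ) - ((j : ℕ) : ℤ))) ∧
        -- bounds in the pseudo-differential zone
        (∀ j, ∃ C : ℝ, ∀ t ξ, 0 ≤ t → ‖bpd j t ξ‖ ≤ C * (1 + t) ^ (j : ℕ)) ∧
        -- the representation of all solutions
        (∀ j t, 0 ≤ t →
          Function.HasTemperateGrowth (reprMultiplier a (bhyp j) (bpd j) t)) ∧
        (∀ (u₀ u₁ : 𝓢'(EuclideanSpace ℝ (Fin n), ℂ))
          (u : ℝ → 𝓢'(EuclideanSpace ℝ (Fin n), ℂ)), IsSolution a u₀ u₁ u →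
          ∀ t, 0 ≤ t → distFourier (u t) =
            ∑ j : Fin 2, TemperedDistribution.smulLeftCLM ℂ
              (reprMultiplier a (bhyp j) (bpd j) t) (distFourier (![u₀, u₁] j))) := by
  -- With `K = k` the construction controls derivatives up to order `k`, more than the required `(k
  -- - 1)/2`. The zone constant is then `2 N`, so that the cutoff acts strictly inside the region
  -- `(1 + t)|ξ| ≥ N` where the amplitudes are controlled.
  obtain ⟨ε, c, C, N, h⟩ := exists_wkbBounds ha hell k
  have hN1 := h.one_le_N
  have hc : 0 < 2 * N := by linarith
  have hN : N < 2 * N := by linarith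
  refine ⟨2 * N, hc, hypSymbol a k hc, pdSymbol a hc, fun j s t ht => h.contDiff_hypSymbol hN j s ht,
    fun j t ht => h.contDiff_pdSymbol j t, fun j s t ξ ht hb => ⟨ht, ?_⟩,
    fun j t ξ ht hb => ⟨ht, ?_⟩, fun j s m hm => ?_, fun j => h.exists_norm_pdSymbol_le j,
    fun j t ht => ?_, fun u₀ u₁ u hu t ht => ?_⟩
  · by_contra hlt
    exact hb (hypSymbol_eq_zero hc k j s ht (not_le.1 hlt).le)
  · by_contra hlt
    exact hb (pdSymbol_eq_zero hc j ht (not_lt.1 hlt))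
  · exact h.exists_norm_iteratedFDeriv_hypSymbol_le hN j s (by omega)
  · rw [h.reprMultiplier_eq hN j ht]
    exact h.hasTemperateGrowth_fundSol j ht
  · ext φ
    have key := (hu.isFourierSolution h).eq_fundSol h (U₁ := (distFourier u₁ : _ →L[ℂ] ℂ))
      (fun φ => hu.initial_deriv (schwartzFourier n φ)) ht φ
    rw [hu.initial] at key
    refine key.trans ?_
    simp only [h.reprMultiplier_eq hN _ ht, Fin.sum_univ_two]
    rfl
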